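/- Let $0<\epsilon<\frac16$ be a real number and $M$ a positive integer. Then there is a finite set $\Gamma_0'$ of positive integers, depending only on $\epsilon$ and $M$, with the following property. Let $r$ be a positive integer, $0\le a_1,a_2,a_3,a_4,e<r$ integers, $\xi_r=e^{2\pi i/r}$, $\boldsymbol\mu$ the action $x_i\mapsto \xi_r^{a_i}x_i$ on $\mathbb C^4$, $\mathfrak m$ the maximal ideal of $\mathbb C\{x_1,x_2,x_3,x_4\}$, and $f\in\mathbb C\{x_1,x_2,x_3,x_4\}$ with $\boldsymbol\mu(f)=\xi_r^e f$. Let $Y=(f=0)\subset(\mathbb C^4\ni 0)$ and $X=Y/\boldsymbol\mu$, with $x\in X$ the image of the origin. Suppose that * $Y$ is an isolated cDV singularity, $X\ni x$ is an isolated singularity (that is, the group generated by $\boldsymbol\mu$ acts freely on $Y$ outside the origin), and $Y\to X$ is the index $1$ cover; * $a(E,X)\ne 1$ for every prime divisor $E$ over $X\ni x$ (with center $x$), and $\frac56+\epsilon\le \mathrm{mld}(X\ni x)<1$, where $a(E,X)$ is the log discrepancy and $\mathrm{mld}(X\ni x)$ is the infimum of $a(E,X)$ over all such $E$; * $a_1+a_2+a_3+a_4-e\equiv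 1 \bmod r$; * $f$ is not of cA type but in one of the following normal forms: either $f=x_1^2+x_2^2+g(x_3,x_4)$ with $g\in\mathfrak m^3$ and $a_1\not\equiv a_2\bmod r$, or $f=x_1^2+g(x_2,x_3,x_4)$ with $g\in\mathfrak m^3$. For a weight $w\in\mathbb Q_{\ge0}^4$ and a power series $h\neq 0$ let $w(h)$ be the minimum of $w(\boldsymbol x^{\boldsymbol n})=\sum_i w_in_i$ over the monomials $\boldsymbol x^{\boldsymbol n}$ occurring in $h$. Let $N$ be the set of nonzero $w\in\mathbb Q^4_{\ge 0}$ with $w\equiv\frac1r(ja_1,ja_2,ja_3,ja_4)\bmod\mathbb Z^4$ for some $j\in\mathbb Z$; a vector of $N$ is primitive if it is not $l v$ with $v\in N$ and an integer $l\ge2$. Let $N^0=(N\cap[0,1]^4)\setminus\{0,1\}^4$, let $\alpha_j=(\{\frac{ja_1}r\},\{\frac{ja_2}r\},\{\frac{ja_3}r\},\{\frac{ja_4}r\})$ for $1\le j\le r-1$, and let $\Psi_1$ be the set of primitive $\beta\in N$ with $\frac56+\epsilon\le\beta(x_1x_2x_3x_4)-\beta(f)<1$. Suppose moreover that 1. $2a_1\equiv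 e \bmod r$; 2. $7\le\gcd(a_1,r)=\gcd(e,r)\le M$; 3. $r\mid k_\beta e$ for every $\beta\in\Psi_1\cap N^0$ and every integer $1\le k_\beta\le r-1$ with $\beta=\alpha_{k_\beta}$. Then $r\in\Gamma_0'$. -/

import Mathlib

namespace Hyperquotient

open MvPowerSeries

/-! ### Convergent power series in four variables -/

/-- A power series in `x₁, …, x₄` (indices `0, …, 3` here) with complex coefficients converges
near the origin. -/
def IsConvergent (h : MvPowerSeries (Fin 4) ℂ) : Prop :=
  ∃ ρ : ℝ, 0 < ρ ∧ Summable fun n : Fin 4 →₀ ℕ => ‖coeff n h‖ * ρ ^ n.degree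

theorem IsConvergent.mono {h : MvPowerSeries (Fin 4) ℂ} {ρ ρ' : ℝ} (h0 : 0 ≤ ρ') (h1 : ρ' ≤ ρ)
    (hs : Summable fun n : Fin 4 →₀ ℕ => ‖coeff n h‖ * ρ ^ n.degree) :
    Summable fun n : Fin 4 →₀ ℕ => ‖coeff n h‖ * ρ' ^ n.degree :=
  Summable.of_nonneg_of_le (fun n => by positivity) (fun n => by gcongr) hs

theorem isConvergent_of_finite {h : MvPowerSeries (Fin 4) ℂ} {s : Finset (Fin 4 →₀ ℕ)}
    (hs : ∀ n ∉ s, coeff n h = 0) : IsConvergent h :=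
  ⟨1, one_pos, summable_of_ne_finset_zero (s := s) fun n hn => by simp [hs n hn]⟩

theorem IsConvergent.add {h k : MvPowerSeries (Fin 4) ℂ} (hh : IsConvergent h)
    (hk : IsConvergent k) : IsConvergent (h + k) := by
  obtain ⟨ρ, hρ, hs⟩ := hh
  obtain ⟨σ, hσ, ht⟩ := hk
  have hm : 0 < min ρ σ := lt_min hρ hσ
  refine ⟨min ρ σ, hm, ?_⟩
  refine Summable.of_nonneg_of_le (fun n => by positivity) (fun n => ?_)
    ((IsConvergent.mono hm.le (min_le_left _ _) hs).add
      (IsConvergent.mono hm.le (min_le_right _ _) ht))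
  rw [map_add, ← add_mul]
  gcongr
  exact norm_add_le _ _

theorem summable_convolution {ι : Type*} [AddCommMonoid ι] [Finset.HasAntidiagonal ι]
    (d : ι →+ ℕ) (u v : ι → ℂ) (m : ℝ) (hm : 0 < m)
    (h1 : Summable fun n => ‖u n‖ * m ^ d n) (h2 : Summable fun n => ‖v n‖ * m ^ d n) :
    Summable fun n => ‖∑ p ∈ Finset.HasAntidiagonal.antidiagonal n, u p.1 * v p.2‖ * m ^ d n := by
  have h3 : Summable fun p : ι × ι =>
      (‖u p.1‖ * m ^ d p.1) * (‖v p.2‖ * m ^ d p.2) :=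
    Summable.mul_of_nonneg h1 h2 (fun n => by positivity) (fun n => by positivity)
  have h4 := summable_sum_mul_antidiagonal_of_summable_mul 
    (f := fun n => ‖u n‖ * m ^ d n)
    (g := fun n => ‖v n‖ * m ^ d n) h3
  refine Summable.of_nonneg_of_le (fun n => by positivity) (fun n => ?_) h4
  have : ∀ p ∈ Finset.HasAntidiagonal.antidiagonal n, ‖u p.1‖ * m ^ d p.1 * (‖v p.2‖ * m ^ d p.2) = ‖u p.1‖ * ‖v p.2‖ * m ^ d n := by
    intro p hp
    rw [← Finset.HasAntidiagonal.mem_antidiagonal.mp hp, map_add, pow_add]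
    ring
  rw [Finset.sum_congr rfl this, ← Finset.sum_mul]
  gcongr
  refine (norm_sum_le _ _).trans (Finset.sum_le_sum fun p _ => ?_)
  exact norm_mul_le _ _

theorem IsConvergent.mul {h k : MvPowerSeries (Fin 4) ℂ} (hh : IsConvergent h)
    (hk : IsConvergent k) : IsConvergent (h * k) := by
  classical
  obtain ⟨ρ, hρ, hs⟩ := hh
  obtain ⟨σ, hσ, ht⟩ := hk
  have hm : 0 < min ρ σ := lt_min hρ hσ
  refine ⟨min ρ σ, hm, ?_⟩
  simp only [coeff_mul]
  exact summable_convolution Finsupp.degree (fun n => coeff n h) (fun n => coeff n k) _ hm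
    (IsConvergent.mono hm.le (min_le_left _ _) hs) (IsConvergent.mono hm.le (min_le_right _ _) ht)

theorem isConvergent_C (c : ℂ) : IsConvergent (C c) := by
  classical
  refine isConvergent_of_finite (s := {0}) fun n hn => ?_
  rw [coeff_C, if_neg (by simpa using hn)]

theorem isConvergent_X (i : Fin 4) : IsConvergent (X i) := by
  classical
  refine isConvergent_of_finite (s := {Finsupp.single i 1}) fun n hn => ?_
  rw [coeff_X, if_neg (by simpa using hn)]

/-- The ring `ℂ{x₁, x₂, x₃, x₄}` of convergent power series. -/
def ConvSeries : Subalgebra ℂ (MvPowerSeries (Fin 4) ℂ) where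
  carrier := {h | IsConvergent h}
  mul_mem' := IsConvergent.mul
  add_mem' := IsConvergent.add
  algebraMap_mem' c := isConvergent_C c

noncomputable instance : CommRing ConvSeries := Subalgebra.toCommRing ConvSeries

/-- The coordinate functions. -/
noncomputable def coord (i : Fin 4) : ConvSeries := ⟨X i, isConvergent_X i⟩

theorem IsConvergent.pderiv {h : MvPowerSeries (Fin 4) ℂ} (hh : IsConvergent h) (i : Fin 4) :
    IsConvergent (MvPowerSeries.pderiv ℂ i h) := by
  obtain ⟨ρ, hρ, hs⟩ := hh
  refine ⟨ρ / 2, by positivity, ?_⟩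
  have hinj : Function.Injective fun n : Fin 4 →₀ ℕ => n + Finsupp.single i 1 :=
    add_left_injective _
  have h1 := (hs.comp_injective hinj).mul_right (2 / ρ)
  refine Summable.of_nonneg_of_le (fun n => by positivity) (fun n => ?_) h1
  have hle : ((n i : ℝ) + 1) ≤ 2 * 2 ^ n.degree := by
    have h2 : n i ≤ n.degree := Finsupp.le_degree i n
    have h3 : n.degree + 1 ≤ 2 ^ (n.degree + 1) := Nat.lt_two_pow_self.le
    have h4 : n i + 1 ≤ 2 * 2 ^ n.degree := by rw [pow_succ] at h3; omega
    exact_mod_cast h4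
  have hn : ‖((n i : ℂ) + 1)‖ = (n i : ℝ) + 1 := by
    have : ((n i : ℂ) + 1) = ((n i + 1 : ℕ) : ℂ) := by push_cast; ring
    rw [this, Complex.norm_natCast]; push_cast; ring
  rw [MvPowerSeries.coeff_pderiv, norm_mul, hn, div_pow]
  simp only [Function.comp, map_add, Finsupp.degree_single, pow_add, pow_one]
  have hpos : (0 : ℝ) < 2 ^ n.degree := by positivity
  calc ‖coeff (n + Finsupp.single i 1) h‖ * ((n i : ℝ) + 1) * (ρ ^ n.degree / 2 ^ n.degree)
      ≤ ‖coeff (n + Finsupp.single i 1) h‖ * (2 * 2 ^ n.degree)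
          * (ρ ^ n.degree / 2 ^ n.degree) := by gcongr
    _ = _ := by field_simp

/-- The partial derivative `∂/∂xᵢ` on `ℂ{x₁, x₂, x₃, x₄}`. -/
noncomputable def partialDeriv (i : Fin 4) (h : ConvSeries) : ConvSeries :=
  ⟨MvPowerSeries.pderiv ℂ i h.1, IsConvergent.pderiv h.2 i⟩

/-! ### The action of the cyclic group -/

/-- The primitive root of unity `ξ_r = exp (2πi / r)`. -/
noncomputable def xi (r : ℕ) : ℂ := Complex.exp (2 * Real.pi * Complex.I / r)

theorem norm_xi (r : ℕ) : ‖xi r‖ = 1 := by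
  have h : (2 * Real.pi * Complex.I / r : ℂ) = ((2 * Real.pi / r : ℝ) : ℂ) * Complex.I := by
    push_cast; ring
  rw [xi, h, Complex.norm_exp_ofReal_mul_I]

theorem IsConvergent.rescale {h : MvPowerSeries (Fin 4) ℂ} (hh : IsConvergent h) (r : ℕ)
    (a : Fin 4 → ℕ) : IsConvergent (MvPowerSeries.rescale (fun i => xi r ^ a i) h) := by
  obtain ⟨ρ, hρ, hs⟩ := hh
  refine ⟨ρ, hρ, ?_⟩
  convert hs using 3 with n
  rw [coeff_rescale, norm_mul, Finsupp.prod, norm_prod]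
  simp [norm_xi]

/-- The generator `μ` of the group acting on `ℂ{x₁, …, x₄}` by
`xᵢ ↦ ξ_r ^ aᵢ xᵢ`. -/
noncomputable def mu (r : ℕ) (a : Fin 4 → ℕ) : ConvSeries →ₐ[ℂ] ConvSeries where
  toFun h := ⟨rescale (fun i => xi r ^ a i) h.1, h.2.rescale r a⟩
  map_one' := Subtype.ext (map_one _)
  map_mul' h k := Subtype.ext (map_mul _ _ _)
  map_zero' := Subtype.ext (map_zero _)
  map_add' h k := Subtype.ext (map_add _ _ _)
  commutes' c := by
    classical
    refine Subtype.ext (MvPowerSeries.ext fun n => ?_)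
    change coeff n (rescale _ (C c)) = coeff n (C c)
    rw [coeff_rescale, coeff_C]
    split_ifs with hn
    · simp [hn]
    · simp

/-- The local ring of the germ `Y = (f = 0)` at the origin. -/
abbrev LocalRingY (f : ConvSeries) : Type := ConvSeries ⧸ Ideal.span {f}

noncomputable instance (f : ConvSeries) : CommRing (LocalRingY f) :=
  Ideal.Quotient.commRing (Ideal.span {f})

/-- The class in `𝒪_Y` of a convergent power series. -/
noncomputable abbrev toY (f : ConvSeries) : ConvSeries →ₐ[ℂ] LocalRingY f :=
  Ideal.Quotient.mkₐ ℂ (Ideal.span {f})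

/-- The local ring of `X = (f = 0) / μ`: the ring of invariants of `𝒪_Y`, that is, the classes of
the series `h` for which `μ h` and `h` agree on `Y`. -/
noncomputable def LocalRingX (r : ℕ) (a : Fin 4 → ℕ) (f : ConvSeries) :
    Subalgebra ℂ (LocalRingY f) :=
  (AlgHom.equalizer ((toY f).comp (mu r a)) (toY f)).map (toY f)

noncomputable instance (r : ℕ) (a : Fin 4 → ℕ) (f : ConvSeries) : CommRing (LocalRingX r a f) :=
  Subalgebra.toCommRing (LocalRingX r a f)

noncomputable instance (r : ℕ) (a : Fin 4 → ℕ) (f : ConvSeries) : Algebra ℂ (LocalRingX r a f) :=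
  Subalgebra.algebra (LocalRingX r a f)

/-! ### Properties of the germ and of the quotient map -/

/-- The singular locus of `(f = 0)`, defined by `f` and its partial derivatives, is supported at
the origin. -/
def HasIsolatedSingularity (f : ConvSeries) : Prop :=
  ∀ i, coord i ∈ (Ideal.span (insert f (Set.range fun j => partialDeriv j f))).radical

/-- The equations of the Du Val surface singularities `A_n` (`n ≥ 1`), `D_n` (`n ≥ 4`), `E₆`,
`E₇`, `E₈` in the coordinates `x₁, x₂, x₃`. -/
inductive IsDuValEquation : ConvSeries → Prop
  | A (n : ℕ) (hn : 1 ≤ n) :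
      IsDuValEquation (coord 0 ^ 2 + coord 1 ^ 2 + coord 2 ^ (n + 1))
  | D (n : ℕ) (hn : 4 ≤ n) :
      IsDuValEquation (coord 0 ^ 2 + coord 1 ^ 2 * coord 2 + coord 2 ^ (n - 1))
  | E6 : IsDuValEquation (coord 0 ^ 2 + coord 1 ^ 3 + coord 2 ^ 4)
  | E7 : IsDuValEquation (coord 0 ^ 2 + coord 1 ^ 3 + coord 1 * coord 2 ^ 3)
  | E8 : IsDuValEquation (coord 0 ^ 2 + coord 1 ^ 3 + coord 2 ^ 5)

/-- `(f = 0)` is a compound Du Val (cDV) singularity: in suitable analytic coordinates and up to a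
unit its equation is `p(x₁, x₂, x₃) + x₄ k(x₁, x₂, x₃, x₄)` with `p` a Du Val equation. -/
def IsCDV (f : ConvSeries) : Prop :=
  ∃ (φ : ConvSeries ≃ₐ[ℂ] ConvSeries) (p k : ConvSeries),
    IsDuValEquation p ∧ Associated (φ f) (p + coord 3 * k)

/-- The group generated by `μ` acts freely on `Y` outside the origin: for every nontrivial element
`μ ^ j`, its fixed locus in `Y`, which is cut out by the coordinates that `μ ^ j` does not fix, is
supported at the origin. -/
def ActsFreelyOutsideOrigin (r : ℕ) (a : Fin 4 → ℕ) (f : ConvSeries) : Prop :=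
  ∀ j : ℕ, ¬ r ∣ j → ∀ i,
    coord i ∈ (Ideal.span (insert f {h | ∃ l, ¬ r ∣ j * a l ∧ h = coord l})).radical

/-- `X` has an isolated singularity and `Y → X` is its index one cover: the group acts freely
outside the origin, and it acts on the generator of `ω_Y` (the residue of
`dx₁ ∧ dx₂ ∧ dx₃ ∧ dx₄ / f`, which `μ` multiplies by `ξ_r ^ (∑ aᵢ - e)`) through a character of
order exactly `r`, so that `r` is the Cartier index of `K_X`. -/
def IsIndexOneCover (r : ℕ) (a : Fin 4 → ℕ) (e : ℕ) (f : ConvSeries) : Prop :=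
  ActsFreelyOutsideOrigin r a f ∧ IsCoprime ((∑ i, (a i : ℤ)) - e) (r : ℤ)

/-! ### Prime divisors, log discrepancies, and the minimal log discrepancy -/

/-- The discrete valuation ring `V` is (the local ring at its generic point of) a prime divisor
over the threefold germ with local ring `R`, with center the closed point: `V` has the same
fraction field as `R`, it dominates `R`, and its residue field has transcendence degree `2 = 3 - 1`
over `ℂ`. -/
structure IsPrimeDivisorOver (R V : Type) [CommRing R] [Algebra ℂ R] [CommRing V] [IsDomain V]
    [IsDiscreteValuationRing V] [Algebra ℂ V] [Algebra R V] [IsScalarTower ℂ R V] : Prop where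
  injective : Function.Injective (algebraMap R V)
  sameFractionField : ∀ v : V, ∃ p q : R, q ≠ 0 ∧ v * algebraMap R V q = algebraMap R V p
  dominates : IsLocalHom (algebraMap R V)
  trdeg_residueField : Algebra.trdeg ℂ (IsLocalRing.ResidueField V) = 2

/-- The 3-form `dv₁ ∧ dv₂ ∧ dv₃` in `⋀³ Ω_{V/ℂ}`. -/
noncomputable def wedgeD (V : Type) [CommRing V] [Algebra ℂ V] (v : Fin 3 → V) :
    ⋀[V]^3 (Ω[V⁄ℂ]) :=
  exteriorPower.ιMulti V 3 fun i => KaehlerDifferential.D ℂ V (v i)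

/-- The 3-form `ω` vanishes along the divisor of `V` to order exactly `k`. -/
def VanishesToOrder (V : Type) [CommRing V] [IsLocalRing V] [Algebra ℂ V]
    (ω : ⋀[V]^3 (Ω[V⁄ℂ])) (k : ℕ) : Prop :=
  ω ∈ (IsLocalRing.maximalIdeal V ^ k) • (⊤ : Submodule V (⋀[V]^3 (Ω[V⁄ℂ]))) ∧
    ω ∉ (IsLocalRing.maximalIdeal V ^ (k + 1)) • (⊤ : Submodule V (⋀[V]^3 (Ω[V⁄ℂ])))

/-- The Jacobian determinant `∂(f, h₁, h₂, h₃) / ∂(x₁, x₂, x₃, x₄)`. -/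
noncomputable def jacobian (f : ConvSeries) (h : Fin 3 → ConvSeries) : ConvSeries :=
  Matrix.det (Matrix.of fun i j : Fin 4 =>
    partialDeriv j ((Fin.cons f h : Fin 4 → ConvSeries) i))

/-- `c` is the log discrepancy `a(E, X)` of the prime divisor `E` over `X` with local ring `V`.

Let `s` be the generator of `ω_Y` given by the residue of `dx₁ ∧ dx₂ ∧ dx₃ ∧ dx₄ / f`. Then `s ^ r`
generates `𝒪_X(r K_X)`, and `a(E, X) = 1 + ord_E (s ^ r) / r`, where `s ^ r` is regarded as a
rational section of the `r`-th power of the canonical sheaf of a resolution on which `E` lies.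
For functions `u₁, u₂, u₃` on `X` lifted to `h₁, h₂, h₃`, one has
`du₁ ∧ du₂ ∧ du₃ = J s` on `Y` with `J` the Jacobian determinant of `f, h₁, h₂, h₃`. Hence, when
`J ≠ 0` on `Y`, `ord_E (s ^ r) = r ord_E (du₁ ∧ du₂ ∧ du₃) - ord_E (J ^ r)`, for any choice of the
`uᵢ`; note that `J ^ r` is a function on `X`. -/
def HasLogDiscrepancy (r : ℕ) (a : Fin 4 → ℕ) (f : ConvSeries) (V : Type) [CommRing V]
    [IsDomain V] [IsDiscreteValuationRing V] [Algebra ℂ V] [Algebra (LocalRingX r a f) V]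
    (c : ℝ) : Prop :=
  ∃ (u : Fin 3 → LocalRingX r a f) (h : Fin 3 → ConvSeries) (J : LocalRingX r a f) (k m : ℕ),
    (∀ i, toY f (h i) = (u i : LocalRingY f)) ∧
    (J : LocalRingY f) = toY f (jacobian f h) ^ r ∧ J ≠ 0 ∧
    VanishesToOrder V (wedgeD V fun i => algebraMap (LocalRingX r a f) V (u i)) k ∧
    IsDiscreteValuationRing.addVal V (algebraMap (LocalRingX r a f) V J) = m ∧
    c = 1 + (k : ℝ) - (m : ℝ) / r

/-- The set of the log discrepancies `a(E, X)` of all prime divisors `E` over `X ∋ x`. -/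
def logDiscrepancies (r : ℕ) (a : Fin 4 → ℕ) (f : ConvSeries) : Set ℝ :=
  {c | ∃ (V : Type) (_ : CommRing V) (_ : IsDomain V) (_ : IsDiscreteValuationRing V)
    (_ : Algebra ℂ V) (_ : Algebra (LocalRingX r a f) V)
    (_ : IsScalarTower ℂ (LocalRingX r a f) V),
    IsPrimeDivisorOver (LocalRingX r a f) V ∧ HasLogDiscrepancy r a f V c}

/-- The minimal log discrepancy `mld(X ∋ x)`. -/
noncomputable def mld (r : ℕ) (a : Fin 4 → ℕ) (f : ConvSeries) : EReal :=
  sInf ((fun c : ℝ => (c : EReal)) '' logDiscrepancies r a f)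

/-- The hyperquotient singularity `X = (f = 0) / (1/r)(a₁, a₂, a₃, a₄)`, with `f` semi-invariant of
weight `e`: `Y = (f = 0)` is an isolated cDV singularity, `Y → X` is the index one cover, `X` is
isolated, no prime divisor over `X ∋ x` has log discrepancy `1`, and
`5/6 + ε ≤ mld(X ∋ x) < 1`. -/
structure IsHyperquotientSingularity (ε : ℝ) (r : ℕ) (a : Fin 4 → ℕ) (e : ℕ)
    (f : ConvSeries) : Prop where
  a_lt : ∀ i, a i < r
  e_lt : e < r
  semiInvariant : mu r a f = xi r ^ e • f
  isolated : HasIsolatedSingularity f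
  cDV : IsCDV f
  indexOneCover : IsIndexOneCover r a e f
  logDiscrepancy_ne_one : (1 : ℝ) ∉ logDiscrepancies r a f
  le_mld : ((5 / 6 + ε : ℝ) : EReal) ≤ mld r a f
  mld_lt : mld r a f < 1

/-! ### The non-cA normal forms -/

/-- Odd type: `f = x₁² + x₂² + g(x₃, x₄)` with `g ∈ 𝔪³` and `a₁ ≢ a₂ mod r`. -/
def IsOddType (r : ℕ) (a : Fin 4 → ℕ) (f : ConvSeries) : Prop :=
  ¬ a 0 ≡ a 1 [MOD r] ∧ ∃ g : ConvSeries, f = coord 0 ^ 2 + coord 1 ^ 2 + g ∧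
    ∀ n, coeff n g.1 ≠ 0 → n 0 = 0 ∧ n 1 = 0 ∧ 3 ≤ n.degree

/-- cD-E type: `f = x₁² + g(x₂, x₃, x₄)` with `g ∈ 𝔪³`. -/
def IsCDEType (f : ConvSeries) : Prop :=
  ∃ g : ConvSeries, f = coord 0 ^ 2 + g ∧ ∀ n, coeff n g.1 ≠ 0 → n 0 = 0 ∧ 3 ≤ n.degree

/-! ### Weights -/

/-- The weight `w(h)`, the minimum of `w(x^n)` over the monomials `x^n` that occur in `h`. It is
used for `h ≠ 0` and rational weights `w ≥ 0` only, where the minimum is attained. -/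
noncomputable def weight (w : Fin 4 → ℚ) (h : ConvSeries) : ℝ :=
  sInf {s : ℝ | ∃ n : Fin 4 →₀ ℕ, coeff n h.1 ≠ 0 ∧ s = ((∑ i, w i * n i : ℚ) : ℝ)}

/-- The set `N` of nonzero weights `w ∈ ℚ⁴_{≥ 0}` with `w ≡ (j/r)(a₁, a₂, a₃, a₄) mod ℤ⁴` for some
integer `j`. -/
def weightSet (r : ℕ) (a : Fin 4 → ℕ) : Set (Fin 4 → ℚ) :=
  {w | (∀ i, 0 ≤ w i) ∧ w ≠ 0 ∧ ∃ j : ℤ, ∀ i, ∃ m : ℤ, w i = (j * a i : ℚ) / r + m}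

/-- `N⁰ = N ∩ [0,1]⁴ \ {0,1}⁴`. -/
def weightSetZero (r : ℕ) (a : Fin 4 → ℕ) : Set (Fin 4 → ℚ) :=
  {w | w ∈ weightSet r a ∧ (∀ i, w i ≤ 1) ∧ ¬ ∀ i, w i = 0 ∨ w i = 1}

/-- `w` is a primitive vector of `N`: it lies in `N` and it is not an integer multiple `l v` of a
vector `v ∈ N` with `l ≥ 2`. -/
def IsPrimitive (r : ℕ) (a : Fin 4 → ℕ) (w : Fin 4 → ℚ) : Prop :=
  w ∈ weightSet r a ∧ ∀ l : ℕ, 2 ≤ l → ∀ v ∈ weightSet r a, w ≠ (l : ℚ) • v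

/-- `Ψ₁`: the primitive `β ∈ N` with `5/6 + ε ≤ β(x₁x₂x₃x₄) - β(f) < 1`. -/
def Psi1 (ε : ℝ) (r : ℕ) (a : Fin 4 → ℕ) (f : ConvSeries) : Set (Fin 4 → ℚ) :=
  {β | IsPrimitive r a β ∧ 5 / 6 + ε ≤ ((∑ i, β i : ℚ) : ℝ) - weight β f ∧
    ((∑ i, β i : ℚ) : ℝ) - weight β f < 1}

/-- `α_j = ({j a₁ / r}, {j a₂ / r}, {j a₃ / r}, {j a₄ / r})`. -/
def alpha (r : ℕ) (a : Fin 4 → ℕ) (j : ℕ) : Fin 4 → ℚ :=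
  fun i => Int.fract ((j * a i : ℚ) / r)

/-- The special alternative, with bound `M`: `2 a₁ ≡ e mod r`,
`7 ≤ gcd(a₁, r) = gcd(e, r) ≤ M`, and `r ∣ k_β e` whenever `β = α_{k_β}` lies in `Ψ₁ ∩ N⁰`, where
`1 ≤ k_β ≤ r - 1`. -/
structure SpecialAlternative (M : ℕ) (ε : ℝ) (r : ℕ) (a : Fin 4 → ℕ) (e : ℕ)
    (f : ConvSeries) : Prop where
  two_mul_modEq : 2 * a 0 ≡ e [MOD r]
  seven_le : 7 ≤ Nat.gcd (a 0) r
  gcd_eq : Nat.gcd (a 0) r = Nat.gcd e r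
  gcd_le : Nat.gcd e r ≤ M
  dvd_mul : ∀ β ∈ Psi1 ε r a f ∩ weightSetZero r a, ∀ k : ℕ, 1 ≤ k → k < r →
    β = alpha r a k → r ∣ k * e

end Hyperquotient

/-!
Suppose first that `f = x₁² + g(x₂, x₃, x₄)`, and let `b` be a positive integral weight congruent
to a multiple of `a` modulo `r`. A generic arc of weight `b` on `Y`, whose coefficients involve two
independent transcendentals and whose coordinate `x₁` is a square root of `-g`, pulls back the
`t`-adic valuation to a prime divisor over `X`. Comparing the orders of `dx₂ ∧ dx₃ ∧ dx₄` and of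
the Jacobian along it bounds its log discrepancy from above, so the lower bound on the minimal log
discrepancy gives `5/6 + ε ≤ β(x₁x₂x₃x₄) - β(f)` for every positive `β ∈ N`. For `β = α_k` with
`r ∤ ke` the right-hand side is not `1` because `∑ aᵢ - e ≡ 1 mod r`, and it is not less than `1`:
otherwise `α_k` would lie in `Ψ₁ ∩ N⁰`, or it would be a proper multiple of some `v ∈ N` which
violates the inequality. Using this for both `k` and `r - k` determines the sum of the residues of
`ka₂, ka₃, ka₄` modulo `r` whenever `2(ka₁ mod r) < r`. Since freeness makes `a₂, a₃, a₄` coprime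
to `r`, summing this identity over the `k` in a residue class modulo `r / gcd(a₁, r)` forces
`r = gcd(e, r)`.

If instead `f = x₁² + x₂² + g(x₃, x₄)`, a common divisor of `a₁`, `e` and `r` is coprime to `a₂` by
freeness and divides `2a₂ ≡ e`, hence divides `2`; this excludes `gcd(a₁, r) ≥ 4`.
-/

namespace Hyperquotient

section PullbackDVR

open IsDiscreteValuationRing

theorem exists_forall_dvd_of_mem {V A : Type*} [CommRing V] [CommRing A] [IsDomain A]
    [IsDiscreteValuationRing A] (ι : V →+* A) (hdvd : ∀ x y, ι x ∣ ι y → x ∣ y)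
    (I : Ideal V) : ∃ x ∈ I, ∀ y ∈ I, x ∣ y := by
  obtain ⟨x, hxI, hx⟩ := WellFounded.has_min
    (InvImage.wf (fun x => addVal A (ι x)) wellFounded_lt) (I : Set V) ⟨0, I.zero_mem⟩
  exact ⟨x, hxI, fun y hy => hdvd x y (addVal_le_iff_dvd.1 (not_lt.1 (hx y hy)))⟩

theorem isLocalHom_of_dvd {V A : Type*} [CommRing V] [CommRing A] (ι : V →+* A)
    (hdvd : ∀ x y, ι x ∣ ι y → x ∣ y) : IsLocalHom ι :=
  ⟨fun _ hx => isUnit_iff_dvd_one.2 (hdvd _ _ hx.dvd)⟩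

theorem isDiscreteValuationRing_of_dvd {V A : Type*} [CommRing V] [IsDomain V] [CommRing A]
    [IsDomain A] [IsDiscreteValuationRing A] (ι : V →+* A) (hdvd : ∀ x y, ι x ∣ ι y → x ∣ y)
    (hV : ¬ IsField V) : IsDiscreteValuationRing V := by
  have := isLocalHom_of_dvd ι hdvd
  have := ι.domain_isLocalRing
  have : IsPrincipalIdealRing V := ⟨fun I => by
    obtain ⟨x, hxI, hx⟩ := exists_forall_dvd_of_mem ι hdvd I
    exact ⟨x, le_antisymm (fun y hy => Ideal.mem_span_singleton.2 (hx y hy))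
      ((Ideal.span_singleton_le_iff_mem I).2 hxI)⟩⟩
  exact { not_a_field' := fun h => hV (IsLocalRing.isField_iff_maximalIdeal_eq.2 h) }

theorem addVal_map_eq_mul {V A : Type*} [CommRing V] [IsDomain V] [IsDiscreteValuationRing V]
    [CommRing A] [IsDomain A] [IsDiscreteValuationRing A] (ι : V →+* A) {π : V}
    (hπ : Irreducible π) {x : V} (hx : x ≠ 0) :
    addVal A (ι x) = addVal A (ι π) * addVal V x := by
  obtain ⟨n, u, rfl⟩ := eq_unit_mul_pow_irreducible hx hπ
  rw [addVal_def' u hπ, map_mul, map_pow, addVal_mul, addVal_pow,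
    addVal_eq_zero_iff.2 (u.isUnit.map ι), zero_add, nsmul_eq_mul, mul_comm]

theorem addVal_powerSeries {L : Type*} [Field L] (p : PowerSeries L) :
    addVal (PowerSeries L) p = p.order := by
  by_cases hp : p = 0
  · rw [hp, addVal_zero, PowerSeries.order_zero]
  nth_rw 1 [← PowerSeries.X_pow_order_mul_divXPowOrder (f := p)]
  rw [addVal_mul, PowerSeries.X_irreducible.addVal_pow,
    addVal_eq_zero_iff.2 (PowerSeries.isUnit_divided_by_X_pow_order hp), add_zero,
    PowerSeries.coe_toNat_order hp]

end PullbackDVR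

section ArcRing

variable {R A : Type*} [CommRing R] [IsDomain R] [CommRing A] [IsDomain A] (φ : R →+* A)
  (hφ : Function.Injective φ)

/-- The extension of an injective homomorphism of domains to the fraction fields. -/
noncomputable def fractionMap : FractionRing R →+* FractionRing A :=
  IsFractionRing.lift (g := (algebraMap A (FractionRing A)).comp φ)
    ((IsFractionRing.injective A _).comp hφ)

theorem fractionMap_algebraMap (x : R) :
    fractionMap φ hφ (algebraMap R _ x) = algebraMap A _ (φ x) :=
  IsFractionRing.lift_algebraMap _ x

/-- The fractions of `R` that become integral along `φ : R →+* A`. When `A = L⟦X⟧` this is the ring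
of the divisorial valuation defined by the arc `φ`. -/
noncomputable def arcRing : Subalgebra R (FractionRing R) where
  carrier := {x | fractionMap φ hφ x ∈ (algebraMap A (FractionRing A)).range}
  mul_mem' hx hy := by simpa only [Set.mem_ofPred_eq, map_mul] using mul_mem hx hy
  add_mem' hx hy := by simpa only [Set.mem_ofPred_eq, map_add] using add_mem hx hy
  algebraMap_mem' x := ⟨φ x, (fractionMap_algebraMap φ hφ x).symm⟩

/-- The extension of the arc `φ` to its valuation ring. -/
noncomputable def arcMap : arcRing φ hφ →+* A :=
  ((AlgEquiv.ofInjective (Algebra.ofId A (FractionRing A))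
      (IsFractionRing.injective A _)).symm : _ →+* A).comp
    (((fractionMap φ hφ).comp (arcRing φ hφ).val.toRingHom).codRestrict
      (Algebra.ofId A (FractionRing A)).range fun x => x.2)

theorem algebraMap_arcMap (x : arcRing φ hφ) :
    algebraMap A (FractionRing A) (arcMap φ hφ x) = fractionMap φ hφ x :=
  congrArg Subtype.val (AlgEquiv.apply_symm_apply
    (AlgEquiv.ofInjective (Algebra.ofId A (FractionRing A)) (IsFractionRing.injective A _)) _)

theorem arcMap_algebraMap (x : R) : arcMap φ hφ (algebraMap R _ x) = φ x :=
  IsFractionRing.injective A (FractionRing A)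
    ((algebraMap_arcMap φ hφ _).trans (fractionMap_algebraMap φ hφ x))

theorem algebraMap_arcRing_injective : Function.Injective (algebraMap R (arcRing φ hφ)) :=
  FaithfulSMul.algebraMap_injective R _

theorem exists_arcMap_eq {a b : R} (hb : b ≠ 0) {p : A} (h : φ a = φ b * p) :
    ∃ x : arcRing φ hφ, arcMap φ hφ x = p := by
  have hb' : algebraMap A (FractionRing A) (φ b) ≠ 0 := by
    rwa [Ne, IsFractionRing.to_map_eq_zero_iff, map_eq_zero_iff φ hφ]
  have hp : algebraMap A (FractionRing A) p =
      fractionMap φ hφ (algebraMap R _ a / algebraMap R _ b) := by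
    rw [map_div₀, fractionMap_algebraMap, fractionMap_algebraMap, h, map_mul,
      mul_div_cancel_left₀ _ hb']
  exact ⟨⟨_, p, hp⟩, IsFractionRing.injective A (FractionRing A)
    ((algebraMap_arcMap φ hφ _).trans hp.symm)⟩

theorem dvd_of_arcMap_dvd (x y : arcRing φ hφ) (h : arcMap φ hφ x ∣ arcMap φ hφ y) : x ∣ y := by
  obtain ⟨p, hp⟩ := h
  have hxy : fractionMap φ hφ y = fractionMap φ hφ x * algebraMap A _ p := by
    rw [← algebraMap_arcMap, ← algebraMap_arcMap, hp, map_mul]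
  by_cases hx : (x : FractionRing R) = 0
  · rw [hx, map_zero, zero_mul, map_eq_zero] at hxy
    rw [(Subtype.ext hxy : y = 0)]
    exact dvd_zero x
  have hx' : fractionMap φ hφ x ≠ 0 := (map_ne_zero _).2 hx
  have hmem : (y / x : FractionRing R) ∈ arcRing φ hφ :=
    ⟨p, by rw [map_div₀, hxy, mul_div_cancel_left₀ _ hx']⟩
  exact ⟨⟨_, hmem⟩, Subtype.ext (mul_div_cancel₀ _ hx).symm⟩

theorem exists_mul_algebraMap_eq_arcRing (v : arcRing φ hφ) :
    ∃ p q : R, q ≠ 0 ∧ v * algebraMap R (arcRing φ hφ) q = algebraMap R _ p := by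
  obtain ⟨p, q, hq, h⟩ := IsFractionRing.div_surjective (A := R) (v : FractionRing R)
  have hq0 : algebraMap R (FractionRing R) q ≠ 0 :=
    IsFractionRing.to_map_ne_zero_of_mem_nonZeroDivisors hq
  exact ⟨p, q, nonZeroDivisors.ne_zero hq, Subtype.ext ((div_eq_iff hq0).1 h).symm⟩

theorem isLocalHom_algebraMap_arcRing [IsLocalHom φ] :
    IsLocalHom (algebraMap R (arcRing φ hφ)) :=
  ⟨fun x hx => isUnit_of_map_unit φ x <| by
    simpa only [arcMap_algebraMap] using hx.map (arcMap φ hφ)⟩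

theorem isDiscreteValuationRing_arcRing [IsDiscreteValuationRing A] [IsLocalHom φ]
    (hR : ¬ IsField R) : IsDiscreteValuationRing (arcRing φ hφ) := by
  refine isDiscreteValuationRing_of_dvd _ (dvd_of_arcMap_dvd φ hφ) fun hV => hR ?_
  have := isLocalHom_algebraMap_arcRing φ hφ
  refine ⟨exists_pair_ne R, mul_comm, fun {x} hx => ?_⟩
  have hx' := (map_ne_zero_iff _ (algebraMap_arcRing_injective φ hφ)).2 hx
  exact (isUnit_of_map_unit (algebraMap R (arcRing φ hφ)) x
    (isUnit_iff_exists_inv.2 (hV.mul_inv_cancel hx'))).exists_right_inv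

end ArcRing

section ExteriorPower

variable {A M : Type*} [CommRing A] [AddCommGroup M] [Module A M] {n : ℕ}

theorem ιMulti_mem_smul_top (I : Ideal A) (v : Fin n → M) (i : Fin n)
    (hi : v i ∈ I • (⊤ : Submodule A M)) :
    exteriorPower.ιMulti A n v ∈ I • (⊤ : Submodule A (⋀[A]^n M)) := by
  have hmap : Submodule.map
      ((exteriorPower.ιMulti A n (M := M)).toMultilinearMap.toLinearMap v i) (I • ⊤) ≤
        I • (⊤ : Submodule A (⋀[A]^n M)) := by
    rw [Submodule.map_smul'']
    exact Submodule.smul_mono le_rfl le_top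
  simpa using hmap (Submodule.mem_map_of_mem hi)

theorem alternatingMap_comp_mem_span {N ι : Type*} [AddCommGroup N] [Module A N] [Finite ι]
    (g : M [⋀^ι]→ₗ[A] N) (e : ι → M) (σ : ι → ι) :
    g (e ∘ σ) ∈ Submodule.span A {g e} := by
  classical
  have := Fintype.ofFinite ι
  by_cases hσ : Function.Injective σ
  · have hperm : g (e ∘ σ) = _ :=
      g.map_perm e (Equiv.ofBijective σ (Finite.injective_iff_bijective.1 hσ))
    rw [hperm]
    exact Submodule.smul_of_tower_mem _ _ (Submodule.mem_span_singleton_self _)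
  · obtain ⟨i, j, hij, hne⟩ := Function.not_injective_iff.1 hσ
    rw [g.map_eq_zero_of_eq (e ∘ σ) (congrArg e hij) hne]
    exact Submodule.zero_mem _

theorem alternatingMap_mem_span_of_mem_span {N ι : Type*} [AddCommGroup N] [Module A N] [Finite ι]
    (g : M [⋀^ι]→ₗ[A] N) {e v : ι → M} (hv : ∀ i, v i ∈ Submodule.span A (Set.range e)) :
    g v ∈ Submodule.span A {g e} := by
  classical
  have := Fintype.ofFinite ι
  choose c hc using fun i => (Submodule.mem_span_range_iff_exists_fun A).1 (hv i)
  rw [← funext hc, ← g.coe_multilinearMap, g.toMultilinearMap.map_sum fun i j => c i j • e j]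
  refine Submodule.sum_mem _ fun σ _ => ?_
  rw [g.toMultilinearMap.map_smul_univ (fun i => c i (σ i)) fun i => e (σ i)]
  exact Submodule.smul_mem _ _ (alternatingMap_comp_mem_span g e σ)

theorem exteriorPower_span_sup_smul_top (I : Ideal A) (e : Fin n → M)
    (he : Submodule.span A (Set.range e) ⊔ I • (⊤ : Submodule A M) = ⊤) :
    Submodule.span A {exteriorPower.ιMulti A n e} ⊔ I • (⊤ : Submodule A (⋀[A]^n M)) = ⊤ := by
  refine top_le_iff.1 ((exteriorPower.ιMulti_span A n M).ge.trans (Submodule.span_le.2 ?_))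
  rintro _ ⟨y, rfl⟩
  choose v hv z hz hvz using fun i =>
    Submodule.mem_sup.1 (he.ge (Submodule.mem_top (x := y i)))
  have hy : y = v + z := funext fun i => (hvz i).symm
  rw [hy, SetLike.mem_coe, (exteriorPower.ιMulti A n (M := M)).map_add_univ v z]
  refine Submodule.sum_mem _ fun s _ => ?_
  by_cases hs : s = Finset.univ
  · rw [hs, Finset.piecewise_univ]
    exact Submodule.mem_sup_left (alternatingMap_mem_span_of_mem_span _ hv)
  · obtain ⟨i, hi⟩ := not_forall.1 (mt Finset.eq_univ_iff_forall.2 hs)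
    refine Submodule.mem_sup_right (ιMulti_mem_smul_top I _ i ?_)
    rw [Finset.piecewise_eq_of_notMem _ _ _ hi]
    exact hz i

end ExteriorPower

section Kaehler

open IsLocalRing KaehlerDifferential

theorem exists_aeval_eq_zero_derivative_ne_zero {B K : Type*} [CommRing B] [IsDomain B]
    [CharZero B] [CommRing K] [Algebra B K] [FaithfulSMul B K] {x : K} (hx : IsAlgebraic B x) :
    ∃ p : Polynomial B, p.aeval x = 0 ∧ p.derivative.aeval x ≠ 0 := by
  obtain ⟨p, ⟨hp0, hpx⟩, hmin⟩ := WellFounded.has_min (measure Polynomial.natDegree).wf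
    {p : Polynomial B | p ≠ 0 ∧ p.aeval x = 0} hx
  refine ⟨p, hpx, fun h => ?_⟩
  have hdeg : p.natDegree ≠ 0 := by
    intro h0
    rw [Polynomial.eq_C_of_natDegree_eq_zero h0] at hpx hp0
    rw [Polynomial.aeval_C, FaithfulSMul.algebraMap_eq_zero_iff] at hpx
    rw [hpx, Polynomial.C_0] at hp0
    exact hp0 rfl
  exact hmin _ ⟨fun h0 => hdeg (Polynomial.derivative_eq_zero.1 h0), h⟩
    (Polynomial.natDegree_derivative_lt hdeg)

theorem derivation_aeval_eq_smul {k V Q : Type*} [CommRing k] [CommRing V] [Algebra k V]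
    [AddCommGroup Q] [Module k Q] [Module V Q]
    [IsScalarTower k V Q] (d : Derivation k V Q) {B : Subalgebra k V} (hB : ∀ b ∈ B, d b = 0)
    (p : Polynomial B) (v : V) : d (p.aeval v) = p.derivative.aeval v • d v := by
  let dB : Derivation B V Q := Derivation.mk'
    { d.toLinearMap.toAddMonoidHom with
      map_smul' := fun b x => by
        change d ((b : V) * x) = (b : V) • d x
        rw [d.leibniz, hB b b.2, smul_zero, add_zero] }
    d.leibniz
  exact dB.map_aeval p v

variable {k V : Type*} [Field k] [CharZero k] [CommRing V] [IsLocalRing V] [Algebra k V]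

theorem exists_polynomial_adjoin_not_isUnit {σ : Type*} {θ : σ → V}
    (hθ : IsTranscendenceBasis k fun i => residue V (θ i)) (v : V) :
    ∃ p : Polynomial (Algebra.adjoin k (Set.range θ)),
      ¬ IsUnit (p.aeval v) ∧ IsUnit (p.derivative.aeval v) := by
  let ρ : V →ₐ[k] ResidueField V := IsScalarTower.toAlgHom k V (ResidueField V)
  have hρ : (Algebra.adjoin k (Set.range θ)).map ρ =
      Algebra.adjoin k (Set.range fun i => residue V (θ i)) := by
    rw [AlgHom.map_adjoin, ← Set.range_comp]
    rfl
  let f : Algebra.adjoin k (Set.range θ) →ₐ[k]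
      Algebra.adjoin k (Set.range fun i => residue V (θ i)) :=
    (ρ.comp (Subalgebra.val _)).codRestrict _ fun x => by
      rw [← hρ]
      exact Subalgebra.mem_map.2 ⟨x, x.2, rfl⟩
  have hf : Function.Surjective f := fun y => by
    obtain ⟨x, hx, hxy⟩ := Subalgebra.mem_map.1 (hρ.ge y.2)
    exact ⟨⟨x, hx⟩, Subtype.ext hxy⟩
  have : CharZero (Algebra.adjoin k (Set.range fun i => residue V (θ i))) :=
    charZero_of_injective_algebraMap (FaithfulSMul.algebraMap_injective k _)
  obtain ⟨p', hp, hp'⟩ := exists_aeval_eq_zero_derivative_ne_zero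
    (hθ.isAlgebraic.isAlgebraic (residue V v))
  obtain ⟨p, rfl⟩ := Polynomial.map_surjective f.toRingHom hf p'
  have hres : ∀ q : Polynomial (Algebra.adjoin k (Set.range θ)),
      residue V (q.aeval v) = (q.map f.toRingHom).aeval (residue V v) := fun q =>
    Polynomial.map_aeval_eq_aeval_map (φ := f.toRingHom) (ψ := residue V)
      (RingHom.ext fun _ => rfl) q v
  refine ⟨p, ?_, ?_⟩
  · rwa [← residue_ne_zero_iff_isUnit, hres, not_not]
  · rwa [← residue_ne_zero_iff_isUnit, hres, ← Polynomial.derivative_map]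

theorem kaehler_sup_maximalIdeal_smul_top {π : V} (hπ : maximalIdeal V = Ideal.span {π})
    {σ : Type*} {θ : σ → V} (hθ : IsTranscendenceBasis k fun i => residue V (θ i))
    (N : Submodule V (Ω[V⁄k])) (hN : D k V π ∈ N) (hNθ : ∀ i, D k V (θ i) ∈ N) :
    N ⊔ maximalIdeal V • (⊤ : Submodule V (Ω[V⁄k])) = ⊤ := by
  set P := N ⊔ maximalIdeal V • (⊤ : Submodule V (Ω[V⁄k]))
  let d : Derivation k V (Ω[V⁄k] ⧸ P) := P.mkQ.compDer (D k V)
  have hd : ∀ x, d x = 0 ↔ D k V x ∈ P := fun x => Submodule.Quotient.mk_eq_zero P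
  have hadjoin : ∀ b ∈ Algebra.adjoin k (Set.range θ), d b = 0 :=
    Derivation.eqOn_adjoin (D1 := d) (D2 := 0) <| by
      rintro _ ⟨i, rfl⟩
      exact (hd _).2 (Submodule.mem_sup_left (hNθ i))
  have hmax : ∀ x, ¬ IsUnit x → d x = 0 := by
    intro x hx
    obtain ⟨y, rfl⟩ := Ideal.mem_span_singleton.1 (hπ ▸ (mem_maximalIdeal x).2 hx)
    rw [hd, Derivation.leibniz]
    exact add_mem (Submodule.mem_sup_right (Submodule.smul_mem_smul
      (hπ ▸ Ideal.mem_span_singleton_self π) Submodule.mem_top))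
      (Submodule.mem_sup_left (N.smul_mem y hN))
  rw [eq_top_iff, ← span_range_derivation k V, Submodule.span_le]
  rintro _ ⟨v, rfl⟩
  obtain ⟨p, hp, hp'⟩ := exists_polynomial_adjoin_not_isUnit hθ v
  exact (hd v).1 (hp'.smul_eq_zero.1
    ((derivation_aeval_eq_smul d hadjoin p v).symm.trans (hmax _ hp)))

end Kaehler

section Vanishing

open IsLocalRing

section Semilinear

variable {V A M : Type*} [CommRing V] [IsLocalRing V] [CommRing A] [AddCommGroup M] [Module V M]
  {ι : V →+* A} (F : M →ₛₗ[ι] A) {ω₀ : M}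

theorem apply_dvd_apply_of_span_sup_smul_top [IsLocalRing A] [IsNoetherianRing A] [IsLocalHom ι]
    (hω₀ : Submodule.span V {ω₀} ⊔ maximalIdeal V • (⊤ : Submodule V M) = ⊤) (ω : M) :
    F ω₀ ∣ F ω := by
  have hF : Ideal.span (Set.range F) ≤
      Ideal.span {F ω₀} ⊔ maximalIdeal A • Ideal.span (Set.range F) := by
    rw [Ideal.span_le]
    rintro _ ⟨y, rfl⟩
    obtain ⟨w, hw, z, hz, rfl⟩ := Submodule.mem_sup.1 (hω₀.ge (Submodule.mem_top (x := y)))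
    obtain ⟨c, rfl⟩ := Submodule.mem_span_singleton.1 hw
    rw [map_add, map_smulₛₗ]
    refine Submodule.add_mem_sup (Submodule.smul_mem _ _ (Ideal.mem_span_singleton_self _)) ?_
    refine Submodule.smul_induction_on hz (fun a ha x _ => ?_) fun x y hx hy => ?_
    · rw [map_smulₛₗ]
      exact Submodule.smul_mem_smul (map_nonunit ι a ha) (Ideal.subset_span ⟨x, rfl⟩)
    · rw [map_add]
      exact add_mem hx hy
  exact Ideal.mem_span_singleton.1 (Submodule.le_of_le_smul_of_le_jacobson_bot
    (IsNoetherian.noetherian _) (maximalIdeal_le_jacobson _) hF (Ideal.subset_span ⟨ω, rfl⟩))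

theorem pow_mul_apply_dvd_apply_of_mem {π : V} (hπ : maximalIdeal V = Ideal.span {π})
    (hF : ∀ x, F ω₀ ∣ F x) {n : ℕ} {ω : M} (hω : ω ∈ maximalIdeal V ^ n • (⊤ : Submodule V M)) :
    ι π ^ n * F ω₀ ∣ F ω := by
  refine Submodule.smul_induction_on hω (fun a ha x _ => ?_) fun x y hx hy => ?_
  · rw [hπ, Ideal.span_singleton_pow, Ideal.mem_span_singleton] at ha
    rw [map_smulₛₗ, smul_eq_mul, ← map_pow]
    exact mul_dvd_mul (map_dvd ι ha) (hF x)
  · rw [map_add]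
    exact dvd_add hx hy

theorem exists_mem_pow_smul_top_of_apply_ne_zero [IsDomain A] [IsLocalRing A] [IsNoetherianRing A]
    [IsLocalHom ι] {π : V} (hπ : maximalIdeal V = Ideal.span {π})
    (hω₀ : Submodule.span V {ω₀} ⊔ maximalIdeal V • (⊤ : Submodule V M) = ⊤) {ω : M}
    (hω : F ω ≠ 0) :
    ∃ n : ℕ, ω ∈ maximalIdeal V ^ n • (⊤ : Submodule V M) ∧
      ω ∉ maximalIdeal V ^ (n + 1) • (⊤ : Submodule V M) ∧ ι π ^ n * F ω₀ ∣ F ω := by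
  classical
  have hdvd := apply_dvd_apply_of_span_sup_smul_top F hω₀
  have hπ' : ¬ IsUnit (ι π) := map_nonunit ι π (hπ ▸ Ideal.mem_span_singleton_self π)
  obtain ⟨m, hm⟩ := FiniteMultiplicity.of_not_isUnit hπ' hω
  have hex : ∃ n : ℕ, ω ∉ maximalIdeal V ^ (n + 1) • (⊤ : Submodule V M) :=
    ⟨m, fun h => hm (dvd_of_mul_right_dvd (pow_mul_apply_dvd_apply_of_mem F hπ hdvd h))⟩
  have hmem : ω ∈ maximalIdeal V ^ Nat.find hex • (⊤ : Submodule V M) := by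
    cases hn : Nat.find hex with
    | zero => simp only [pow_zero, Ideal.one_eq_top, Submodule.top_smul, Submodule.mem_top]
    | succ n => exact not_not.1 (Nat.find_min hex (hn ▸ n.lt_succ_self))
  exact ⟨_, hmem, Nat.find_spec hex, pow_mul_apply_dvd_apply_of_mem F hπ hdvd hmem⟩

end Semilinear

theorem exists_semilinearMap_ιMulti_eq_det {k V A : Type*} [CommRing k] [CommRing V] [CommRing A]
    [Algebra k V] [Algebra k A] {n : ℕ} (ι : V →ₐ[k] A) (δ : Fin n → Derivation k A A) :
    ∃ F : (⋀[V]^n (Ω[V⁄k])) →ₛₗ[(ι : V →+* A)] A, ∀ u : Fin n → V,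
      F (exteriorPower.ιMulti V n fun i => KaehlerDifferential.D k V (u i)) =
        Matrix.det (Matrix.of fun i j => δ j (ι (u i))) := by
  let : Algebra V A := ι.toRingHom.toAlgebra
  have : IsScalarTower k V A := IsScalarTower.of_algebraMap_eq fun c => (ι.commutes c).symm
  let ℓ : Fin n → (Ω[V⁄k] →ₗ[V] A) := fun j => ((δ j).compAlgebraMap V).liftKaehlerDifferential
  let g : (Ω[V⁄k]) [⋀^Fin n]→ₗ[V] A :=
    { ((Matrix.detRowAlternating (R := A) (n := Fin n)).toMultilinearMap.restrictScalars
        V).compLinearMap fun _ => LinearMap.pi ℓ with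
      map_eq_zero_of_eq' := fun v i j hij hne =>
        (Matrix.detRowAlternating (R := A) (n := Fin n)).map_eq_zero_of_eq _
          (congrArg (LinearMap.pi ℓ) hij) hne }
  let G := exteriorPower.alternatingMapLinearEquiv g
  refine ⟨{ G.toAddMonoidHom with
    map_smul' := fun v x => (map_smul G v x).trans (Algebra.smul_def _ _) }, fun u => ?_⟩
  refine (exteriorPower.alternatingMapLinearEquiv_apply_ιMulti g _).trans ?_
  change Matrix.det (fun i => LinearMap.pi ℓ (KaehlerDifferential.D k V (u i))) = Matrix.det _
  congr 1
  funext i j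
  exact ((δ j).compAlgebraMap V).liftKaehlerDifferential_comp_D (u i)

end Vanishing

section PrimeDivisor

open PowerSeries
open IsLocalRing (ResidueField residue)
open IsDiscreteValuationRing (addVal)

theorem isTranscendenceBasis_residue {k V L σ : Type*} [Field k] [CommRing V] [IsLocalRing V]
    [Algebra k V] [Field L] [Algebra k L] (ψ : V →ₐ[k] L) [IsLocalHom (ψ : V →+* L)] {θ : σ → V}
    (hθ : IsTranscendenceBasis k (ψ ∘ θ)) : IsTranscendenceBasis k fun i => residue V (θ i) :=
  let ρ : ResidueField V →ₐ[k] L :=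
    { ResidueField.lift (ψ : V →+* L) with commutes' := ψ.commutes }
  IsTranscendenceBasis.of_comp ρ ρ.toRingHom.injective hθ

theorem exists_vanishesToOrder_wedgeD {V A : Type} [CommRing V] [IsDomain V]
    [IsDiscreteValuationRing V] [Algebra ℂ V] [CommRing A] [IsDomain A] [IsDiscreteValuationRing A]
    [Algebra ℂ A] (ι : V →ₐ[ℂ] A) [IsLocalHom (ι : V →+* A)] {π : V} (hπ : Irreducible π)
    {θ : Fin 2 → V} (hθ : IsTranscendenceBasis ℂ fun i => residue V (θ i))
    {δ : Fin 3 → Derivation ℂ A A} (hδ : ∀ j, ι π ∣ δ j (ι π)) {u : Fin 3 → V}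
    (hu : Matrix.det (Matrix.of fun i j => δ j (ι (u i))) ≠ 0) :
    ∃ k : ℕ, VanishesToOrder V (wedgeD V u) k ∧
      ι π ^ (k + 1) ∣ Matrix.det (Matrix.of fun i j => δ j (ι (u i))) := by
  obtain ⟨F, hF⟩ := exists_semilinearMap_ιMulti_eq_det ι δ
  have hFu : F (wedgeD V u) = _ := hF u
  let v : Fin 3 → V := ![π, θ 0, θ 1]
  have hspan : Submodule.span V (Set.range fun i => KaehlerDifferential.D ℂ V (v i)) ⊔
      IsLocalRing.maximalIdeal V • (⊤ : Submodule V (Ω[V⁄ℂ])) = ⊤ :=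
    kaehler_sup_maximalIdeal_smul_top hπ.maximalIdeal_eq hθ _ (Submodule.subset_span ⟨0, rfl⟩)
      fun i => Submodule.subset_span ⟨i.succ, by fin_cases i <;> rfl⟩
  have hFv : ι π ∣ F (exteriorPower.ιMulti V 3 fun i => KaehlerDifferential.D ℂ V (v i)) := by
    rw [hF, Matrix.det_succ_row_zero]
    exact Finset.dvd_sum fun j _ => Dvd.dvd.mul_right (Dvd.dvd.mul_left (hδ j) _) _
  rw [← hFu] at hu ⊢
  obtain ⟨k, hmem, hnotMem, hdvd⟩ := exists_mem_pow_smul_top_of_apply_ne_zero F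
    hπ.maximalIdeal_eq (exteriorPower_span_sup_smul_top _ _ hspan) hu
  exact ⟨k, ⟨hmem, hnotMem⟩, pow_succ (ι π) k ▸ (mul_dvd_mul_left _ hFv).trans hdvd⟩

variable {R L : Type} [CommRing R] [IsDomain R] [Algebra ℂ R] [Field L] [Algebra ℂ L]
  (φ : R →ₐ[ℂ] L⟦X⟧) (hφ : Function.Injective (φ : R →+* L⟦X⟧))

/-- The extension `arcMap` of an arc `φ` to its valuation ring, as a homomorphism of
`ℂ`-algebras. -/
noncomputable def arcAlgHom : arcRing (φ : R →+* L⟦X⟧) hφ →ₐ[ℂ] L⟦X⟧ :=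
  { arcMap (φ : R →+* L⟦X⟧) hφ with
    commutes' := fun c => (arcMap_algebraMap (φ : R →+* L⟦X⟧) hφ _).trans (φ.commutes c) }

theorem arcAlgHom_algebraMap (x : R) : arcAlgHom φ hφ (algebraMap R _ x) = φ x :=
  arcMap_algebraMap (φ : R →+* L⟦X⟧) hφ x

instance isLocalHom_arcAlgHom :
    IsLocalHom (arcAlgHom φ hφ : arcRing (φ : R →+* L⟦X⟧) hφ →+* L⟦X⟧) :=
  isLocalHom_of_dvd _ (dvd_of_arcMap_dvd (φ : R →+* L⟦X⟧) hφ)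

theorem arcAlgHom_injective : Function.Injective (arcAlgHom φ hφ) :=
  (injective_iff_map_eq_zero _).2 fun x hx =>
    zero_dvd_iff.1 (dvd_of_arcMap_dvd (φ : R →+* L⟦X⟧) hφ 0 x
      ((map_zero (arcAlgHom φ hφ)).trans hx.symm).dvd)

theorem exists_arcRing_isTranscendenceBasis_residue [IsLocalRing (arcRing (φ : R →+* L⟦X⟧) hφ)]
    {σ : Type*} {S : σ → L} (hS : IsTranscendenceBasis ℂ S)
    (hθ : ∀ i, ∃ a b : R, b ≠ 0 ∧ φ a = φ b * C (S i)) :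
    ∃ θ : σ → arcRing (φ : R →+* L⟦X⟧) hφ, IsTranscendenceBasis ℂ fun i => residue _ (θ i) := by
  have hlift : ∀ i, ∃ x : arcRing (φ : R →+* L⟦X⟧) hφ, arcAlgHom φ hφ x = C (S i) := fun i => by
    obtain ⟨a, b, hb, hab⟩ := hθ i
    exact exists_arcMap_eq (φ : R →+* L⟦X⟧) hφ hb hab
  choose θ hθ using hlift
  let ψ : arcRing (φ : R →+* L⟦X⟧) hφ →ₐ[ℂ] L :=
    { (constantCoeff (R := L)).comp (arcAlgHom φ hφ : _ →+* L⟦X⟧) with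
      commutes' := fun c => (congrArg constantCoeff ((arcAlgHom φ hφ).commutes c)).trans
        (constantCoeff_C _) }
  have : IsLocalHom (ψ : arcRing (φ : R →+* L⟦X⟧) hφ →+* L) :=
    ⟨fun v hv => isUnit_of_map_unit (arcAlgHom φ hφ : _ →+* L⟦X⟧) v
      (isUnit_iff_constantCoeff.2 hv)⟩
  refine ⟨θ, isTranscendenceBasis_residue ψ ?_⟩
  have hψ : ψ ∘ θ = S :=
    funext fun i => (congrArg constantCoeff (hθ i)).trans (constantCoeff_C _)
  exact hψ ▸ hS

theorem isPrimeDivisorOver_arcRing [IsDiscreteValuationRing (arcRing (φ : R →+* L⟦X⟧) hφ)]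
    [IsLocalHom (φ : R →+* L⟦X⟧)] {θ : Fin 2 → arcRing (φ : R →+* L⟦X⟧) hφ}
    (hθ : IsTranscendenceBasis ℂ fun i => residue _ (θ i)) :
    IsPrimeDivisorOver R (arcRing (φ : R →+* L⟦X⟧) hφ) where
  injective := algebraMap_arcRing_injective _ hφ
  sameFractionField := exists_mul_algebraMap_eq_arcRing _ hφ
  dominates := isLocalHom_algebraMap_arcRing _ hφ
  trdeg_residueField := by simpa using hθ.cardinalMk_eq_trdeg.symm

theorem dvd_order_arcAlgHom {r : ℕ} (hr : ∀ x : R, r ∣ (φ x).order.toNat)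
    (v : arcRing (φ : R →+* L⟦X⟧) hφ) : r ∣ (arcAlgHom φ hφ v).order.toNat := by
  obtain ⟨a, b, hb, hab⟩ := exists_mul_algebraMap_eq_arcRing _ hφ v
  have hφab : φ a = arcAlgHom φ hφ v * φ b := by
    rw [← arcAlgHom_algebraMap φ hφ, ← arcAlgHom_algebraMap φ hφ, ← hab, map_mul]
  by_cases hv : arcAlgHom φ hφ v = 0
  · rw [hv, order_zero, ENat.toNat_top]
    exact dvd_zero r
  have hb' : φ b ≠ 0 := (map_ne_zero_iff (φ : R →+* L⟦X⟧) hφ).2 hb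
  have hdvd := hr a
  rw [hφab, order_mul, ENat.toNat_add (order_finite_iff_ne_zero.2 hv).ne
    (order_finite_iff_ne_zero.2 hb').ne] at hdvd
  exact (Nat.dvd_add_left (hr b)).1 hdvd

theorem exists_primeDivisor (hφ : Function.Injective (φ : R →+* L⟦X⟧))
    [IsLocalHom (φ : R →+* L⟦X⟧)] (hR : ¬ IsField R)
    {S : Fin 2 → L} (hS : IsTranscendenceBasis ℂ S)
    (hθ : ∀ i, ∃ a b : R, b ≠ 0 ∧ φ a = φ b * C (S i)) {r : ℕ}
    (hr : ∀ x : R, r ∣ (φ x).order.toNat) {δ : Fin 3 → Derivation ℂ L⟦X⟧ L⟦X⟧}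
    (hδ : ∀ j p, p ∣ δ j p) :
    ∃ (V : Type) (_ : CommRing V) (_ : IsDomain V) (_ : IsDiscreteValuationRing V)
      (_ : Algebra ℂ V) (_ : Algebra R V) (_ : IsScalarTower ℂ R V),
      IsPrimeDivisorOver R V ∧ ∃ q : ℕ, 0 < q ∧ r ∣ q ∧
        (∀ x : R, x ≠ 0 → (φ x).order = q * addVal V (algebraMap R V x)) ∧
        ∀ u : Fin 3 → R, Matrix.det (Matrix.of fun i j => δ j (φ (u i))) ≠ 0 →
          ∃ k : ℕ, VanishesToOrder V (wedgeD V fun i => algebraMap R V (u i)) k ∧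
            ((q * (k + 1) : ℕ) : ℕ∞) ≤
              (Matrix.det (Matrix.of fun i j => δ j (φ (u i)))).order := by
  have := isDiscreteValuationRing_arcRing (φ : R →+* L⟦X⟧) hφ hR
  obtain ⟨θ, hθ⟩ := exists_arcRing_isTranscendenceBasis_residue φ hφ hS hθ
  obtain ⟨π, hπ⟩ := IsDiscreteValuationRing.exists_irreducible (arcRing (φ : R →+* L⟦X⟧) hφ)
  have hπ0 : arcAlgHom φ hφ π ≠ 0 :=
    (map_ne_zero_iff _ (arcAlgHom_injective φ hφ)).2 hπ.ne_zero
  have hq : (arcAlgHom φ hφ π).order = (arcAlgHom φ hφ π).order.toNat :=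
    (coe_toNat_order hπ0).symm
  have hπpos : (arcAlgHom φ hφ π).order ≠ 0 := by
    rw [← addVal_powerSeries, Ne, IsDiscreteValuationRing.addVal_eq_zero_iff]
    exact fun h => hπ.not_isUnit (isUnit_of_map_unit (arcAlgHom φ hφ : _ →+* L⟦X⟧) π h)
  refine ⟨arcRing (φ : R →+* L⟦X⟧) hφ, inferInstance, inferInstance, inferInstance, inferInstance,
    inferInstance, inferInstance, isPrimeDivisorOver_arcRing φ hφ hθ, _,
    Nat.pos_of_ne_zero fun h => hπpos (hq.trans (congrArg _ h)), dvd_order_arcAlgHom φ hφ hr π,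
    fun x hx => ?_, fun u hu => ?_⟩
  · rw [← hq, ← addVal_powerSeries, ← addVal_powerSeries, ← arcAlgHom_algebraMap φ hφ]
    exact addVal_map_eq_mul (arcAlgHom φ hφ : _ →+* L⟦X⟧) hπ
      ((map_ne_zero_iff _ (algebraMap_arcRing_injective _ hφ)).2 hx)
  · simp only [← arcAlgHom_algebraMap φ hφ] at hu ⊢
    obtain ⟨k, hk, hdvd⟩ := exists_vanishesToOrder_wedgeD _ hπ hθ (fun j => hδ j _) hu
    refine ⟨k, hk, ?_⟩
    have hpow : (arcAlgHom φ hφ π ^ (k + 1)).order =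
        ((arcAlgHom φ hφ π).order.toNat * (k + 1) : ℕ) := by
      rw [order_pow, hq, ENat.toNat_natCast, mul_comm, Nat.cast_mul, nsmul_eq_mul]
    rw [← hpow, ← addVal_powerSeries, ← addVal_powerSeries]
    exact IsDiscreteValuationRing.addVal_le_iff_dvd.2 hdvd

end PrimeDivisor

section ArcField

/-- The coefficient field of the arcs: an algebraic closure of `ℂ(s, t)`. -/
abbrev ArcField : Type := AlgebraicClosure (FractionRing (MvPolynomial (Fin 2) ℂ))

/-- The transcendental generators `s` and `t` of `ArcField`. -/
noncomputable def arcGen (i : Fin 2) : ArcField :=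
  algebraMap (MvPolynomial (Fin 2) ℂ) ArcField (MvPolynomial.X i)

theorem isTranscendenceBasis_arcGen : IsTranscendenceBasis ℂ arcGen := by
  have := IsLocalization.isAlgebraic (R := MvPolynomial (Fin 2) ℂ)
    (FractionRing (MvPolynomial (Fin 2) ℂ)) (nonZeroDivisors (MvPolynomial (Fin 2) ℂ))
  have := Algebra.IsAlgebraic.trans (MvPolynomial (Fin 2) ℂ)
    (FractionRing (MvPolynomial (Fin 2) ℂ)) ArcField
  have := FaithfulSMul.trans (MvPolynomial (Fin 2) ℂ) (FractionRing (MvPolynomial (Fin 2) ℂ))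
    ArcField
  exact (IsTranscendenceBasis.mvPolynomial (Fin 2) ℂ).algebraMap_comp

instance formallyEtale_arcField : Algebra.FormallyEtale (MvPolynomial (Fin 2) ℂ) ArcField :=
  have := Algebra.FormallyEtale.of_isLocalization (Rₘ := FractionRing (MvPolynomial (Fin 2) ℂ))
    (nonZeroDivisors (MvPolynomial (Fin 2) ℂ))
  have := Algebra.FormallyEtale.of_isSeparable (FractionRing (MvPolynomial (Fin 2) ℂ)) ArcField
  .comp _ (FractionRing (MvPolynomial (Fin 2) ℂ)) _

theorem exists_derivation_arcField (i : Fin 2) :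
    ∃ d : Derivation ℂ ArcField ArcField, ∀ j, d (arcGen j) = if j = i then 1 else 0 := by
  let d₀ : Derivation ℂ (MvPolynomial (Fin 2) ℂ) ArcField :=
    MvPolynomial.mkDerivation ℂ fun j => if j = i then 1 else 0
  let ℓ := (LinearMap.liftBaseChange ArcField d₀.liftKaehlerDifferential).comp
    (KaehlerDifferential.tensorKaehlerEquivOfFormallyEtale ℂ (MvPolynomial (Fin 2) ℂ)
      ArcField).symm.toLinearMap
  refine ⟨ℓ.compDer (KaehlerDifferential.D ℂ ArcField), fun j => ?_⟩
  change ℓ (KaehlerDifferential.D ℂ ArcField (arcGen j)) = _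
  simp [ℓ, arcGen, KaehlerDifferential.tensorKaehlerEquivOfFormallyEtale_symm_D_algebraMap, d₀]

end ArcField

section PowerSeriesDerivation

open PowerSeries

variable {k L : Type*} [CommRing k]

/-- A derivation of the coefficients, extended to power series. -/
noncomputable def coeffDerivation [CommRing L] [Algebra k L] (d : Derivation k L L) :
    Derivation k L⟦X⟧ L⟦X⟧ :=
  Derivation.mk'
    { toFun := fun p => PowerSeries.mk fun n => d (coeff n p)
      map_add' := fun p q => by ext n; simp
      map_smul' := fun c p => by ext n; simp }
    fun p q => by
      ext n
      simp only [LinearMap.coe_mk, AddHom.coe_mk, coeff_mk, coeff_mul, map_sum,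
        Derivation.leibniz, map_add, smul_eq_mul, Finset.sum_add_distrib]
      congr 1
      rw [← Finset.Nat.sum_antidiagonal_swap]
      rfl

theorem coeff_coeffDerivation [CommRing L] [Algebra k L] (d : Derivation k L L) (p : L⟦X⟧)
    (n : ℕ) : coeff n (coeffDerivation d p) = d (coeff n p) := by
  simp [coeffDerivation]

theorem coeffDerivation_C_mul_X_pow [CommRing L] [Algebra k L] (d : Derivation k L L) (c : L)
    (n : ℕ) : coeffDerivation d (C c * X ^ n) = C (d c) * X ^ n := by
  ext m
  rw [coeff_coeffDerivation, coeff_C_mul, coeff_C_mul, coeff_X_pow]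
  split_ifs <;> simp

variable (k L) in
/-- The Euler derivation `X d/dX`. -/
noncomputable def eulerDerivation [CommRing L] [Algebra k L] : Derivation k L⟦X⟧ L⟦X⟧ :=
  (X : L⟦X⟧) • (PowerSeries.derivative L).restrictScalars k

theorem coeff_eulerDerivation [CommRing L] [Algebra k L] (p : L⟦X⟧) (n : ℕ) :
    coeff n (eulerDerivation k L p) = n * coeff n p := by
  change coeff n (X * PowerSeries.derivative L p) = _
  cases n with
  | zero => simp
  | succ n => rw [coeff_succ_X_mul, coeff_derivative, mul_comm]; push_cast; ring

theorem eulerDerivation_C_mul_X_pow [CommRing L] [Algebra k L] (c : L) (n : ℕ) :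
    eulerDerivation k L (C c * X ^ n) = C (n * c) * X ^ n := by
  ext m
  rw [coeff_eulerDerivation, coeff_C_mul, coeff_C_mul, coeff_X_pow]
  split_ifs with h
  · simp [h]
  · simp

theorem dvd_of_forall_coeff_eq_zero [Field L] {p q : L⟦X⟧}
    (h : ∀ n, coeff n p = 0 → coeff n q = 0) : p ∣ q := by
  refine IsDiscreteValuationRing.addVal_le_iff_dvd.1 ?_
  rw [addVal_powerSeries, addVal_powerSeries]
  exact le_order _ _ fun n hn => h n (coeff_of_lt_order n hn)

theorem dvd_coeffDerivation [Field L] [Algebra k L] (d : Derivation k L L) (p : L⟦X⟧) :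
    p ∣ coeffDerivation d p :=
  dvd_of_forall_coeff_eq_zero fun n hn => by rw [coeff_coeffDerivation, hn, map_zero]

theorem dvd_eulerDerivation [Field L] [Algebra k L] (p : L⟦X⟧) : p ∣ eulerDerivation k L p :=
  dvd_of_forall_coeff_eq_zero fun n hn => by rw [coeff_eulerDerivation, hn, mul_zero]

end PowerSeriesDerivation

section WeightedNorm

open MvPowerSeries
open scoped NNReal ENNReal

variable {σ R : Type*} [NormedRing R]

/-- The weighted `ℓ¹` norm of a power series on the polydisc of radius `ρ`; it is `∞` when the
series does not converge absolutely there. -/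
noncomputable def wnorm (ρ : ℝ≥0) (h : MvPowerSeries σ R) : ℝ≥0∞ :=
  ∑' n : σ →₀ ℕ, ‖coeff n h‖ₑ * ρ ^ n.degree

theorem wnorm_mono {ρ ρ' : ℝ≥0} (h : ρ ≤ ρ') (k : MvPowerSeries σ R) :
    wnorm ρ k ≤ wnorm ρ' k :=
  ENNReal.tsum_le_tsum fun n => by gcongr

theorem wnorm_add_le (ρ : ℝ≥0) (h k : MvPowerSeries σ R) :
    wnorm ρ (h + k) ≤ wnorm ρ h + wnorm ρ k := by
  rw [wnorm, wnorm, wnorm, ← ENNReal.tsum_add]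
  refine ENNReal.tsum_le_tsum fun n => ?_
  rw [← add_mul, map_add]
  gcongr
  exact enorm_add_le _ _

theorem enorm_coeff_mul_le [DecidableEq σ] (ρ : ℝ≥0) (h k : MvPowerSeries σ R) (n : σ →₀ ℕ) :
    ‖coeff n (h * k)‖ₑ * ρ ^ n.degree ≤ ∑ p ∈ Finset.HasAntidiagonal.antidiagonal n,
      (‖coeff p.1 h‖ₑ * ρ ^ p.1.degree) * (‖coeff p.2 k‖ₑ * ρ ^ p.2.degree) := by
  rw [coeff_mul]
  calc _ ≤ (∑ p ∈ Finset.HasAntidiagonal.antidiagonal n, ‖coeff p.1 h * coeff p.2 k‖ₑ) *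
        (ρ : ℝ≥0∞) ^ n.degree := by gcongr; exact enorm_sum_le _ _
    _ ≤ _ := by
      rw [Finset.sum_mul]
      refine Finset.sum_le_sum fun p hp => ?_
      rw [← Finset.HasAntidiagonal.mem_antidiagonal.1 hp, map_add, pow_add, mul_mul_mul_comm]
      gcongr
      simp only [enorm_eq_nnnorm]
      exact_mod_cast nnnorm_mul_le _ _

theorem wnorm_mul_le (ρ : ℝ≥0) (h k : MvPowerSeries σ R) :
    wnorm ρ (h * k) ≤ wnorm ρ h * wnorm ρ k := by
  classical
  calc wnorm ρ (h * k)
      ≤ ∑' n, ∑' p : Finset.HasAntidiagonal.antidiagonal n,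
          (‖coeff p.1.1 h‖ₑ * ρ ^ p.1.1.degree) * (‖coeff p.1.2 k‖ₑ * ρ ^ p.1.2.degree) := by
        refine ENNReal.tsum_le_tsum fun n => (enorm_coeff_mul_le ρ h k n).trans_eq ?_
        rw [tsum_fintype, Finset.sum_coe_sort _ fun p : (σ →₀ ℕ) × (σ →₀ ℕ) =>
          (‖coeff p.1 h‖ₑ * ρ ^ p.1.degree) * (‖coeff p.2 k‖ₑ * ρ ^ p.2.degree)]
    _ = ∑' p : (σ →₀ ℕ) × (σ →₀ ℕ),
          (‖coeff p.1 h‖ₑ * ρ ^ p.1.degree) * (‖coeff p.2 k‖ₑ * ρ ^ p.2.degree) := by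
        rw [← ENNReal.tsum_sigma]
        exact Finset.HasAntidiagonal.sigmaAntidiagonalEquivProd.tsum_eq fun p =>
          (‖coeff p.1 h‖ₑ * ρ ^ p.1.degree) * (‖coeff p.2 k‖ₑ * ρ ^ p.2.degree)
    _ = wnorm ρ h * wnorm ρ k := by
        rw [ENNReal.tsum_prod']
        simp_rw [ENNReal.tsum_mul_left, ENNReal.tsum_mul_right]
        rfl

theorem wnorm_le_div_pow_mul {ρ ρ₀ : ℝ≥0} (hρ₀ : 0 < ρ₀) (h : ρ ≤ ρ₀) {t : ℕ}
    {k : MvPowerSeries σ R} (hk : ∀ n, coeff n k ≠ 0 → t ≤ n.degree) :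
    wnorm ρ k ≤ ((ρ / ρ₀) ^ t : ℝ≥0) * wnorm ρ₀ k := by
  rw [wnorm, wnorm, ← ENNReal.tsum_mul_left]
  refine ENNReal.tsum_le_tsum fun n => ?_
  by_cases hn : coeff n k = 0
  · simp only [hn, enorm_zero, zero_mul, mul_zero, le_refl]
  have hpow : ρ ^ n.degree ≤ (ρ / ρ₀) ^ t * ρ₀ ^ n.degree := by
    obtain ⟨m, hm⟩ := Nat.exists_eq_add_of_le (hk n hn)
    rw [hm, pow_add, pow_add, ← mul_assoc, ← mul_pow, div_mul_cancel₀ _ hρ₀.ne']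
    gcongr
  rw [mul_left_comm]
  gcongr
  exact_mod_cast hpow

theorem wnorm_le_of_forall_coeff_eq {ρ : ℝ≥0} {c : ℝ≥0∞} {q : MvPowerSeries σ R}
    {u : ℕ → MvPowerSeries σ R} (hu : ∀ m, wnorm ρ (u m) ≤ c)
    (hq : ∀ m n, n.degree < m → coeff n (u m) = coeff n q) : wnorm ρ q ≤ c := by
  rw [wnorm, ENNReal.tsum_eq_iSup_sum]
  refine iSup_le fun t => ?_
  have hcoeff : ∀ n ∈ t, coeff n q = coeff n (u (t.sup Finsupp.degree + 1)) := fun n hn =>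
    (hq _ n (Nat.lt_succ_of_le (Finset.le_sup (f := Finsupp.degree) hn))).symm
  rw [Finset.sum_congr rfl fun n hn => by rw [hcoeff n hn]]
  exact (ENNReal.sum_le_tsum t).trans (hu _)

/-- Division by the monomial `x^s`, dropping the terms which are not divisible. -/
noncomputable def shift (s : σ →₀ ℕ) (h : MvPowerSeries σ R) : MvPowerSeries σ R :=
  fun n => coeff (n + s) h

theorem coeff_shift (s n : σ →₀ ℕ) (h : MvPowerSeries σ R) :
    coeff n (shift s h) = coeff (n + s) h := rfl

theorem pow_degree_mul_wnorm_shift_le (ρ : ℝ≥0) (s : σ →₀ ℕ) (h : MvPowerSeries σ R) :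
    (ρ : ℝ≥0∞) ^ s.degree * wnorm ρ (shift s h) ≤ wnorm ρ h := by
  rw [wnorm, ← ENNReal.tsum_mul_left]
  refine le_trans (le_of_eq (tsum_congr fun n => ?_))
    (ENNReal.tsum_comp_le_tsum_of_injective (add_left_injective s) _)
  rw [coeff_shift, map_add, pow_add, mul_left_comm, mul_comm (_ ^ _)]

theorem exists_wnorm_shift_mul_le {s : σ →₀ ℕ} {k : MvPowerSeries σ R} {ρ₀ : ℝ≥0} (hρ₀ : 0 < ρ₀)
    (hk : wnorm ρ₀ k ≠ ∞) (hks : ∀ n, coeff n k ≠ 0 → s.degree < n.degree) :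
    ∃ ρ₁, 0 < ρ₁ ∧ ∀ ρ, 0 < ρ → ρ ≤ ρ₁ →
      ∀ u : MvPowerSeries σ R, wnorm ρ (shift s (k * u)) ≤ 2⁻¹ * wnorm ρ u := by
  lift wnorm ρ₀ k to ℝ≥0 using hk with c hc
  obtain ⟨ρ₁, hρ₁, hρ₁c⟩ := exists_pos_mul_lt (show (0 : ℝ≥0) < 2⁻¹ by norm_num)
    (c / ρ₀ ^ (s.degree + 1))
  refine ⟨min ρ₀ ρ₁, lt_min hρ₀ hρ₁, fun ρ hρ hle u => ?_⟩
  have hkρ : wnorm ρ k ≤ ((ρ ^ s.degree * 2⁻¹ : ℝ≥0) : ℝ≥0∞) := by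
    refine (wnorm_le_div_pow_mul hρ₀ (hle.trans (min_le_left _ _)) hks).trans ?_
    rw [← hc, ← ENNReal.coe_mul, ENNReal.coe_le_coe]
    calc (ρ / ρ₀) ^ (s.degree + 1) * c = ρ ^ s.degree * (c / ρ₀ ^ (s.degree + 1) * ρ) := by
          rw [div_pow, pow_succ]; ring
      _ ≤ ρ ^ s.degree * (c / ρ₀ ^ (s.degree + 1) * ρ₁) := by
          gcongr; exact hle.trans (min_le_right _ _)
      _ ≤ _ := by gcongr
  have hpow : (ρ : ℝ≥0∞) ^ s.degree ≠ 0 := pow_ne_zero _ (ENNReal.coe_ne_zero.2 hρ.ne')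
  refine (ENNReal.mul_le_mul_iff_right hpow (ENNReal.pow_ne_top ENNReal.coe_ne_top)).1 ?_
  calc _ ≤ wnorm ρ (k * u) := pow_degree_mul_wnorm_shift_le ρ s _
    _ ≤ wnorm ρ k * wnorm ρ u := wnorm_mul_le ρ k u
    _ ≤ _ := by
      rw [← mul_assoc]
      gcongr
      simpa using hkρ

theorem coeff_shift_mul_congr {s : σ →₀ ℕ} {k : MvPowerSeries σ R}
    (hks : ∀ n, coeff n k ≠ 0 → s.degree < n.degree) {m : ℕ} {u v : MvPowerSeries σ R}
    (huv : ∀ n, n.degree < m → coeff n u = coeff n v) {n : σ →₀ ℕ} (hn : n.degree < m + 1) :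
    coeff n (shift s (k * u)) = coeff n (shift s (k * v)) := by
  classical
  rw [coeff_shift, coeff_shift, coeff_mul, coeff_mul]
  refine Finset.sum_congr rfl fun p hp => ?_
  by_cases hp0 : coeff p.1 k = 0
  · rw [hp0, zero_mul, zero_mul]
  have hdeg := congrArg Finsupp.degree (Finset.HasAntidiagonal.mem_antidiagonal.1 hp)
  have hlt := hks _ hp0
  rw [map_add, map_add] at hdeg
  rw [huv p.2 (by omega)]

theorem exists_eq_add_shift_mul {s : σ →₀ ℕ} {k : MvPowerSeries σ R} (H : MvPowerSeries σ R)
    (hks : ∀ n, coeff n k ≠ 0 → s.degree < n.degree) :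
    ∃ q, q = H + shift s (k * q) ∧
      ∀ m n, n.degree < m → coeff n ((fun u => H + shift s (k * u))^[m] 0) = coeff n q := by
  set T := fun u => H + shift s (k * u) with hT
  have hTcongr : ∀ {m u v}, (∀ n, n.degree < m → coeff n u = coeff n v) →
      ∀ n, n.degree < m + 1 → coeff n (T u) = coeff n (T v) := fun huv n hn => by
    rw [hT, map_add, map_add, coeff_shift_mul_congr hks huv hn]
  have hstep : ∀ m n, n.degree < m → coeff n (T^[m] 0) = coeff n (T^[m + 1] 0) := by
    intro m
    induction m with
    | zero => exact fun n hn => absurd hn n.degree.not_lt_zero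
    | succ m ih =>
      rw [Function.iterate_succ_apply', Function.iterate_succ_apply' T (m + 1)]
      exact hTcongr ih
  have hstab : ∀ m n, n.degree < m → coeff n (T^[m] 0) = coeff n (T^[n.degree + 1] 0) := by
    intro m n hm
    induction m, hm using Nat.le_induction with
    | base => rfl
    | succ m hm ih => rw [← hstep m n hm, ih]
  refine ⟨fun n => coeff n (T^[n.degree + 1] 0), MvPowerSeries.ext fun n => ?_, hstab⟩
  refine Eq.trans ?_ (hTcongr (hstab n.degree) n n.degree.lt_succ_self)
  rw [← Function.iterate_succ_apply' T]
  rfl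

theorem exists_eq_add_shift_mul_wnorm_le {s : σ →₀ ℕ} {k : MvPowerSeries σ R} {ρ₀ : ℝ≥0}
    (hρ₀ : 0 < ρ₀) (hk : wnorm ρ₀ k ≠ ∞) (hks : ∀ n, coeff n k ≠ 0 → s.degree < n.degree) :
    ∃ ρ₁, 0 < ρ₁ ∧ ∀ ρ, 0 < ρ → ρ ≤ ρ₁ → ∀ H, ∃ q,
      q = H + shift s (k * q) ∧ wnorm ρ q ≤ 2 * wnorm ρ H := by
  obtain ⟨ρ₁, hρ₁, hcontr⟩ := exists_wnorm_shift_mul_le hρ₀ hk hks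
  refine ⟨ρ₁, hρ₁, fun ρ hρ hle H => ?_⟩
  obtain ⟨q, hq, hcoeff⟩ := exists_eq_add_shift_mul H hks
  refine ⟨q, hq, wnorm_le_of_forall_coeff_eq (fun m => ?_) hcoeff⟩
  induction m with
  | zero => simp [wnorm]
  | succ m ih =>
    rw [Function.iterate_succ_apply']
    calc _ ≤ wnorm ρ H + wnorm ρ (shift s (k * _)) := wnorm_add_le _ _ _
      _ ≤ wnorm ρ H + 2⁻¹ * (2 * wnorm ρ H) := by
        gcongr
        exact (hcontr ρ hρ hle _).trans (by gcongr)
      _ = 2 * wnorm ρ H := by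
        rw [← mul_assoc, ENNReal.inv_mul_cancel two_ne_zero ENNReal.ofNat_ne_top, one_mul,
          two_mul]

end WeightedNorm

section Division

open MvPowerSeries
open scoped NNReal ENNReal

theorem isConvergent_iff_wnorm_ne_top {h : MvPowerSeries (Fin 4) ℂ} :
    IsConvergent h ↔ ∃ ρ : ℝ≥0, 0 < ρ ∧ wnorm ρ h ≠ ∞ := by
  have hsum : ∀ ρ : ℝ≥0, wnorm ρ h ≠ ∞ ↔
      Summable fun n : Fin 4 →₀ ℕ => ‖coeff n h‖ * (ρ : ℝ) ^ n.degree := fun ρ => by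
    have hiff := (ENNReal.tsum_coe_ne_top_iff_summable
      (f := fun n : Fin 4 →₀ ℕ => ‖coeff n h‖₊ * ρ ^ n.degree)).trans NNReal.summable_coe.symm
    simpa [wnorm, enorm] using hiff
  exact ⟨fun ⟨ρ, hρ, hs⟩ => ⟨⟨ρ, hρ.le⟩, hρ, (hsum _).2 hs⟩,
    fun ⟨ρ, hρ, hs⟩ => ⟨ρ, hρ, (hsum ρ).1 hs⟩⟩

theorem IsConvergent.exists_eq_add_shift_mul {s : Fin 4 →₀ ℕ} {k H : MvPowerSeries (Fin 4) ℂ}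
    (hk : IsConvergent k) (hH : IsConvergent H)
    (hks : ∀ n, coeff n k ≠ 0 → s.degree < n.degree) :
    ∃ q, IsConvergent q ∧ q = H + shift s (k * q) := by
  obtain ⟨ρ₀, hρ₀, hkρ⟩ := isConvergent_iff_wnorm_ne_top.1 hk
  obtain ⟨ρ₂, hρ₂, hHρ⟩ := isConvergent_iff_wnorm_ne_top.1 hH
  obtain ⟨ρ₁, hρ₁, hsol⟩ := exists_eq_add_shift_mul_wnorm_le hρ₀ hkρ hks
  have hρ : 0 < min ρ₁ ρ₂ := lt_min hρ₁ hρ₂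
  obtain ⟨q, hq, hle⟩ := hsol _ hρ (min_le_left _ _) H
  refine ⟨q, isConvergent_iff_wnorm_ne_top.2 ⟨_, hρ, ne_top_of_le_ne_top ?_ hle⟩, hq⟩
  exact ENNReal.mul_ne_top ENNReal.ofNat_ne_top
    (ne_top_of_le_ne_top hHρ (wnorm_mono (min_le_right _ _) H))

theorem IsConvergent.shift {h : MvPowerSeries (Fin 4) ℂ} (hh : IsConvergent h)
    (s : Fin 4 →₀ ℕ) : IsConvergent (shift s h) := by
  obtain ⟨ρ, hρ, hfin⟩ := isConvergent_iff_wnorm_ne_top.1 hh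
  refine isConvergent_iff_wnorm_ne_top.2 ⟨ρ, hρ, fun htop => hfin (top_le_iff.1 ?_)⟩
  have hle := pow_degree_mul_wnorm_shift_le ρ s h
  rwa [htop, ENNReal.mul_top (pow_ne_zero _ (ENNReal.coe_ne_zero.2 hρ.ne'))] at hle

theorem ConvSeries.isUnit_of_constantCoeff_ne_zero {h : ConvSeries}
    (hc : constantCoeff h.1 ≠ 0) : IsUnit h := by
  set c := constantCoeff h.1
  have hk : IsConvergent (1 - C c⁻¹ * h.1) :=
    ConvSeries.sub_mem ConvSeries.one_mem (ConvSeries.mul_mem (isConvergent_C c⁻¹) h.2)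
  have hk0 : coeff 0 (1 - C c⁻¹ * h.1) = 0 := by
    rw [coeff_zero_eq_constantCoeff_apply, map_sub, map_mul, map_one, constantCoeff_C,
      inv_mul_cancel₀ hc, sub_self]
  obtain ⟨q, hq, hqe⟩ := hk.exists_eq_add_shift_mul (s := 0) (ConvSeries.one_mem : IsConvergent 1)
    fun n hn => by
      rw [map_zero, Nat.pos_iff_ne_zero, Ne, Finsupp.degree_eq_zero_iff]
      rintro rfl
      exact hn hk0
  have hshift : shift 0 ((1 - C c⁻¹ * h.1) * q) = (1 - C c⁻¹ * h.1) * q :=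
    MvPowerSeries.ext fun n => by rw [coeff_shift, add_zero]
  rw [hshift] at hqe
  have hmul : h.1 * (C c⁻¹ * q) = 1 := by linear_combination hqe
  exact IsUnit.of_mul_eq_one ⟨C c⁻¹ * q, ConvSeries.mul_mem (isConvergent_C c⁻¹) hq⟩
    (Subtype.ext hmul)

theorem ConvSeries.exists_eq_coord_sq_add_mul_add {g : ConvSeries}
    (hg : ∀ n, coeff n g.1 ≠ 0 → 3 ≤ n.degree) (h : ConvSeries) :
    ∃ q p : ConvSeries, h = (coord 0 ^ 2 + g) * q + p ∧ ∀ n, coeff n p.1 ≠ 0 → n 0 ≤ 1 := by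
  -- `q` solves `q = (h - g q) / x₁²` up to terms not divisible by `x₁²`, which form `p`.
  obtain ⟨q, hq, hqe⟩ := IsConvergent.exists_eq_add_shift_mul (s := Finsupp.single 0 2)
    (k := -g.1) (ConvSeries.neg_mem g.2) (h.2.shift _) fun n hn => by
      rw [map_neg, neg_ne_zero] at hn
      rw [Finsupp.degree_single]
      exact hg n hn
  refine ⟨⟨q, hq⟩, h - (coord 0 ^ 2 + g) * ⟨q, hq⟩, by ring, fun n hn => ?_⟩
  by_contra! hlt
  obtain ⟨m, rfl⟩ : ∃ m, n = m + Finsupp.single 0 2 :=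
    ⟨n - Finsupp.single 0 2, (tsub_add_cancel_of_le (Finsupp.single_le_iff.2 hlt)).symm⟩
  refine hn ?_
  change coeff (m + Finsupp.single 0 2) (h.1 - (X 0 ^ 2 + g.1) * q) = 0
  have hcoeff := congrArg (coeff m) hqe
  rw [map_add, coeff_shift, coeff_shift] at hcoeff
  rw [add_mul, map_sub, map_add, X_pow_eq, add_comm m, coeff_add_monomial_mul, one_mul, hcoeff,
    neg_mul, map_neg, add_comm m]
  ring

end Division

section SquareRoot

open PowerSeries

variable {L : Type*} [Field L] [CharZero L]

theorem exists_sq_eq_one_add {w : L⟦X⟧} (hw : constantCoeff w = 0) :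
    ∃ u : L⟦X⟧, u ^ 2 = 1 + w := by
  have hs : PowerSeries.HasSubst w := PowerSeries.HasSubst.of_constantCoeff_zero' hw
  have hsqrt : binomialSeries L (1 / 2 : ℚ) ^ 2 = 1 + X := by
    rw [pow_two, ← binomialSeries_add, ← pow_one (1 + X), ← binomialSeries_nat (R := ℚ) (A := L)]
    norm_num
  refine ⟨PowerSeries.substAlgHom (R := L) hs (binomialSeries L (1 / 2 : ℚ)), ?_⟩
  rw [← map_pow, hsqrt, map_add, map_one, substAlgHom_X]

theorem exists_sq_eq_of_constantCoeff_ne_zero [IsAlgClosed L] {v : L⟦X⟧}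
    (hv : constantCoeff v ≠ 0) : ∃ u : L⟦X⟧, u ^ 2 = v := by
  obtain ⟨c, hc⟩ := IsAlgClosed.exists_pow_nat_eq (constantCoeff v) two_pos
  obtain ⟨u, hu⟩ := exists_sq_eq_one_add (w := C (constantCoeff v)⁻¹ * v - 1)
    (by rw [map_sub, map_mul, constantCoeff_C, map_one, inv_mul_cancel₀ hv, sub_self])
  refine ⟨C c * u, ?_⟩
  rw [mul_pow, ← map_pow, hc, hu, add_sub_cancel, ← mul_assoc, ← map_mul, mul_inv_cancel₀ hv,
    map_one, one_mul]

theorem rescale_eq_self_of_rescale_sq {η : L} {u : L⟦X⟧} (hu : constantCoeff u ≠ 0)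
    (h : rescale η (u ^ 2) = u ^ 2) : rescale η u = u := by
  rw [map_pow] at h
  refine (sq_eq_sq_iff_eq_or_eq_neg.1 h).resolve_right fun hneg => hu ?_
  have hconst := congrArg (coeff 0) hneg
  rw [coeff_rescale, pow_zero, one_mul, map_neg, coeff_zero_eq_constantCoeff_apply] at hconst
  exact self_eq_neg.1 hconst

theorem exists_X_pow_mul_sq_eq [IsAlgClosed L] {p : L⟦X⟧} {m : ℕ} (hp : p.order = (2 * m : ℕ))
    {η : L} (hη : η ≠ 0) (hηp : rescale η p = C (η ^ (2 * m)) * p) :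
    ∃ u : L⟦X⟧, (X ^ m * u) ^ 2 = p ∧ constantCoeff u ≠ 0 ∧ rescale η u = u := by
  have hp0 : p ≠ 0 := fun h => ENat.natCast_ne_top _ (by rw [← hp, h, order_zero])
  have hv0 : constantCoeff (divXPowOrder p) ≠ 0 :=
    (isUnit_iff_constantCoeff.1 (isUnit_divided_by_X_pow_order hp0)).ne_zero
  have hpv : X ^ (2 * m) * divXPowOrder p = p := by
    conv_rhs => rw [← X_pow_order_mul_divXPowOrder (f := p), hp, ENat.toNat_natCast]
  obtain ⟨u, hu⟩ := exists_sq_eq_of_constantCoeff_ne_zero hv0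
  have hu0 : constantCoeff u ≠ 0 := fun h => hv0 (by rw [← hu, map_pow, h, zero_pow two_ne_zero])
  refine ⟨u, by rw [mul_pow, hu, ← pow_mul, mul_comm m, hpv], hu0,
    rescale_eq_self_of_rescale_sq hu0 ?_⟩
  rw [← hpv, map_mul, map_pow, rescale_X, mul_pow, ← map_pow, mul_assoc, ← hu] at hηp
  exact mul_left_cancel₀ (pow_ne_zero (2 * m) X_ne_zero)
    (mul_left_cancel₀ ((map_ne_zero_iff C C_injective).2 (pow_ne_zero _ hη)) hηp)

end SquareRoot

section AlgebraicIndependence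

variable {k L ι : Type*}

theorem isTranscendenceBasis_of_pow_eq [Field k] [Field L] [Algebra k L] [Finite ι]
    {x s : ι → L} (hx : IsTranscendenceBasis k x) {m : ℕ}
    (hs : ∀ i, s i ^ m = x i) : IsTranscendenceBasis k s := by
  have hle : Algebra.adjoin k (Set.range x) ≤ Algebra.adjoin k (Set.range s) := by
    refine Algebra.adjoin_le (Set.range_subset_iff.2 fun i => ?_)
    rw [← hs]
    exact pow_mem (Algebra.subset_adjoin (Set.mem_range_self i)) m
  have : Algebra.IsAlgebraic (Algebra.adjoin k (Set.range s)) L :=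
    ⟨fun y => (hx.isAlgebraic.isAlgebraic y).tower_top_of_subalgebra_le hle⟩
  exact Algebra.IsAlgebraic.isTranscendenceBasis_of_lift_le_trdeg_of_finite k s
    hx.lift_cardinalMk_eq_trdeg.le

theorem linearIndependent_prod_pow_of_algebraicIndependent [CommRing k] [CommRing L] [Algebra k L]
    [Fintype ι] {s : ι → L} (hs : AlgebraicIndependent k s) :
    LinearIndependent k fun m : ι →₀ ℕ => ∏ i, s i ^ m i := by
  have hmap : (fun m : ι →₀ ℕ => ∏ i, s i ^ m i) =
      (MvPolynomial.aeval (R := k) s).toLinearMap ∘ MvPolynomial.basisMonomials ι k := by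
    ext m
    simp [MvPolynomial.aeval_monomial, Finsupp.prod_fintype]
  rw [hmap]
  exact (MvPolynomial.basisMonomials ι k).linearIndependent.map' _ (LinearMap.ker_eq_bot.2 hs)

end AlgebraicIndependence

section EvalArc

open PowerSeries

variable {L : Type*} [Field L] [Algebra ℂ L]

/-- Composition of a germ with the formal arc whose coordinates are the series `A i`. -/
noncomputable def evalArc (A : Fin 4 → L⟦X⟧) (hA : ∀ i, constantCoeff (A i) = 0) :
    ConvSeries →ₐ[ℂ] L⟦X⟧ :=
  (MvPowerSeries.substAlgHom
    (MvPowerSeries.hasSubst_of_constantCoeff_zero (a := A) hA)).comp ConvSeries.val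

variable {A : Fin 4 → L⟦X⟧} (hA : ∀ i, constantCoeff (A i) = 0)

theorem evalArc_coord (i : Fin 4) : evalArc A hA (coord i) = A i :=
  MvPowerSeries.substAlgHom_X (MvPowerSeries.hasSubst_of_constantCoeff_zero (a := A) hA) i

theorem coeff_evalArc (h : ConvSeries) (N : ℕ) :
    coeff N (evalArc A hA h) =
      ∑ᶠ n : Fin 4 →₀ ℕ, MvPowerSeries.coeff n h.1 • coeff N (∏ i, A i ^ n i) := by
  have hs := MvPowerSeries.hasSubst_of_constantCoeff_zero (a := A) hA
  refine (congrArg (coeff N) (MvPowerSeries.substAlgHom_apply hs h.1)).trans ?_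
  refine (MvPowerSeries.coeff_subst hs h.1 (Finsupp.single () N)).trans (finsum_congr fun n => ?_)
  rw [Finsupp.prod_fintype _ _ fun i => pow_zero _]
  rfl

theorem constantCoeff_evalArc (h : ConvSeries) :
    constantCoeff (evalArc A hA h) = algebraMap ℂ L (MvPowerSeries.constantCoeff h.1) := by
  rw [← coeff_zero_eq_constantCoeff_apply, coeff_evalArc, finsum_eq_single _ 0]
  · simp [Algebra.smul_def]
  · intro n hn
    obtain ⟨i, hi⟩ := Finsupp.ne_iff.1 hn
    rw [coeff_zero_eq_constantCoeff_apply, map_prod, Finset.prod_eq_zero (Finset.mem_univ i),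
      smul_zero]
    rw [map_pow, hA, zero_pow hi]

theorem coeff_mu (r : ℕ) (a : Fin 4 → ℕ) (h : ConvSeries) (n : Fin 4 →₀ ℕ) :
    MvPowerSeries.coeff n (mu r a h).1 =
      (∏ i, (xi r ^ a i) ^ n i) * MvPowerSeries.coeff n h.1 := by
  change MvPowerSeries.coeff n (MvPowerSeries.rescale _ h.1) = _
  rw [MvPowerSeries.coeff_rescale, Finsupp.prod_fintype _ _ fun i => pow_zero _]

theorem rescale_evalArc {η : L} {r : ℕ} {a : Fin 4 → ℕ}
    (hη : ∀ i, rescale η (A i) = C (algebraMap ℂ L (xi r ^ a i)) * A i) (h : ConvSeries) :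
    rescale η (evalArc A hA h) = evalArc A hA (mu r a h) := by
  ext N
  rw [coeff_rescale, coeff_evalArc, coeff_evalArc, ← smul_eq_mul, smul_finsum]
  refine finsum_congr fun n => ?_
  have hprod : rescale η (∏ i, A i ^ n i) =
      C (algebraMap ℂ L (∏ i, (xi r ^ a i) ^ n i)) * ∏ i, A i ^ n i := by
    rw [map_prod, map_prod, map_prod, ← Finset.prod_mul_distrib]
    refine Finset.prod_congr rfl fun i _ => ?_
    rw [map_pow, hη, mul_pow, map_pow (algebraMap ℂ L) _ (n i), map_pow C]
  have hcoeff := congrArg (coeff N) hprod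
  rw [coeff_rescale, coeff_C_mul] at hcoeff
  rw [coeff_mu, smul_eq_mul, mul_smul_comm, hcoeff, mul_comm (∏ i, _), mul_smul,
    Algebra.smul_def (∏ i, _)]

end EvalArc

section WeightedArc

open PowerSeries

/-- The weight `∑ bᵢ nᵢ` of the monomial `x^n`. -/
def wt (b : Fin 4 → ℕ) (n : Fin 4 →₀ ℕ) : ℕ := ∑ i, b i * n i

theorem finite_setOf_wt_eq {b : Fin 4 → ℕ} (hb : ∀ i, 0 < b i) (N : ℕ) :
    {n | wt b n = N}.Finite := by
  refine (Set.finite_Iic (Finsupp.equivFunOnFinite.symm fun _ : Fin 4 => N)).subset ?_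
  rintro n rfl i
  calc n i ≤ b i * n i := Nat.le_mul_of_pos_left _ (hb i)
    _ ≤ wt b n := Finset.single_le_sum (f := fun i => b i * n i) (fun _ _ => Nat.zero_le _)
        (Finset.mem_univ i)

variable {L : Type*} [Field L]

/-- The coordinates of an arc on which the monomial `x^n` has order `wt b n`; the unit `u` is
later chosen so that the arc lies on a given hypersurface. -/
noncomputable def weightedArc (b : Fin 4 → ℕ) (s : Fin 2 → L) (u : L⟦X⟧) : Fin 4 → L⟦X⟧ :=
  ![X ^ b 0 * u, X ^ b 1, C (s 0) * X ^ b 2, C (s 1) * X ^ b 3]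

theorem constantCoeff_weightedArc {b : Fin 4 → ℕ} (hb : ∀ i, 0 < b i) (s : Fin 2 → L)
    (u : L⟦X⟧) (i : Fin 4) : constantCoeff (weightedArc b s u i) = 0 := by
  fin_cases i <;> simp [weightedArc, zero_pow (hb _).ne']

theorem rescale_weightedArc {b : Fin 4 → ℕ} (s : Fin 2 → L) {u : L⟦X⟧} {η : L}
    (hu : rescale η u = u) (i : Fin 4) :
    rescale η (weightedArc b s u i) = C (η ^ b i) * weightedArc b s u i := by
  have hC : ∀ c : L, rescale η (C c) = C c := fun c => by
    ext n
    rw [coeff_rescale, coeff_C]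
    split_ifs with hn <;> simp [hn]
  fin_cases i <;> simp [weightedArc, rescale_X, mul_pow, hu, hC] <;> ring

theorem prod_weightedArc_pow (b : Fin 4 → ℕ) (s : Fin 2 → L) (u : L⟦X⟧)
    {n : Fin 4 →₀ ℕ} (hn : n 0 = 0) :
    ∏ i, weightedArc b s u i ^ n i = C (∏ i : Fin 2, s i ^ ![n 2, n 3] i) * X ^ wt b n := by
  simp only [weightedArc, wt, Fin.prod_univ_four, Fin.prod_univ_two, Fin.sum_univ_four, hn,
    Matrix.cons_val, map_mul, map_pow]
  ring

variable [Algebra ℂ L] {b : Fin 4 → ℕ} (hb : ∀ i, 0 < b i)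

/-- Composition of a germ with a weighted arc. -/
noncomputable def weightedArcHom (s : Fin 2 → L) (u : L⟦X⟧) : ConvSeries →ₐ[ℂ] L⟦X⟧ :=
  evalArc (weightedArc b s u) (constantCoeff_weightedArc hb s u)

theorem coeff_weightedArcHom (s : Fin 2 → L) (u : L⟦X⟧) {h : ConvSeries}
    (hx₀ : ∀ n, MvPowerSeries.coeff n h.1 ≠ 0 → n 0 = 0) (N : ℕ) :
    coeff N (weightedArcHom hb s u h) = ∑ n ∈ (finite_setOf_wt_eq hb N).toFinset,
      MvPowerSeries.coeff n h.1 • ∏ i : Fin 2, s i ^ ![n 2, n 3] i := by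
  have hterm : ∀ n, MvPowerSeries.coeff n h.1 • coeff N (∏ i, weightedArc b s u i ^ n i) =
      if wt b n = N then MvPowerSeries.coeff n h.1 • ∏ i : Fin 2, s i ^ ![n 2, n 3] i
      else 0 := by
    intro n
    by_cases hn : MvPowerSeries.coeff n h.1 = 0
    · simp only [hn, zero_smul, ite_self]
    · rw [prod_weightedArc_pow b s u (hx₀ n hn), coeff_C_mul, coeff_X_pow, mul_ite, mul_one,
        mul_zero, smul_ite, smul_zero]
      simp only [eq_comm]
  rw [weightedArcHom, coeff_evalArc, finsum_congr hterm,
    finsum_eq_sum_of_support_subset (s := (finite_setOf_wt_eq hb N).toFinset)]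
  · exact Finset.sum_congr rfl fun n hn => if_pos ((finite_setOf_wt_eq hb _).mem_toFinset.1 hn)
  · intro n hn
    rw [Finset.mem_coe, Set.Finite.mem_toFinset]
    by_contra hne
    exact hn (if_neg hne)

theorem weightedArcHom_congr (s : Fin 2 → L) (u v : L⟦X⟧) {h : ConvSeries}
    (hx₀ : ∀ n, MvPowerSeries.coeff n h.1 ≠ 0 → n 0 = 0) :
    weightedArcHom hb s u h = weightedArcHom hb s v h := by
  ext N
  rw [coeff_weightedArcHom hb s u hx₀, coeff_weightedArcHom hb s v hx₀]

theorem exists_wt_eq_of_coeff_weightedArcHom_ne_zero {s : Fin 2 → L} {u : L⟦X⟧} {h : ConvSeries}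
    (hx₀ : ∀ n, MvPowerSeries.coeff n h.1 ≠ 0 → n 0 = 0) {N : ℕ}
    (hN : coeff N (weightedArcHom hb s u h) ≠ 0) :
    ∃ n, MvPowerSeries.coeff n h.1 ≠ 0 ∧ wt b n = N := by
  rw [coeff_weightedArcHom hb s u hx₀] at hN
  obtain ⟨n, hn, hne⟩ := Finset.exists_ne_zero_of_sum_ne_zero hN
  exact ⟨n, (smul_ne_zero_iff.1 hne).1, (finite_setOf_wt_eq hb _).mem_toFinset.1 hn⟩

theorem rescale_weightedArcHom_of_modEq (s : Fin 2 → L) (u : L⟦X⟧) {h : ConvSeries}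
    (hx₀ : ∀ n, MvPowerSeries.coeff n h.1 ≠ 0 → n 0 = 0) {η : L} {r N : ℕ} (hη : η ^ r = 1)
    (hN : ∀ n, MvPowerSeries.coeff n h.1 ≠ 0 → wt b n ≡ N [MOD r]) :
    rescale η (weightedArcHom hb s u h) = C (η ^ N) * weightedArcHom hb s u h := by
  ext M
  rw [coeff_rescale, coeff_C_mul]
  by_cases hM : coeff M (weightedArcHom hb s u h) = 0
  · rw [hM, mul_zero, mul_zero]
  obtain ⟨n, hn, rfl⟩ := exists_wt_eq_of_coeff_weightedArcHom_ne_zero hb hx₀ hM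
  rw [pow_eq_pow_mod (wt b n) hη, pow_eq_pow_mod N hη, hN n hn]

theorem coeff_weightedArcHom_wt_ne_zero {s : Fin 2 → L} (hs : AlgebraicIndependent ℂ s)
    (u : L⟦X⟧) {h : ConvSeries} (hx₀ : ∀ n, MvPowerSeries.coeff n h.1 ≠ 0 → n 0 = 0)
    {n : Fin 4 →₀ ℕ} (hn : MvPowerSeries.coeff n h.1 ≠ 0) :
    coeff (wt b n) (weightedArcHom hb s u h) ≠ 0 := by
  classical
  set e : (Fin 4 →₀ ℕ) → (Fin 2 →₀ ℕ) := fun n => Finsupp.equivFunOnFinite.symm ![n 2, n 3]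
  set F := {m ∈ (finite_setOf_wt_eq hb (wt b n)).toFinset | MvPowerSeries.coeff m h.1 ≠ 0}
  have hF : ∀ m ∈ F, wt b m = wt b n ∧ m 0 = 0 := fun m hm => by
    obtain ⟨hwt, hm⟩ := Finset.mem_filter.1 hm
    exact ⟨(finite_setOf_wt_eq hb _).mem_toFinset.1 hwt, hx₀ m hm⟩
  -- A monomial free of `x₁` is determined by its weight and its exponents in `x₃` and `x₄`.
  have he : Set.InjOn e F := fun m hm m' hm' hmm' => by
    have h2 : m 2 = m' 2 := DFunLike.congr_fun hmm' 0
    have h3 : m 3 = m' 3 := DFunLike.congr_fun hmm' 1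
    have hwt := (hF m hm).1.trans (hF m' hm').1.symm
    rw [wt, wt, Fin.sum_univ_four, Fin.sum_univ_four, (hF m hm).2, (hF m' hm').2, h2, h3,
      Nat.add_right_cancel_iff, Nat.add_right_cancel_iff, Nat.add_left_cancel_iff] at hwt
    ext i
    fin_cases i
    exacts [(hF m hm).2.trans (hF m' hm').2.symm, Nat.eq_of_mul_eq_mul_left (hb 1) hwt, h2, h3]
  have hind : LinearIndepOn ℂ (fun m => ∏ i, s i ^ e m i) (F : Set (Fin 4 →₀ ℕ)) :=
    (linearIndependent_prod_pow_of_algebraicIndependent hs).comp _ he.injective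
  rw [coeff_weightedArcHom hb s u hx₀, ← Finset.sum_filter_of_ne fun m _ hm =>
    (smul_ne_zero_iff.1 hm).1]
  exact fun hzero => hn (linearIndepOn_finset_iff.1 hind _ hzero n
    (Finset.mem_filter.2 ⟨(finite_setOf_wt_eq hb _).mem_toFinset.2 rfl, hn⟩))

theorem weightedArcHom_ne_zero {s : Fin 2 → L} (hs : AlgebraicIndependent ℂ s)
    (u : L⟦X⟧) {h : ConvSeries} (hx₀ : ∀ n, MvPowerSeries.coeff n h.1 ≠ 0 → n 0 = 0)
    (hh : h ≠ 0) : weightedArcHom hb s u h ≠ 0 := by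
  obtain ⟨n, hn⟩ : ∃ n, MvPowerSeries.coeff n h.1 ≠ 0 := by
    by_contra! hzero
    exact hh (Subtype.ext (MvPowerSeries.ext hzero))
  exact fun hzero => coeff_weightedArcHom_wt_ne_zero hb hs u hx₀ hn (by rw [hzero, map_zero])

theorem order_weightedArcHom {s : Fin 2 → L} (hs : AlgebraicIndependent ℂ s) (u : L⟦X⟧)
    {h : ConvSeries} (hx₀ : ∀ n, MvPowerSeries.coeff n h.1 ≠ 0 → n 0 = 0) {N : ℕ}
    (hN : ∃ n, MvPowerSeries.coeff n h.1 ≠ 0 ∧ wt b n = N)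
    (hmin : ∀ n, MvPowerSeries.coeff n h.1 ≠ 0 → N ≤ wt b n) :
    (weightedArcHom hb s u h).order = N := by
  obtain ⟨n, hn, rfl⟩ := hN
  refine order_eq_nat.2 ⟨coeff_weightedArcHom_wt_ne_zero hb hs u hx₀ hn, fun M hM => ?_⟩
  by_contra hne
  obtain ⟨m, hm, rfl⟩ := exists_wt_eq_of_coeff_weightedArcHom_ne_zero hb hx₀ hne
  exact hM.not_ge (hmin m hm)

end WeightedArc

section CyclicAction

theorem ConvSeries.ext_coeff {h k : ConvSeries}
    (H : ∀ n, MvPowerSeries.coeff n h.1 = MvPowerSeries.coeff n k.1) : h = k :=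
  Subtype.ext (MvPowerSeries.ext H)

theorem isPrimitiveRoot_xi {r : ℕ} (hr : r ≠ 0) : IsPrimitiveRoot (xi r) r :=
  Complex.isPrimitiveRoot_exp r hr

theorem xi_ne_zero (r : ℕ) : xi r ≠ 0 := Complex.exp_ne_zero _

theorem xi_pow_eq_xi_pow_iff {r : ℕ} (hr : r ≠ 0) {m n : ℕ} :
    xi r ^ m = xi r ^ n ↔ m ≡ n [MOD r] := by
  rw [((isPrimitiveRoot_xi hr).isOfFinOrder hr).pow_eq_pow_iff_modEq,
    ← (isPrimitiveRoot_xi hr).eq_orderOf]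

theorem coeff_mu_eq_xi_pow_mul (r : ℕ) (a : Fin 4 → ℕ) (h : ConvSeries) (n : Fin 4 →₀ ℕ) :
    MvPowerSeries.coeff n (mu r a h).1 = xi r ^ wt a n * MvPowerSeries.coeff n h.1 := by
  rw [coeff_mu, wt, ← Finset.prod_pow_eq_pow_sum]
  simp only [pow_mul]

theorem mu_comm (r s : ℕ) (a b : Fin 4 → ℕ) (h : ConvSeries) :
    mu r a (mu s b h) = mu s b (mu r a h) :=
  ConvSeries.ext_coeff fun n => by simp only [coeff_mu, mul_left_comm]

theorem mu_add (r : ℕ) (a b : Fin 4 → ℕ) (h : ConvSeries) :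
    mu r (a + b) h = mu r a (mu r b h) :=
  ConvSeries.ext_coeff fun n => by
    simp only [coeff_mu, Pi.add_apply, pow_add, mul_pow, Finset.prod_mul_distrib, mul_assoc]

theorem mu_coord (r : ℕ) (a : Fin 4 → ℕ) (i : Fin 4) : mu r a (coord i) = xi r ^ a i • coord i := by
  classical
  refine ConvSeries.ext_coeff fun n => ?_
  change _ = xi r ^ a i * MvPowerSeries.coeff n (MvPowerSeries.X i)
  rw [coeff_mu_eq_xi_pow_mul, coord, MvPowerSeries.coeff_X]
  split_ifs with hn
  · simp [hn, wt, Finsupp.single_apply]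
  · rw [mul_zero, mul_zero]

theorem mu_coord_pow_self {r : ℕ} (hr : r ≠ 0) (a : Fin 4 → ℕ) (i : Fin 4) :
    mu r a (coord i ^ r) = coord i ^ r := by
  rw [map_pow, mu_coord, smul_pow, ← pow_mul, mul_comm, pow_mul,
    (isPrimitiveRoot_xi hr).pow_eq_one, one_pow, one_smul]

theorem wt_modEq_of_semiInvariant {r : ℕ} (hr : r ≠ 0) {a : Fin 4 → ℕ} {e : ℕ} {f : ConvSeries}
    (hf : mu r a f = xi r ^ e • f) {n : Fin 4 →₀ ℕ} (hn : MvPowerSeries.coeff n f.1 ≠ 0) :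
    wt a n ≡ e [MOD r] := by
  have hcoeff : xi r ^ e * MvPowerSeries.coeff n f.1 = xi r ^ wt a n * MvPowerSeries.coeff n f.1 :=
    (congrArg (fun h : ConvSeries => MvPowerSeries.coeff n h.1) hf).symm.trans
      (coeff_mu_eq_xi_pow_mul r a f n)
  exact (xi_pow_eq_xi_pow_iff hr).1 (mul_right_cancel₀ hn hcoeff).symm

theorem wt_modEq {r j : ℕ} {a b : Fin 4 → ℕ} (hab : ∀ i, b i ≡ j * a i [MOD r])
    (n : Fin 4 →₀ ℕ) : wt b n ≡ j * wt a n [MOD r] := by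
  rw [wt, wt, Finset.mul_sum]
  refine Nat.ModEq.sum fun i _ => ?_
  rw [← mul_assoc]
  exact (hab i).mul_right _

end CyclicAction

section ArcOnHypersurface

open PowerSeries

variable {L : Type*} [Field L] [CharZero L] [IsAlgClosed L] [Algebra ℂ L] {b : Fin 4 → ℕ}
  (hb : ∀ i, 0 < b i)

/- The equation `x₁² = -g` is solved along the arc for its first coordinate, which is possible
because `-g` has even order there. -/
theorem exists_weightedArcHom_eq_zero {r j : ℕ} (hr : r ≠ 0) {a : Fin 4 → ℕ}
    (hab : ∀ i, b i ≡ j * a i [MOD r]) {s : Fin 2 → L} (hs : AlgebraicIndependent ℂ s)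
    {g : ConvSeries} (hx₀ : ∀ n, MvPowerSeries.coeff n g.1 ≠ 0 → n 0 = 0)
    (hmod : ∀ n, MvPowerSeries.coeff n g.1 ≠ 0 → wt b n ≡ 2 * b 0 [MOD r])
    (hex : ∃ n, MvPowerSeries.coeff n g.1 ≠ 0 ∧ wt b n = 2 * b 0)
    (hmin : ∀ n, MvPowerSeries.coeff n g.1 ≠ 0 → 2 * b 0 ≤ wt b n) :
    ∃ u : L⟦X⟧, constantCoeff u ≠ 0 ∧ weightedArcHom hb s u (coord 0 ^ 2 + g) = 0 ∧
      ∀ h, rescale (algebraMap ℂ L (xi r)) (weightedArcHom hb s u h) =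
        weightedArcHom hb s u (mu r (fun i => j * a i) h) := by
  set η := algebraMap ℂ L (xi r)
  have hη : η ^ r = 1 := by rw [← map_pow, (isPrimitiveRoot_xi hr).pow_eq_one, map_one]
  obtain ⟨u, hsq, hu0, hu⟩ := exists_X_pow_mul_sq_eq (p := -weightedArcHom hb s 1 g)
    (m := b 0) (η := η)
    (by rw [order_neg, order_weightedArcHom hb hs 1 hx₀ hex hmin])
    ((_root_.map_ne_zero _).2 (xi_ne_zero r))
    (by rw [map_neg, rescale_weightedArcHom_of_modEq hb s 1 hx₀ hη hmod, mul_neg])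
  refine ⟨u, hu0, ?_, rescale_evalArc _ fun i => ?_⟩
  · rw [map_add, map_pow, weightedArcHom_congr hb s u 1 hx₀]
    exact (congrArg (· ^ 2 + _) (evalArc_coord _ 0)).trans
      ((congrArg (· + _) hsq).trans (neg_add_cancel _))
  · rw [rescale_weightedArc s hu i, ← map_pow, (xi_pow_eq_xi_pow_iff hr).2 (hab i)]

end ArcOnHypersurface

section LocalRing

variable {r : ℕ} {a : Fin 4 → ℕ} {f g h : ConvSeries}

theorem mem_localRingX_iff {x : LocalRingY f} :
    x ∈ LocalRingX r a f ↔ ∃ h : ConvSeries, toY f (mu r a h) = toY f h ∧ toY f h = x :=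
  Subalgebra.mem_map

theorem toY_eq_iff {k : ConvSeries} : toY f h = toY f k ↔ f ∣ h - k := by
  rw [← Ideal.mem_span_singleton]
  exact Ideal.Quotient.mk_eq_mk_iff_sub_mem h k

theorem toY_eq_zero_iff : toY f h = 0 ↔ f ∣ h := by
  rw [← map_zero (toY f), toY_eq_iff, sub_zero]

theorem toY_map_eq_toY_map {τ : ConvSeries →ₐ[ℂ] ConvSeries} (hf : f ∣ τ f) {k : ConvSeries}
    (hk : toY f h = toY f k) : toY f (τ h) = toY f (τ k) := by
  rw [toY_eq_iff] at hk ⊢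
  rw [← map_sub]
  exact hf.trans (map_dvd τ hk)

theorem toY_mu_mul (hf : f ∣ mu r a f) (hh : toY f (mu r a h) = toY f h) (j : ℕ) :
    toY f (mu r (fun i => j * a i) h) = toY f h := by
  induction j with
  | zero =>
    refine congrArg _ (ConvSeries.ext_coeff fun n => ?_)
    simp [coeff_mu]
  | succ j ih =>
    have hadd : (fun i => (j + 1) * a i) = a + fun i => j * a i :=
      funext fun i => by rw [Pi.add_apply, add_one_mul, add_comm]
    rw [hadd, mu_add]
    exact (toY_map_eq_toY_map hf ih).trans hh

theorem isUnit_localRingX (hh : toY f (mu r a h) = toY f h) (hu : IsUnit h)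
    {x : LocalRingX r a f} (hx : (x : LocalRingY f) = toY f h) : IsUnit x := by
  obtain ⟨k, hk⟩ := hu.exists_right_inv
  have hhk : toY f h * toY f k = 1 := by rw [← map_mul, hk, map_one]
  have hinv : toY f (mu r a k) = toY f k := by
    have hmu : toY f h * toY f (mu r a k) = 1 := by
      rw [← hh, ← map_mul, ← map_mul, hk, map_one, map_one]
    exact (hu.map (toY f)).mul_left_cancel (hmu.trans hhk.symm)
  exact IsUnit.of_mul_eq_one ⟨_, mem_localRingX_iff.2 ⟨k, hinv, rfl⟩⟩
    (Subtype.ext ((congrArg (· * toY f k) hx).trans hhk))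

theorem isDomain_localRingX (hne : (logDiscrepancies r a f).Nonempty) :
    IsDomain (LocalRingX r a f) := by
  obtain ⟨_, V, _, _, _, _, _, _, hV, _⟩ := hne
  exact Function.Injective.isDomain (algebraMap (LocalRingX r a f) V) hV.injective

end LocalRing

section Reflection

/-- The reflection `x₁ ↦ -x₁`, an automorphism of every germ `x₁² + g(x₂, x₃, x₄) = 0`. -/
noncomputable def reflection : ConvSeries →ₐ[ℂ] ConvSeries := mu 2 ![1, 0, 0, 0]

variable {r : ℕ} {a : Fin 4 → ℕ} {g h : ConvSeries}

theorem coeff_reflection (h : ConvSeries) (n : Fin 4 →₀ ℕ) :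
    MvPowerSeries.coeff n (reflection h).1 = (-1) ^ n 0 * MvPowerSeries.coeff n h.1 := by
  have hxi : xi 2 = -1 := (isPrimitiveRoot_xi two_ne_zero).eq_neg_one_of_two_right
  rw [reflection, coeff_mu, Fin.prod_univ_four, hxi]
  simp

theorem reflection_reflection (h : ConvSeries) : reflection (reflection h) = h :=
  ConvSeries.ext_coeff fun n => by
    rw [coeff_reflection, coeff_reflection, ← mul_assoc, ← mul_pow, neg_one_mul, neg_neg, one_pow,
      one_mul]

theorem reflection_eq_self (hx₀ : ∀ n, MvPowerSeries.coeff n h.1 ≠ 0 → n 0 = 0) :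
    reflection h = h := by
  refine ConvSeries.ext_coeff fun n => ?_
  rw [coeff_reflection]
  by_cases hn : MvPowerSeries.coeff n h.1 = 0
  · rw [hn, mul_zero]
  · rw [hx₀ n hn, pow_zero, one_mul]

theorem reflection_coord_sq_add (hx₀ : ∀ n, MvPowerSeries.coeff n g.1 ≠ 0 → n 0 = 0) :
    reflection (coord 0 ^ 2 + g) = coord 0 ^ 2 + g := by
  rw [map_add, reflection_eq_self hx₀, reflection, mu_coord_pow_self two_ne_zero]

theorem apply_zero_eq_zero_of_coeff_add_reflection_ne_zero
    (hh : ∀ n, MvPowerSeries.coeff n h.1 ≠ 0 → n 0 ≤ 1) {n : Fin 4 →₀ ℕ}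
    (hn : MvPowerSeries.coeff n (h + reflection h).1 ≠ 0) : n 0 = 0 := by
  have hadd : MvPowerSeries.coeff n (h + reflection h).1 =
      (1 + (-1) ^ n 0) * MvPowerSeries.coeff n h.1 := by
    rw [add_mul, one_mul, ← coeff_reflection]
    rfl
  rw [hadd] at hn
  by_contra h0
  have h1 : n 0 = 1 := le_antisymm (hh n (right_ne_zero_of_mul hn)) (Nat.pos_of_ne_zero h0)
  simp [h1] at hn

theorem exists_eq_mul_add_of_reflection_eq_self
    (hx₀ : ∀ n, MvPowerSeries.coeff n g.1 ≠ 0 → n 0 = 0)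
    (hg : ∀ n, MvPowerSeries.coeff n g.1 ≠ 0 → 3 ≤ n.degree) (hh : reflection h = h) :
    ∃ q p : ConvSeries, h = (coord 0 ^ 2 + g) * q + p ∧
      ∀ n, MvPowerSeries.coeff n p.1 ≠ 0 → n 0 = 0 := by
  obtain ⟨q, p, hqp, hp⟩ := ConvSeries.exists_eq_coord_sq_add_mul_add hg h
  have hqp' : h = (coord 0 ^ 2 + g) * reflection q + reflection p := by
    rw [← reflection_coord_sq_add hx₀, ← map_mul, ← map_add, ← hqp, hh]
  refine ⟨(1 / 2 : ℂ) • (q + reflection q), (1 / 2 : ℂ) • (p + reflection p), ?_, fun n hn =>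
    apply_zero_eq_zero_of_coeff_add_reflection_ne_zero hp (right_ne_zero_of_mul hn)⟩
  calc h = (1 / 2 : ℂ) • (h + h) := by rw [← two_smul ℂ h, smul_smul]; norm_num
    _ = (1 / 2 : ℂ) • ((coord 0 ^ 2 + g) * q + p +
        ((coord 0 ^ 2 + g) * reflection q + reflection p)) := by rw [← hqp, ← hqp']
    _ = _ := by rw [mul_smul_comm, ← smul_add]; congr 1; ring

/- The norm `h · reflection h` is even, so modulo `f` it is a series free of `x₁`, to which the
injectivity assumption applies. -/
theorem toY_eq_zero_of_map_eq_zero {A : Type*} [CommRing A] [Algebra ℂ A]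
    (hx₀ : ∀ n, MvPowerSeries.coeff n g.1 ≠ 0 → n 0 = 0)
    (hg : ∀ n, MvPowerSeries.coeff n g.1 ≠ 0 → 3 ≤ n.degree)
    [IsDomain (LocalRingX r a (coord 0 ^ 2 + g))]
    {φ : ConvSeries →ₐ[ℂ] A} (hφ : φ (coord 0 ^ 2 + g) = 0)
    (hφ₀ : ∀ h : ConvSeries, (∀ n, MvPowerSeries.coeff n h.1 ≠ 0 → n 0 = 0) → φ h = 0 → h = 0)
    (hh : toY (coord 0 ^ 2 + g) (mu r a h) = toY (coord 0 ^ 2 + g) h) (hφh : φ h = 0) :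
    toY (coord 0 ^ 2 + g) h = 0 := by
  set f := coord 0 ^ 2 + g
  have hf : f ∣ reflection f := (reflection_coord_sq_add hx₀).symm.dvd
  obtain ⟨q, p, hqp, hp⟩ := exists_eq_mul_add_of_reflection_eq_self (h := h * reflection h) hx₀ hg
    (by rw [map_mul, reflection_reflection, mul_comm])
  have hp0 : p = 0 := hφ₀ p hp (by
    have := congrArg φ hqp
    rwa [map_mul, hφh, zero_mul, map_add, map_mul, hφ, zero_mul, zero_add, eq_comm] at this)
  have hnorm : toY f h * toY f (reflection h) = 0 := by
    rw [← map_mul, toY_eq_zero_iff, hqp, hp0, add_zero]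
    exact dvd_mul_right f q
  have hh' : toY f (mu r a (reflection h)) = toY f (reflection h) :=
    (congrArg (toY f) (mu_comm r 2 a _ h)).trans (toY_map_eq_toY_map hf hh)
  have hmul : (⟨_, mem_localRingX_iff.2 ⟨h, hh, rfl⟩⟩ : LocalRingX r a f) *
      ⟨_, mem_localRingX_iff.2 ⟨_, hh', rfl⟩⟩ = 0 := Subtype.ext hnorm
  have : NoZeroDivisors (LocalRingX r a f) := IsDomain.to_noZeroDivisors _
  rcases eq_zero_or_eq_zero_of_mul_eq_zero hmul with h0 | h0
  · exact congrArg Subtype.val h0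
  · have h0' : toY f (reflection h) = toY f 0 := (congrArg Subtype.val h0).trans (map_zero _).symm
    simpa only [reflection_reflection, map_zero] using toY_map_eq_toY_map hf h0'

end Reflection

section Jacobian

theorem partialDeriv_coord_pow (j i : Fin 4) (m : ℕ) :
    partialDeriv j (coord i ^ m) = if j = i then (m : ConvSeries) * coord i ^ (m - 1) else 0 := by
  apply Subtype.ext
  change MvPowerSeries.pderiv ℂ j ((MvPowerSeries.X i : MvPowerSeries (Fin 4) ℂ) ^ m) = _
  rw [Derivation.leibniz_pow]
  split_ifs with hij
  · rw [hij, MvPowerSeries.pderiv_X_self, smul_eq_mul, mul_one, nsmul_eq_mul]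
    rfl
  · rw [MvPowerSeries.pderiv_X_of_ne (Ne.symm hij), smul_zero, smul_zero]
    rfl

theorem partialDeriv_zero_coord_sq_add {g : ConvSeries}
    (hx₀ : ∀ n, MvPowerSeries.coeff n g.1 ≠ 0 → n 0 = 0) :
    partialDeriv 0 (coord 0 ^ 2 + g) = 2 * coord 0 := by
  have hg : partialDeriv 0 g = 0 := by
    refine ConvSeries.ext_coeff fun n => (MvPowerSeries.coeff_pderiv ..).trans ?_
    refine mul_eq_zero_of_left (by_contra fun hn => ?_) _
    simpa using hx₀ _ hn
  have hadd : partialDeriv 0 (coord 0 ^ 2 + g) = partialDeriv 0 (coord 0 ^ 2) + partialDeriv 0 g :=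
    Subtype.ext (map_add _ _ _)
  rw [hadd, hg, add_zero, partialDeriv_coord_pow, if_pos rfl, pow_one, Nat.cast_ofNat]

theorem jacobian_coord_pow {g : ConvSeries}
    (hx₀ : ∀ n, MvPowerSeries.coeff n g.1 ≠ 0 → n 0 = 0) (r : ℕ) :
    jacobian (coord 0 ^ 2 + g) (fun i => coord i.succ ^ r) =
      2 * coord 0 * ((r : ConvSeries) ^ 3 * (coord 1 * coord 2 * coord 3) ^ (r - 1)) := by
  rw [jacobian, Matrix.det_of_isUpperTriangular]
  · rw [Fin.prod_univ_succ, Fin.prod_univ_three]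
    simp only [Matrix.of_apply, Fin.cons_zero, Fin.cons_succ, partialDeriv_coord_pow, if_true,
      partialDeriv_zero_coord_sq_add hx₀]
    simp only [Fin.succ_zero_eq_one, Fin.succ_one_eq_two, show Fin.succ 2 = (3 : Fin 4) from rfl,
      mul_pow]
    ring
  · intro i j hij
    obtain ⟨i, rfl⟩ := Fin.exists_succ_eq.2 (Fin.ne_zero_of_lt hij)
    simp only [Matrix.of_apply, Fin.cons_succ, partialDeriv_coord_pow]
    exact if_neg hij.ne

end Jacobian

section LocalRingXHom

open PowerSeries

variable {r : ℕ} {a : Fin 4 → ℕ} {f : ConvSeries}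

/-- The restriction to `𝒪_X` of a morphism out of `ℂ{x₁, x₂, x₃, x₄}` that vanishes at `f`. -/
noncomputable def localRingXHom {A : Type*} [CommRing A] [Algebra ℂ A] (r : ℕ) (a : Fin 4 → ℕ)
    (φ : ConvSeries →ₐ[ℂ] A) (hφ : φ f = 0) : LocalRingX r a f →ₐ[ℂ] A :=
  (Ideal.Quotient.liftₐ (Ideal.span {f}) φ ((Ideal.span_singleton_le_iff_mem (RingHom.ker φ)).2
    hφ)).comp (LocalRingX r a f).val

theorem localRingXHom_apply {A : Type*} [CommRing A] [Algebra ℂ A] {φ : ConvSeries →ₐ[ℂ] A}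
    (hφ : φ f = 0) {x : LocalRingX r a f} {h : ConvSeries} (hx : toY f h = (x : LocalRingY f)) :
    localRingXHom r a φ hφ x = φ h := by
  rw [localRingXHom, AlgHom.comp_apply, Subalgebra.coe_val, ← hx]
  rfl

theorem localRingXHom_injective {A : Type*} [CommRing A] [Algebra ℂ A] {g : ConvSeries}
    (hx₀ : ∀ n, MvPowerSeries.coeff n g.1 ≠ 0 → n 0 = 0)
    (hg : ∀ n, MvPowerSeries.coeff n g.1 ≠ 0 → 3 ≤ n.degree)
    [IsDomain (LocalRingX r a (coord 0 ^ 2 + g))]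
    {φ : ConvSeries →ₐ[ℂ] A} (hφ : φ (coord 0 ^ 2 + g) = 0)
    (hφ₀ : ∀ h : ConvSeries, (∀ n, MvPowerSeries.coeff n h.1 ≠ 0 → n 0 = 0) → φ h = 0 → h = 0) :
    Function.Injective (localRingXHom r a φ hφ) := by
  refine (injective_iff_map_eq_zero _).2 fun x hx => ?_
  obtain ⟨h, hh, hhx⟩ := mem_localRingX_iff.1 x.2
  rw [localRingXHom_apply hφ hhx] at hx
  exact Subtype.ext (hhx.symm.trans (toY_eq_zero_of_map_eq_zero hx₀ hg hφ hφ₀ hh hx))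

theorem isLocalHom_localRingXHom {A : Type*} [CommRing A] [Algebra ℂ A] {φ : ConvSeries →ₐ[ℂ] A}
    (hφ : φ f = 0) [IsLocalHom φ] :
    IsLocalHom (localRingXHom r a φ hφ : LocalRingX r a f →+* A) where
  map_nonunit x hx := by
    obtain ⟨h, hh, hhx⟩ := mem_localRingX_iff.1 x.2
    have hφh : IsUnit (φ h) := localRingXHom_apply hφ hhx ▸ hx
    exact isUnit_localRingX hh (isUnit_of_map_unit φ h hφh) hhx.symm

theorem dvd_order_of_rescale_eq {L : Type*} [Field L] {η : L} (hη : IsPrimitiveRoot η r)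
    {p : L⟦X⟧} (hp : rescale η p = p) : r ∣ p.order.toNat := by
  by_cases hp0 : p = 0
  · rw [hp0, order_zero, ENat.toNat_top]
    exact dvd_zero r
  have hcoeff := congrArg (coeff p.order.toNat) hp
  rw [coeff_rescale] at hcoeff
  exact hη.dvd_of_pow_eq_one _
    (mul_right_cancel₀ (coeff_order hp0) (hcoeff.trans (one_mul _).symm))

theorem dvd_order_localRingXHom {L : Type*} [Field L] [Algebra ℂ L] (hr : r ≠ 0)
    (hf : f ∣ mu r a f) {φ : ConvSeries →ₐ[ℂ] L⟦X⟧} (hφ : φ f = 0) {j : ℕ}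
    (hη : ∀ h, rescale (algebraMap ℂ L (xi r)) (φ h) = φ (mu r (fun i => j * a i) h))
    (x : LocalRingX r a f) : r ∣ (localRingXHom r a φ hφ x).order.toNat := by
  obtain ⟨h, hh, hhx⟩ := mem_localRingX_iff.1 x.2
  refine dvd_order_of_rescale_eq
    ((isPrimitiveRoot_xi hr).map_of_injective (algebraMap ℂ L).injective) ?_
  rw [localRingXHom_apply hφ hhx, hη, ← localRingXHom_apply hφ hhx,
    ← localRingXHom_apply hφ ((toY_mu_mul hf hh j).trans hhx)]

end LocalRingXHom

section InvariantFunctions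

variable {r : ℕ}

theorem toY_mem_localRingX {a : Fin 4 → ℕ} {h : ConvSeries} (f : ConvSeries) (hh : mu r a h = h) :
    toY f h ∈ LocalRingX r a f :=
  mem_localRingX_iff.2 ⟨h, by rw [hh], rfl⟩

/-- The invariant function `xᵢ ^ r` on `X`. -/
noncomputable def coordPow (hr : r ≠ 0) (a : Fin 4 → ℕ) (f : ConvSeries) (i : Fin 4) :
    LocalRingX r a f :=
  ⟨toY f (coord i ^ r), toY_mem_localRingX f (mu_coord_pow_self hr a i)⟩

theorem localRingXHom_coordPow {A : Type*} [CommRing A] [Algebra ℂ A] (hr : r ≠ 0)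
    (a : Fin 4 → ℕ) {f : ConvSeries} {φ : ConvSeries →ₐ[ℂ] A} (hφ : φ f = 0) (i : Fin 4) :
    localRingXHom r a φ hφ (coordPow hr a f i) = φ (coord i) ^ r := by
  rw [localRingXHom_apply (h := coord i ^ r) hφ rfl, map_pow]

theorem mu_jacobian_pow {g : ConvSeries} (hr : r ≠ 0) (a : Fin 4 → ℕ)
    (hx₀ : ∀ n, MvPowerSeries.coeff n g.1 ≠ 0 → n 0 = 0) :
    mu r a (jacobian (coord 0 ^ 2 + g) (fun i => coord i.succ ^ r) ^ r) =
      jacobian (coord 0 ^ 2 + g) (fun i => coord i.succ ^ r) ^ r := by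
  have hjac : jacobian (coord 0 ^ 2 + g) (fun i => coord i.succ ^ r) ^ r =
      (2 * (r : ConvSeries) ^ 3) ^ r *
        (coord 0 ^ r * (coord 1 ^ r * coord 2 ^ r * coord 3 ^ r) ^ (r - 1)) := by
    rw [jacobian_coord_pow hx₀]
    ring
  rw [hjac]
  simp only [map_mul, map_pow (mu r a) (_ * _), map_pow (mu r a) (r : ConvSeries), map_natCast,
    map_ofNat, mu_coord_pow_self hr]

end InvariantFunctions

section WeightedArcOrders

open PowerSeries

theorem order_C_mul_X_pow {L : Type*} [Field L] {c : L} (hc : c ≠ 0) (n : ℕ) :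
    (C c * X ^ n : L⟦X⟧).order = n := by
  rw [order_mul, order_X_pow, order_zero_of_unit, zero_add]
  exact isUnit_iff_constantCoeff.2 (by rw [constantCoeff_C]; exact hc.isUnit)

theorem order_natCast {L : Type*} [Field L] [CharZero L] {m : ℕ} (hm : m ≠ 0) :
    (m : L⟦X⟧).order = 0 :=
  order_zero_of_unit (isUnit_iff_constantCoeff.2
    (by rw [map_natCast]; exact (Nat.cast_ne_zero.2 hm).isUnit))

theorem order_weightedArc {L : Type*} [Field L] (b : Fin 4 → ℕ) {s : Fin 2 → L} {u : L⟦X⟧}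
    (hs : ∀ i, s i ≠ 0) (hu : constantCoeff u ≠ 0) : ∀ i, (weightedArc b s u i).order = b i
  | 0 => (order_mul _ _).trans
      (by rw [order_X_pow, order_zero_of_unit (isUnit_iff_constantCoeff.2 hu.isUnit), add_zero])
  | 1 => order_X_pow _
  | 2 => order_C_mul_X_pow (hs 0) _
  | 3 => order_C_mul_X_pow (hs 1) _

theorem weightedArc_succ_pow {L : Type*} [Field L] (b : Fin 4 → ℕ) (s : Fin 2 → L) (u : L⟦X⟧)
    (r : ℕ) (i : Fin 3) :
    weightedArc b s u i.succ ^ r =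
      C ((![1, s 0, s 1] : Fin 3 → L) i ^ r) * X ^ (r * b i.succ) := by
  have hsucc : weightedArc b s u i.succ =
      C ((![1, s 0, s 1] : Fin 3 → L) i) * X ^ b i.succ := by
    fin_cases i
    · exact (one_mul _).symm.trans (congrArg (· * _) (map_one C).symm)
    · rfl
    · rfl
  rw [hsucc, mul_pow, map_pow, ← pow_mul, mul_comm r]

theorem weightedArc_one_pow {L : Type*} [Field L] (b : Fin 4 → ℕ) (s : Fin 2 → L) (u : L⟦X⟧)
    (r : ℕ) : weightedArc b s u 1 ^ r = X ^ (r * b 1) := by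
  rw [mul_comm, pow_mul]
  rfl

theorem weightedArc_pow_eq_mul_C {L : Type*} [Field L] {b : Fin 4 → ℕ} {s : Fin 2 → L} (u : L⟦X⟧)
    {r : ℕ} {x : Fin 2 → L} (hs : ∀ i, s i ^ (r * b 1) = x i) (i : Fin 2) :
    (weightedArc b s u i.succ.succ ^ r) ^ b 1 =
      (weightedArc b s u 1 ^ r) ^ b i.succ.succ * C (x i) := by
  have hcons : (![1, s 0, s 1] : Fin 3 → L) i.succ = s i := by fin_cases i <;> rfl
  rw [weightedArc_succ_pow, weightedArc_one_pow, hcons, mul_pow, ← map_pow, ← pow_mul, hs,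
    ← pow_mul, ← pow_mul, mul_comm, mul_right_comm]

theorem derivation_eq_zero_of_pow {L : Type*} [Field L] [CharZero L] [Algebra ℂ L]
    (d : Derivation ℂ L L) {x : L} (hx : x ≠ 0) {m : ℕ} (hm : m ≠ 0) :
    d (x ^ m) = 0 ↔ d x = 0 := by
  rw [Derivation.leibniz_pow, smul_eq_mul, nsmul_eq_mul, mul_eq_zero, mul_eq_zero,
    Nat.cast_eq_zero, pow_eq_zero_iff']
  tauto

variable {L : Type*} [Field L] [Algebra ℂ L] {b : Fin 4 → ℕ} {r : ℕ} {s : Fin 2 → L}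

theorem order_det_weightedArc [CharZero L] (hrb : r * b 1 ≠ 0) (hs0 : ∀ i, s i ≠ 0) (u : L⟦X⟧)
    {x : Fin 2 → L} (hs : ∀ i, s i ^ (r * b 1) = x i) {d : Fin 2 → Derivation ℂ L L}
    (hd : ∀ i j, d i (x j) = if j = i then 1 else 0) :
    (Matrix.det (Matrix.of fun i j => (![eulerDerivation ℂ L, coeffDerivation (d 0),
      coeffDerivation (d 1)] : Fin 3 → Derivation ℂ L⟦X⟧ L⟦X⟧) j
        (weightedArc b s u i.succ ^ r))).order = (r * (b 1 + b 2 + b 3) : ℕ) := by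
  have hds : ∀ i j, d i (s j ^ r) = 0 ↔ j ≠ i := fun i j => by
    rw [derivation_eq_zero_of_pow _ (hs0 j) (left_ne_zero_of_mul hrb),
      ← derivation_eq_zero_of_pow _ (hs0 j) hrb, hs, hd, ite_eq_right_iff, imp_iff_not one_ne_zero]
  have h01 : d 0 (s 1 ^ r) = 0 := (hds 0 1).2 (by decide)
  have h10 : d 1 (s 0 ^ r) = 0 := (hds 1 0).2 (by decide)
  simp only [weightedArc_succ_pow]
  rw [Matrix.det_fin_three]
  simp only [Matrix.of_apply, Matrix.cons_val_zero, Matrix.cons_val_one, Matrix.cons_val,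
    eulerDerivation_C_mul_X_pow, coeffDerivation_C_mul_X_pow, one_pow, Derivation.map_one_eq_zero,
    h01, h10, map_zero, zero_mul, mul_zero, sub_zero, add_zero, mul_one,
    Fin.succ_zero_eq_one]
  rw [order_mul, order_mul, order_C_mul_X_pow (Nat.cast_ne_zero.2 hrb),
    order_C_mul_X_pow fun h => (hds 0 0).1 h rfl, order_C_mul_X_pow fun h => (hds 1 1).1 h rfl,
    Fin.succ_one_eq_two, show Fin.succ 2 = (3 : Fin 4) from rfl]
  push_cast
  ring

variable (hb : ∀ i, 0 < b i)

instance isLocalHom_weightedArcHom (u : L⟦X⟧) : IsLocalHom (weightedArcHom hb s u) where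
  map_nonunit h hh := by
    refine ConvSeries.isUnit_of_constantCoeff_ne_zero fun h0 => ?_
    rw [isUnit_iff_constantCoeff, weightedArcHom, constantCoeff_evalArc, h0, map_zero] at hh
    exact not_isUnit_zero hh

theorem weightedArcHom_coord (u : L⟦X⟧) (i : Fin 4) :
    weightedArcHom hb s u (coord i) = weightedArc b s u i :=
  evalArc_coord _ i

theorem order_weightedArcHom_jacobian [CharZero L] {u : L⟦X⟧} {g : ConvSeries}
    (hr : r ≠ 0) (hs : ∀ i, s i ≠ 0) (hu : constantCoeff u ≠ 0)
    (hx₀ : ∀ n, MvPowerSeries.coeff n g.1 ≠ 0 → n 0 = 0) :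
    (weightedArcHom hb s u (jacobian (coord 0 ^ 2 + g) fun i => coord i.succ ^ r)).order =
      (b 0 + (r - 1) * (b 1 + b 2 + b 3) : ℕ) := by
  have htwo : (2 : L⟦X⟧).order = 0 := order_natCast two_ne_zero
  rw [jacobian_coord_pow hx₀]
  simp only [map_mul, map_pow, map_natCast, map_ofNat, order_mul, order_pow, weightedArcHom_coord,
    order_weightedArc b hs hu, htwo, order_natCast hr, nsmul_eq_mul]
  push_cast
  ring

end WeightedArcOrders

section SquareAdd

variable {r e j : ℕ} {a b : Fin 4 → ℕ} {g : ConvSeries} {n : Fin 4 →₀ ℕ}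

theorem coeff_coord_sq_add (g : ConvSeries) (i : Fin 4) (n : Fin 4 →₀ ℕ) :
    MvPowerSeries.coeff n (coord i ^ 2 + g).1 =
      (if n = Finsupp.single i 2 then 1 else 0) + MvPowerSeries.coeff n g.1 := by
  classical
  change MvPowerSeries.coeff n (MvPowerSeries.X i ^ 2 + g.1) = _
  rw [map_add, MvPowerSeries.coeff_X_pow]

theorem coeff_coord_sq_add_of_apply_zero (g : ConvSeries) (hn : n 0 = 0) :
    MvPowerSeries.coeff n (coord 0 ^ 2 + g).1 = MvPowerSeries.coeff n g.1 := by
  rw [coeff_coord_sq_add, if_neg, zero_add]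
  rintro rfl
  rw [Finsupp.single_eq_same] at hn
  exact two_ne_zero hn

theorem coeff_single_coord_sq_add (hx₀ : ∀ n, MvPowerSeries.coeff n g.1 ≠ 0 → n 0 = 0) :
    MvPowerSeries.coeff (Finsupp.single 0 2) (coord 0 ^ 2 + g).1 ≠ 0 := by
  have hg : MvPowerSeries.coeff (Finsupp.single 0 2) g.1 = 0 := by
    by_contra h
    exact two_ne_zero (Finsupp.single_eq_same.symm.trans (hx₀ _ h))
  rw [coeff_coord_sq_add, if_pos rfl, hg, add_zero]
  exact one_ne_zero

theorem wt_single (b : Fin 4 → ℕ) (i : Fin 4) (m : ℕ) : wt b (Finsupp.single i m) = b i * m := by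
  rw [wt, Finset.sum_eq_single i (fun l _ hl => by
    rw [Finsupp.single_eq_of_ne hl, mul_zero]) (by simp), Finsupp.single_eq_same]

theorem two_mul_modEq_of_semiInvariant (hr : r ≠ 0)
    (hf : mu r a (coord 0 ^ 2 + g) = xi r ^ e • (coord 0 ^ 2 + g))
    (hx₀ : ∀ n, MvPowerSeries.coeff n g.1 ≠ 0 → n 0 = 0) : 2 * a 0 ≡ e [MOD r] := by
  rw [mul_comm, ← wt_single]
  exact wt_modEq_of_semiInvariant hr hf (coeff_single_coord_sq_add hx₀)

theorem wt_modEq_two_mul_of_semiInvariant (hr : r ≠ 0)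
    (hf : mu r a (coord 0 ^ 2 + g) = xi r ^ e • (coord 0 ^ 2 + g))
    (hx₀ : ∀ n, MvPowerSeries.coeff n g.1 ≠ 0 → n 0 = 0) (hab : ∀ i, b i ≡ j * a i [MOD r])
    (hn : MvPowerSeries.coeff n g.1 ≠ 0) : wt b n ≡ 2 * b 0 [MOD r] :=
  calc wt b n ≡ j * wt a n [MOD r] := wt_modEq hab n
    _ ≡ j * e [MOD r] := (wt_modEq_of_semiInvariant hr hf
        (by rwa [coeff_coord_sq_add_of_apply_zero g (hx₀ n hn)])).mul_left j
    _ ≡ j * (2 * a 0) [MOD r] := (two_mul_modEq_of_semiInvariant hr hf hx₀).symm.mul_left j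
    _ = 2 * (j * a 0) := mul_left_comm _ _ _
    _ ≡ 2 * b 0 [MOD r] := (hab 0).symm.mul_left 2

end SquareAdd

section KeyInequality

open PowerSeries

variable {r j : ℕ} {a b : Fin 4 → ℕ} {f g : ConvSeries} (hb : ∀ i, 0 < b i) {s : Fin 2 → ArcField}
  {u : ArcField⟦X⟧}

theorem localRingXHom_coordPow_one (hr : r ≠ 0) (hφ : weightedArcHom hb s u f = 0) :
    localRingXHom r a (weightedArcHom hb s u) hφ (coordPow hr a f 1) = X ^ (r * b 1) := by
  rw [localRingXHom_coordPow, weightedArcHom_coord, weightedArc_one_pow]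

theorem not_isField_localRingX (hr : r ≠ 0) (hφ : weightedArcHom hb s u f = 0) :
    ¬ IsField (LocalRingX r a f) := by
  intro hfield
  have hone := localRingXHom_coordPow_one (a := a) hb hr hφ
  have hne : coordPow hr a f 1 ≠ 0 := fun h0 =>
    pow_ne_zero _ X_ne_zero (by rw [← hone, h0, map_zero])
  obtain ⟨y, hy⟩ := hfield.mul_inv_cancel hne
  have hunit : IsUnit (X ^ (r * b 1) : ArcField⟦X⟧) :=
    hone ▸ (IsUnit.of_mul_eq_one y hy).map (localRingXHom r a (weightedArcHom hb s u) hφ)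
  exact X_prime.not_isUnit ((isUnit_pow_iff (mul_ne_zero hr (hb 1).ne')).1 hunit)

theorem exists_localRingXHom_eq_mul_C (hr : r ≠ 0) (hφ : weightedArcHom hb s u f = 0)
    (hs : ∀ i, s i ^ (r * b 1) = arcGen i) (i : Fin 2) :
    ∃ x y : LocalRingX r a f, y ≠ 0 ∧ localRingXHom r a (weightedArcHom hb s u) hφ x =
      localRingXHom r a (weightedArcHom hb s u) hφ y * C (arcGen i) := by
  refine ⟨coordPow hr a f i.succ.succ ^ b 1, coordPow hr a f 1 ^ b i.succ.succ, fun h0 => ?_, ?_⟩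
  · refine pow_ne_zero (b i.succ.succ) (pow_ne_zero (r * b 1) (X_ne_zero (R := ArcField))) ?_
    rw [← localRingXHom_coordPow_one (a := a) hb hr hφ, ← map_pow, h0, map_zero]
  · simp only [map_pow, localRingXHom_coordPow, weightedArcHom_coord]
    exact weightedArc_pow_eq_mul_C u hs i

theorem exists_jacobian_pow (hr : r ≠ 0) (hx₀ : ∀ n, MvPowerSeries.coeff n g.1 ≠ 0 → n 0 = 0)
    (hs : ∀ i, s i ≠ 0) (hu : constantCoeff u ≠ 0)
    (hφ : weightedArcHom hb s u (coord 0 ^ 2 + g) = 0) :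
    ∃ J : LocalRingX r a (coord 0 ^ 2 + g), (J : LocalRingY (coord 0 ^ 2 + g)) =
      toY (coord 0 ^ 2 + g) (jacobian (coord 0 ^ 2 + g) fun i => coord i.succ ^ r) ^ r ∧ J ≠ 0 ∧
      (localRingXHom r a (weightedArcHom hb s u) hφ J).order =
        (r * (b 0 + (r - 1) * (b 1 + b 2 + b 3)) : ℕ) := by
  let J : LocalRingX r a (coord 0 ^ 2 + g) := ⟨_, toY_mem_localRingX _ (mu_jacobian_pow hr a hx₀)⟩
  have hJ : (localRingXHom r a (weightedArcHom hb s u) hφ J).order =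
      (r * (b 0 + (r - 1) * (b 1 + b 2 + b 3)) : ℕ) := by
    rw [localRingXHom_apply hφ (x := J) rfl, map_pow, order_pow,
      order_weightedArcHom_jacobian hb hr hs hu hx₀, nsmul_eq_mul, ← Nat.cast_mul]
  refine ⟨J, map_pow _ _ _, fun h0 => ?_, hJ⟩
  rw [h0, map_zero, order_zero] at hJ
  exact ENat.top_ne_natCast _ hJ

theorem mul_one_add_sub_div_le {q k m B b₀ : ℕ} (hr : r ≠ 0) (hk : q * (k + 1) ≤ r * B)
    (hm : q * m = r * (b₀ + (r - 1) * B)) :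
    (q : ℝ) * (1 + k - m / r) ≤ (B : ℝ) - b₀ := by
  have hk' : (q : ℝ) * (k + 1) ≤ r * B := by exact_mod_cast hk
  have hm' : (q : ℝ) * m = r * (b₀ + (r - 1) * B) := by
    rw [← Nat.cast_pred (Nat.pos_of_ne_zero hr)]
    exact_mod_cast hm
  have hdiv : (q : ℝ) * (m / r) = b₀ + (r - 1) * B := by
    rw [← mul_div_assoc, hm', mul_div_cancel_left₀ _ (Nat.cast_ne_zero.2 hr)]
  rw [mul_sub, hdiv]
  linarith

theorem exists_mem_logDiscrepancies_of_weightedArc [IsDomain (LocalRingX r a (coord 0 ^ 2 + g))]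
    (hr : r ≠ 0) (hx₀ : ∀ n, MvPowerSeries.coeff n g.1 ≠ 0 → n 0 = 0)
    (hg : ∀ n, MvPowerSeries.coeff n g.1 ≠ 0 → 3 ≤ n.degree)
    (hf : coord 0 ^ 2 + g ∣ mu r a (coord 0 ^ 2 + g))
    (hs : ∀ i, s i ^ (r * b 1) = arcGen i) (hu : constantCoeff u ≠ 0)
    (hφ : weightedArcHom hb s u (coord 0 ^ 2 + g) = 0)
    (hη : ∀ h, rescale (algebraMap ℂ ArcField (xi r)) (weightedArcHom hb s u h) =
      weightedArcHom hb s u (mu r (fun i => j * a i) h)) :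
    ∃ c ∈ logDiscrepancies r a (coord 0 ^ 2 + g), ∃ q : ℕ, r ≤ q ∧
      q * c ≤ ((b 1 + b 2 + b 3 : ℕ) : ℝ) - b 0 := by
  set f := coord 0 ^ 2 + g
  set φ := localRingXHom r a (weightedArcHom hb s u) hφ
  have hrb : r * b 1 ≠ 0 := mul_ne_zero hr (hb 1).ne'
  have hs_basis := isTranscendenceBasis_of_pow_eq isTranscendenceBasis_arcGen hs
  have hφ_inj : Function.Injective φ := localRingXHom_injective hx₀ hg hφ fun h hh h0 =>
    by_contra fun hne => weightedArcHom_ne_zero hb hs_basis.1 u hh hne h0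
  have : IsLocalHom (φ : LocalRingX r a f →+* ArcField⟦X⟧) := isLocalHom_localRingXHom hφ
  choose d hd using exists_derivation_arcField
  obtain ⟨V, _, _, _, _, _, _, hV, q, hq, hrq, hord, hdet⟩ := exists_primeDivisor φ hφ_inj
    (not_isField_localRingX hb hr hφ) isTranscendenceBasis_arcGen
    (exists_localRingXHom_eq_mul_C hb hr hφ hs) (dvd_order_localRingXHom hr hf hφ hη)
    (δ := ![eulerDerivation ℂ ArcField, coeffDerivation (d 0), coeffDerivation (d 1)])
    (Fin.forall_fin_succ.2 ⟨dvd_eulerDerivation, Fin.forall_fin_two.2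
      ⟨dvd_coeffDerivation _, dvd_coeffDerivation _⟩⟩)
  have hdet_order := order_det_weightedArc hrb hs_basis.1.ne_zero u hs hd
  simp only [← weightedArcHom_coord hb, ← localRingXHom_coordPow hr a hφ] at hdet_order
  obtain ⟨k, hk, hkq⟩ := hdet (fun i => coordPow hr a f i.succ) fun h0 =>
    ENat.top_ne_natCast _ (order_zero.symm.trans (h0 ▸ hdet_order))
  obtain ⟨J, hJ, hJ0, hJ_order⟩ :=
    exists_jacobian_pow hb (a := a) hr hx₀ hs_basis.1.ne_zero hu hφ
  obtain ⟨m, hm⟩ := ENat.ne_top_iff_exists.1 fun htop => hJ0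
    (hV.injective ((IsDiscreteValuationRing.addVal_eq_top_iff.1 htop).trans (map_zero _).symm))
  refine ⟨1 + (k : ℝ) - (m : ℝ) / r, ⟨V, _, _, _, _, _, _, hV, _, _, J, k, m,
    fun i => rfl, hJ, hJ0, hk, hm.symm, rfl⟩, q, Nat.le_of_dvd hq hrq,
    mul_one_add_sub_div_le hr ?_ ?_⟩
  · exact_mod_cast hkq.trans hdet_order.le
  · rw [hord J hJ0, ← hm] at hJ_order
    exact_mod_cast hJ_order

theorem mul_le_sub_of_le_mld [IsDomain (LocalRingX r a (coord 0 ^ 2 + g))] {e : ℕ} (hr : r ≠ 0)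
    (hf : mu r a (coord 0 ^ 2 + g) = xi r ^ e • (coord 0 ^ 2 + g))
    (hx₀ : ∀ n, MvPowerSeries.coeff n g.1 ≠ 0 → n 0 = 0)
    (hg : ∀ n, MvPowerSeries.coeff n g.1 ≠ 0 → 3 ≤ n.degree)
    {c₀ : ℝ} (hc₀ : 0 ≤ c₀) (hmld : (c₀ : EReal) ≤ mld r a (coord 0 ^ 2 + g))
    (hb : ∀ i, 0 < b i) (hab : ∀ i, b i ≡ j * a i [MOD r])
    (hex : ∃ n, MvPowerSeries.coeff n g.1 ≠ 0 ∧ wt b n = 2 * b 0)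
    (hmin : ∀ n, MvPowerSeries.coeff n g.1 ≠ 0 → 2 * b 0 ≤ wt b n) :
    c₀ * r ≤ ((b 1 + b 2 + b 3 : ℕ) : ℝ) - b 0 := by
  have hrb : r * b 1 ≠ 0 := mul_ne_zero hr (hb 1).ne'
  choose s hs using fun i => IsAlgClosed.exists_pow_nat_eq (arcGen i) (Nat.pos_of_ne_zero hrb)
  obtain ⟨u, hu, hφ, hη⟩ := exists_weightedArcHom_eq_zero hb hr hab
    (isTranscendenceBasis_of_pow_eq isTranscendenceBasis_arcGen hs).1 hx₀
    (fun _ => wt_modEq_two_mul_of_semiInvariant hr hf hx₀ hab) hex hmin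
  obtain ⟨c, hc, q, hrq, hqc⟩ := exists_mem_logDiscrepancies_of_weightedArc hb hr hx₀ hg
    (Dvd.intro_left _ ((Algebra.smul_def _ _).symm.trans hf.symm)) hs hu hφ hη
  have hc₀c : c₀ ≤ c := by exact_mod_cast hmld.trans (sInf_le (Set.mem_image_of_mem _ hc))
  calc c₀ * r = r * c₀ := mul_comm _ _
    _ ≤ q * c := by gcongr
    _ ≤ _ := hqc

end KeyInequality

section Freeness

open PowerSeries

theorem map_eq_zero_of_mem_radical_span {R A F : Type*} [CommRing R] [CommRing A] [IsReduced A]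
    [FunLike F R A] [RingHomClass F R A] {φ : F} {S : Set R} (hS : ∀ h ∈ S, φ h = 0) {h : R}
    (hh : h ∈ (Ideal.span S).radical) : φ h = 0 := by
  obtain ⟨m, hm⟩ := hh
  have hker : Ideal.span S ≤ RingHom.ker φ := Ideal.span_le.2 hS
  exact eq_zero_of_pow_eq_zero ((map_pow φ h m).symm.trans (hker hm))

theorem constantCoeff_single_X_pow {L : Type*} [Field L] (i : Fin 4) {m : ℕ}
    (hm : m ≠ 0) (l : Fin 4) :
    constantCoeff ((Pi.single i (X ^ m) : Fin 4 → L⟦X⟧) l) = 0 := by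
  rcases eq_or_ne l i with rfl | hl
  · rw [Pi.single_eq_same, map_pow, constantCoeff_X, zero_pow hm]
  · rw [Pi.single_eq_of_ne hl, map_zero]

theorem exists_sq_eq_of_rescale_neg_one {L : Type*} [Field L] [IsAlgClosed L] [CharZero L]
    {p : L⟦X⟧} (hp : rescale (-1) p = p) : ∃ q : L⟦X⟧, q ^ 2 = p := by
  rcases eq_or_ne p 0 with rfl | hp0
  · exact ⟨0, zero_pow two_ne_zero⟩
  have hlead : (-1) ^ p.order.toNat * coeff p.order.toNat p = coeff p.order.toNat p := by
    rw [← coeff_rescale, hp]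
  have heven : Even p.order.toNat := by
    by_contra hodd
    rw [(Nat.not_even_iff_odd.1 hodd).neg_one_pow, neg_one_mul] at hlead
    exact coeff_order hp0 (self_eq_neg.1 hlead.symm)
  obtain ⟨m, hm⟩ := heven.two_dvd
  obtain ⟨u, hu, -⟩ := exists_X_pow_mul_sq_eq (p := p) (m := m) (η := 1)
    (by rw [← hm, coe_toNat_order hp0]) one_ne_zero (by rw [rescale_one]; simp)
  exact ⟨_, hu⟩

variable {L : Type*} [Field L] [Algebra ℂ L] {A B : Fin 4 → L⟦X⟧}
  (hA : ∀ i, constantCoeff (A i) = 0) (hB : ∀ i, constantCoeff (B i) = 0)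

theorem evalArc_congr {h : ConvSeries}
    (hAB : ∀ n, MvPowerSeries.coeff n h.1 ≠ 0 → ∀ i, n i ≠ 0 → A i = B i) :
    evalArc A hA h = evalArc B hB h := by
  ext N
  rw [coeff_evalArc, coeff_evalArc]
  refine finsum_congr fun n => ?_
  by_cases hn : MvPowerSeries.coeff n h.1 = 0
  · rw [hn, zero_smul, zero_smul]
  · congr 2
    refine Finset.prod_congr rfl fun i _ => ?_
    by_cases hi : n i = 0
    · rw [hi, pow_zero, pow_zero]
    · rw [hAB n hn i hi]

theorem evalArc_eq_zero {h : ConvSeries}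
    (hh : ∀ n, MvPowerSeries.coeff n h.1 ≠ 0 → ∃ i, n i ≠ 0 ∧ A i = 0) : evalArc A hA h = 0 := by
  ext N
  rw [coeff_evalArc, map_zero, finsum_eq_zero_of_forall_eq_zero]
  intro n
  by_cases hn : MvPowerSeries.coeff n h.1 = 0
  · rw [hn, zero_smul]
  · obtain ⟨i, hi, hAi⟩ := hh n hn
    rw [Finset.prod_eq_zero (Finset.mem_univ i) (by rw [hAi, zero_pow hi]), map_zero, smul_zero]

theorem not_hasIsolatedSingularity_coord_sq (i : Fin 4) :
    ¬ HasIsolatedSingularity (coord i ^ 2) := by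
  intro hiso
  obtain ⟨l, hl⟩ := exists_ne i
  let φ := evalArc (Pi.single l (X ^ 1) : Fin 4 → ℂ⟦X⟧)
    (constantCoeff_single_X_pow l one_ne_zero)
  have hφi : φ (coord i) = 0 := (evalArc_coord _ i).trans (Pi.single_eq_of_ne hl.symm _)
  have hφl : φ (coord l) = 0 := by
    refine map_eq_zero_of_mem_radical_span ?_ (hiso l)
    rintro h (rfl | ⟨j, rfl⟩)
    · rw [map_pow, hφi, zero_pow two_ne_zero]
    · simp only [partialDeriv_coord_pow]
      split_ifs
      · rw [pow_one, map_mul, hφi, mul_zero]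
      · exact map_zero φ
  rw [evalArc_coord, Pi.single_eq_same, pow_one] at hφl
  exact X_ne_zero hφl

theorem ActsFreelyOutsideOrigin.eq_one_of_dvd {r c : ℕ} {a : Fin 4 → ℕ} {f : ConvSeries}
    (hfree : ActsFreelyOutsideOrigin r a f) (hr : r ≠ 0) (hc : c ∣ r) {A F : Type*}
    [CommRing A] [IsReduced A] [FunLike F ConvSeries A] [RingHomClass F ConvSeries A] {φ : F}
    (hf : φ f = 0)
    (hφ : ∀ l, ¬ c ∣ a l → φ (coord l) = 0) {i : Fin 4} (hi : φ (coord i) ≠ 0) : c = 1 := by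
  by_contra hc1
  have hc0 : c ≠ 0 := ne_zero_of_dvd_ne_zero hr hc
  have hrc : ¬ r ∣ r / c := fun h =>
    (Nat.div_lt_self (Nat.pos_of_ne_zero hr) (by omega : 1 < c)).not_ge
      (Nat.le_of_dvd (Nat.div_pos (Nat.le_of_dvd (Nat.pos_of_ne_zero hr) hc)
        (Nat.pos_of_ne_zero hc0)) h)
  refine hi (map_eq_zero_of_mem_radical_span ?_ (hfree (r / c) hrc i))
  rintro h (rfl | ⟨l, hl, rfl⟩)
  · exact hf
  · refine hφ l fun hcl => hl ?_
    calc r = r / c * c := (Nat.div_mul_cancel hc).symm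
      _ ∣ r / c * a l := mul_dvd_mul_left _ hcl

theorem ActsFreelyOutsideOrigin.coprime_of_coeff_single_eq_zero {r : ℕ} {a : Fin 4 → ℕ}
    {f : ConvSeries} (hfree : ActsFreelyOutsideOrigin r a f) (hr : r ≠ 0) {i : Fin 4}
    (hf : ∀ m, MvPowerSeries.coeff (Finsupp.single i m) f.1 = 0) : Nat.Coprime (a i) r := by
  have hA := constantCoeff_single_X_pow (L := ℂ) i one_ne_zero
  have hf0 : evalArc _ hA f = 0 := evalArc_eq_zero hA fun n hn => by
    obtain ⟨l, hl⟩ := Finsupp.ne_iff.1 fun h : n = Finsupp.single i (n i) => hn (h ▸ hf _)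
    have hli : l ≠ i := fun h => hl (by rw [h, Finsupp.single_eq_same])
    exact ⟨l, by rwa [Finsupp.single_eq_of_ne hli] at hl, Pi.single_eq_of_ne hli _⟩
  refine hfree.eq_one_of_dvd hr (Nat.gcd_dvd_right _ _) hf0 (fun l hl => ?_) (i := i) ?_
  · have hli : l ≠ i := fun h => hl (h ▸ Nat.gcd_dvd_left _ _)
    exact (evalArc_coord hA l).trans (Pi.single_eq_of_ne hli _)
  · rw [evalArc_coord, Pi.single_eq_same, pow_one]
    exact X_ne_zero

theorem rescale_neg_one_evalArc_single (i : Fin 4) (h : ConvSeries) :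
    rescale (-1) (evalArc (Pi.single i (X ^ 2) : Fin 4 → L⟦X⟧)
      (constantCoeff_single_X_pow i two_ne_zero) h) = evalArc (Pi.single i (X ^ 2))
      (constantCoeff_single_X_pow i two_ne_zero) h := by
  have hmu : mu 1 0 h = h := ConvSeries.ext_coeff fun n => by simp [coeff_mu]
  refine (rescale_evalArc (r := 1) (a := 0) _ (fun l => ?_) h).trans (by rw [hmu])
  rcases eq_or_ne l i with rfl | hl
  · rw [Pi.single_eq_same, map_pow, rescale_X]
    simp
  · rw [Pi.single_eq_of_ne hl, map_zero, mul_zero]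

theorem ActsFreelyOutsideOrigin.eq_one_of_dvd_zero {r c : ℕ} {a : Fin 4 → ℕ} {g : ConvSeries}
    (hfree : ActsFreelyOutsideOrigin r a (coord 0 ^ 2 + g)) (hr : r ≠ 0)
    (hx₀ : ∀ n, MvPowerSeries.coeff n g.1 ≠ 0 → n 0 = 0)
    (hg : MvPowerSeries.constantCoeff g.1 = 0) {i : Fin 4} (hi : i ≠ 0) (hc : c ∣ r)
    (hc0 : c ∣ a 0) (hci : c ∣ a i) : c = 1 := by
  have hB := constantCoeff_single_X_pow (L := ℂ) i two_ne_zero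
  set γ := evalArc _ hB g
  obtain ⟨q, hq⟩ := exists_sq_eq_of_rescale_neg_one (p := -γ)
    (by rw [map_neg, rescale_neg_one_evalArc_single])
  have hq0 : constantCoeff q = 0 := by
    rw [← sq_eq_zero_iff, ← map_pow, hq, map_neg, constantCoeff_evalArc, hg, map_zero, neg_zero]
  have hA : ∀ l,
      constantCoeff ((Function.update (Pi.single i (X ^ 2)) 0 q : Fin 4 → ℂ⟦X⟧) l) = 0 := by
    intro l
    rcases eq_or_ne l 0 with rfl | hl
    · rwa [Function.update_self]
    · rw [Function.update_of_ne hl, hB]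
  have hg_arc : evalArc _ hA g = γ := evalArc_congr hA hB fun n hn l hl =>
    Function.update_of_ne (by rintro rfl; exact hl (hx₀ n hn)) _ _
  refine hfree.eq_one_of_dvd (φ := evalArc _ hA) hr hc ?_ (fun l hl => ?_) (i := i) ?_
  · rw [map_add, map_pow, evalArc_coord, hg_arc, Function.update_self, hq, neg_add_cancel]
  · have hl0 : l ≠ 0 := fun h => hl (h ▸ hc0)
    have hli : l ≠ i := fun h => hl (h ▸ hci)
    rw [evalArc_coord, Function.update_of_ne hl0, Pi.single_eq_of_ne hli]
  · rw [evalArc_coord, Function.update_of_ne hi, Pi.single_eq_same]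
    exact pow_ne_zero 2 X_ne_zero

theorem ActsFreelyOutsideOrigin.coprime_of_gcd_dvd {r e : ℕ} {a : Fin 4 → ℕ} {g : ConvSeries}
    (hfree : ActsFreelyOutsideOrigin r a (coord 0 ^ 2 + g)) (hr : r ≠ 0)
    (hf : mu r a (coord 0 ^ 2 + g) = xi r ^ e • (coord 0 ^ 2 + g))
    (hx₀ : ∀ n, MvPowerSeries.coeff n g.1 ≠ 0 → n 0 = 0)
    (hg : MvPowerSeries.constantCoeff g.1 = 0) (hgcd : Nat.gcd e r ∣ a 0) {i : Fin 4}
    (hi : i ≠ 0) : Nat.Coprime (a i) r := by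
  have hcoeff : ∀ m, MvPowerSeries.coeff (Finsupp.single i m) (coord 0 ^ 2 + g).1 =
      MvPowerSeries.coeff (Finsupp.single i m) g.1 := fun m =>
    coeff_coord_sq_add_of_apply_zero g (Finsupp.single_eq_of_ne hi.symm)
  by_cases hpure : ∀ m, MvPowerSeries.coeff (Finsupp.single i m) g.1 = 0
  · exact hfree.coprime_of_coeff_single_eq_zero hr fun m => (hcoeff m).trans (hpure m)
  obtain ⟨m, hm⟩ := not_forall.1 hpure
  have hmod : a i * m ≡ e [MOD r] := by
    rw [← wt_single]
    exact wt_modEq_of_semiInvariant hr hf (hcoeff m ▸ hm)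
  have hdvd_e : Nat.gcd (a i) r ∣ e :=
    (hmod.dvd_iff (Nat.gcd_dvd_right _ _)).1 ((Nat.gcd_dvd_left _ _).mul_right m)
  exact hfree.eq_one_of_dvd_zero hr hx₀ hg hi (Nat.gcd_dvd_right _ _)
    ((Nat.dvd_gcd hdvd_e (Nat.gcd_dvd_right _ _)).trans hgcd) (Nat.gcd_dvd_left _ _)

theorem ActsFreelyOutsideOrigin.dvd_two_of_dvd {r c e : ℕ} {a : Fin 4 → ℕ}
    {g : ConvSeries} (hfree : ActsFreelyOutsideOrigin r a (coord 0 ^ 2 + (coord 1 ^ 2 + g)))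
    (hr : r ≠ 0) (hf : mu r a (coord 0 ^ 2 + (coord 1 ^ 2 + g)) =
      xi r ^ e • (coord 0 ^ 2 + (coord 1 ^ 2 + g)))
    (hx₀ : ∀ n, MvPowerSeries.coeff n g.1 ≠ 0 → n 0 = 0)
    (hx₁ : ∀ n, MvPowerSeries.coeff n g.1 ≠ 0 → n 1 = 0)
    (hg : MvPowerSeries.constantCoeff g.1 = 0)
    (hc : c ∣ r) (hc0 : c ∣ a 0) (hce : c ∣ e) : c ∣ 2 := by
  have hx₀' : ∀ n, MvPowerSeries.coeff n (coord 1 ^ 2 + g).1 ≠ 0 → n 0 = 0 := fun n hn => by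
    rw [coeff_coord_sq_add] at hn
    split_ifs at hn with h
    · rw [h, Finsupp.single_eq_of_ne (by decide)]
    · exact hx₀ n (by rwa [zero_add] at hn)
  have hg' : MvPowerSeries.constantCoeff (coord 1 ^ 2 + g).1 = 0 := by
    change MvPowerSeries.constantCoeff (MvPowerSeries.X 1 ^ 2 + g.1) = 0
    rw [map_add, hg, map_pow, MvPowerSeries.constantCoeff_X, zero_pow two_ne_zero, add_zero]
  have hcoeff :
      MvPowerSeries.coeff (Finsupp.single 1 2) (coord 0 ^ 2 + (coord 1 ^ 2 + g)).1 ≠ 0 := by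
    rw [coeff_coord_sq_add_of_apply_zero _ (Finsupp.single_eq_of_ne (by decide)),
      coeff_coord_sq_add, if_pos rfl, not_ne_iff.1 fun h => two_ne_zero
        (Finsupp.single_eq_same.symm.trans (hx₁ (Finsupp.single 1 2) h)), add_zero]
    exact one_ne_zero
  have hmod : a 1 * 2 ≡ e [MOD r] := by
    rw [← wt_single]
    exact wt_modEq_of_semiInvariant hr hf hcoeff
  have hcop : Nat.Coprime c (a 1) := hfree.eq_one_of_dvd_zero hr hx₀' hg' one_ne_zero
    ((Nat.gcd_dvd_left _ _).trans hc) ((Nat.gcd_dvd_left _ _).trans hc0) (Nat.gcd_dvd_right _ _)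
  exact hcop.dvd_of_dvd_mul_left ((hmod.dvd_iff hc).2 hce)

end Freeness

section Arithmetic

variable {R d k q x y : ℕ} {a : Fin 4 → ℕ}

theorem sum_add_mul_mod (c : ℕ) (hx : Nat.Coprime x d) :
    ∑ s ∈ Finset.range d, (c + s * x) % d = ∑ s ∈ Finset.range d, s := by
  have hmaps : Set.MapsTo (fun s => (c + s * x) % d) (Finset.range d) (Finset.range d) :=
    fun s hs => by simpa using Nat.mod_lt _ (Nat.zero_lt_of_lt (by simpa using hs))
  have hinj : Set.InjOn (fun s => (c + s * x) % d) (Finset.range d) := by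
    intro s hs t ht hst
    have hmul : s * x ≡ t * x [MOD d] := Nat.ModEq.add_left_cancel' c hst
    exact (Nat.ModEq.cancel_right_of_coprime hx.symm hmul).eq_of_lt_of_lt
      (by simpa using hs) (by simpa using ht)
  exact Finset.sum_nbij _ hmaps hinj
    (Finset.surjOn_of_injOn_of_card_le _ hmaps hinj le_rfl) fun _ _ => rfl

theorem two_mul_sum_mod_le (k : ℕ) (hR : 0 < R) (hx : Nat.Coprime x d) :
    2 * ∑ s ∈ Finset.range d, (k + R * s) * x % (R * d) ≤
      2 * (d * (R - 1)) + R * (d * (d - 1)) := by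
  have hdigits : ∀ s, (k + R * s) * x % (R * d) =
      (k + R * s) * x % R + R * ((k * x / R + s * x) % d) := by
    intro s
    rw [Nat.mod_mul, show (k + R * s) * x = k * x + R * (s * x) by ring,
      Nat.add_mul_div_left _ _ hR]
  have hlow : ∑ s ∈ Finset.range d, (k + R * s) * x % R ≤ d * (R - 1) := by
    calc ∑ s ∈ Finset.range d, (k + R * s) * x % R ≤ ∑ _s ∈ Finset.range d, (R - 1) :=
          Finset.sum_le_sum fun s _ => Nat.le_sub_one_of_lt (Nat.mod_lt _ hR)
      _ = d * (R - 1) := by rw [Finset.sum_const, Finset.card_range, smul_eq_mul]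
  simp_rw [hdigits, Finset.sum_add_distrib, ← Finset.mul_sum, sum_add_mul_mod _ hx]
  calc _ = 2 * ∑ s ∈ Finset.range d, (k + R * s) * x % R +
        R * ((∑ s ∈ Finset.range d, s) * 2) := by ring
    _ ≤ _ := by
      rw [Finset.sum_range_id_mul_two]
      gcongr

theorem lt_four_of_sum_residues {u v w : ℕ} (hd : 0 < d) (hu : Nat.Coprime u d)
    (hv : Nat.Coprime v d) (hw : Nat.Coprime w d)
    (h : ∀ s < d, (k + (2 * q + 1) * s) * u % ((2 * q + 1) * d) +
      (k + (2 * q + 1) * s) * v % ((2 * q + 1) * d) +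
      (k + (2 * q + 1) * s) * w % ((2 * q + 1) * d) =
        q * d + (2 * q + 1) * d + (k + (2 * q + 1) * s)) : d < 4 := by
  have hsum := Finset.sum_congr rfl fun s hs => h s (Finset.mem_range.1 hs)
  simp only [Finset.sum_add_distrib, ← Finset.mul_sum, Finset.sum_const, Finset.card_range,
    smul_eq_mul] at hsum
  have hu_le := two_mul_sum_mod_le k (by omega : 0 < 2 * q + 1) hu
  have hv_le := two_mul_sum_mod_le k (by omega : 0 < 2 * q + 1) hv
  have hw_le := two_mul_sum_mod_le k (by omega : 0 < 2 * q + 1) hw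
  have hgauss := Finset.sum_range_id_mul_two d
  rw [← Finset.mul_sum] at hsum
  obtain ⟨D, rfl⟩ : ∃ D, d = D + 1 := Nat.exists_eq_add_one.2 hd
  simp only [Nat.add_sub_cancel] at hu_le hv_le hw_le hgauss
  have hdiv : (D + 1) * (2 * (q * (D + 1) + (2 * q + 1) * (D + 1) + k) + (2 * q + 1) * D) ≤
      (D + 1) * (3 * (2 * (2 * q) + (2 * q + 1) * D)) := by
    linear_combination hu_le + hv_le + hw_le + 2 * hsum.symm + (2 * q + 1) * hgauss.symm
  nlinarith [le_of_mul_le_mul_left hdiv D.succ_pos]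

theorem odd_of_two_mul_modEq (hy : Nat.Coprime y R) (h : 2 * x ≡ y [MOD R]) : Odd R := by
  rw [← Nat.not_even_iff_odd]
  intro heven
  have hdvd : 2 ∣ y := (h.dvd_iff heven.two_dvd).1 (dvd_mul_right _ _)
  exact (Nat.not_coprime_of_dvd_of_dvd one_lt_two hdvd heven.two_dvd) hy

theorem exists_lt_mul_mod_eq (hx : Nat.Coprime x R) (hqR : q < R) :
    ∃ k < R, k * x % R = q := by
  obtain ⟨m, hmR, hm⟩ := Nat.exists_mul_mod_eq_of_coprime q hx (Nat.ne_zero_of_lt hqR)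
  exact ⟨m, hmR, by rw [mul_comm, hm, Nat.mod_eq_of_lt hqR]⟩

/- The identity is summed over the `k` below `R d` with `k x ≡ (R - 1) / 2 mod R`: these are `d`
integers, and they satisfy `2 (k x d mod R d) < R d`. -/
theorem eq_one_of_residues (hd : 4 ≤ d) (hx : Nat.Coprime x R) (hy : Nat.Coprime y R)
    (hxy : 2 * x ≡ y [MOD R]) (hcop : ∀ i, i ≠ 0 → Nat.Coprime (a i) (R * d))
    (hres : ∀ k < R * d, ¬ R * d ∣ k * (y * d) →
      2 * (k * (x * d) % (R * d)) < R * d →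
      k * a 1 % (R * d) + k * a 2 % (R * d) + k * a 3 % (R * d) =
        k * (x * d) % (R * d) + R * d + k) : R = 1 := by
  obtain ⟨q, rfl⟩ := odd_of_two_mul_modEq hy hxy
  by_contra hR1
  obtain ⟨k, hkR, hk⟩ := exists_lt_mul_mod_eq hx (by omega : q < 2 * q + 1)
  have hk0 : 0 < k := Nat.pos_of_ne_zero fun h => by
    rw [h, zero_mul, Nat.zero_mod] at hk
    omega
  have hcop_d := fun i hi => (hcop i hi).coprime_dvd_right (dvd_mul_left d (2 * q + 1))
  refine absurd (lt_four_of_sum_residues (k := k) (q := q) (by omega) (hcop_d 1 (by decide))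
    (hcop_d 2 (by decide)) (hcop_d 3 (by decide)) fun s hs => ?_) (by omega)
  have hlt : k + (2 * q + 1) * s < (2 * q + 1) * d :=
    calc k + (2 * q + 1) * s < (2 * q + 1) * (s + 1) := by rw [mul_add]; omega
      _ ≤ (2 * q + 1) * d := Nat.mul_le_mul_left _ hs
  have hmod : (k + (2 * q + 1) * s) * (x * d) % ((2 * q + 1) * d) = q * d := by
    rw [← mul_assoc, Nat.mul_mod_mul_right, add_mul, mul_assoc, Nat.add_mul_mod_self_left, hk]
  have hndvd : ¬ (2 * q + 1) * d ∣ (k + (2 * q + 1) * s) * (y * d) := by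
    rw [← mul_assoc, Nat.mul_dvd_mul_iff_right (by omega)]
    intro h
    have hdvd := (Nat.dvd_add_left (dvd_mul_right _ _)).1 (hy.symm.dvd_of_dvd_mul_right h)
    exact absurd (Nat.le_of_dvd hk0 hdvd) (by omega)
  rw [hres _ hlt hndvd (by rw [hmod]; nlinarith), hmod]

theorem eq_gcd_of_residues {r e : ℕ} (htwo : 2 * a 0 ≡ e [MOD r])
    (hgcd : Nat.gcd (a 0) r = Nat.gcd e r) (hfour : 4 ≤ Nat.gcd (a 0) r)
    (hcop : ∀ i, i ≠ 0 → Nat.Coprime (a i) r)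
    (hres : ∀ k < r, ¬ r ∣ k * e → 2 * (k * a 0 % r) < r →
      k * a 1 % r + k * a 2 % r + k * a 3 % r = k * a 0 % r + r + k) :
    r = Nat.gcd e r := by
  obtain ⟨x, R, hx, ha, hr⟩ := Nat.exists_coprime (a 0) r
  obtain ⟨y, R', hy, he, hr'⟩ := Nat.exists_coprime e r
  rw [← hgcd] at he hr' ⊢
  set d := Nat.gcd (a 0) r
  have hd : 0 < d := by omega
  obtain rfl : R = R' := Nat.eq_of_mul_eq_mul_right hd (hr.symm.trans hr')
  rw [ha, he, hr] at htwo
  have hR : R = 1 := eq_one_of_residues hfour hx hy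
    (Nat.ModEq.mul_right_cancel' hd.ne' (by rwa [mul_assoc])) (a := a)
    (fun i hi => hr ▸ hcop i hi) (by rw [← ha, ← he, ← hr]; exact hres)
  rw [hr, hR, one_mul]

end Arithmetic

section WeightInequality

variable {r e j : ℕ} {a b c : Fin 4 → ℕ} {g : ConvSeries} {n : Fin 4 →₀ ℕ}

theorem wt_congr_of_apply_zero (hn : n 0 = 0) (h : ∀ i, i ≠ 0 → b i = c i) :
    wt b n = wt c n := by
  refine Finset.sum_congr rfl fun i _ => ?_
  rcases eq_or_ne i 0 with rfl | hi
  · rw [hn, mul_zero, mul_zero]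
  · rw [h i hi]

theorem wt_mul_left (l : ℕ) (b : Fin 4 → ℕ) (n : Fin 4 →₀ ℕ) :
    wt (fun i => l * b i) n = l * wt b n := by
  rw [wt, wt, Finset.mul_sum]
  exact Finset.sum_congr rfl fun i _ => mul_assoc _ _ _

theorem wt_pos (hb : ∀ i, 0 < b i) (hn : n ≠ 0) : 0 < wt b n := by
  obtain ⟨i, hi⟩ := Finsupp.ne_iff.1 hn
  exact Finset.sum_pos' (fun _ _ => Nat.zero_le _)
    ⟨i, Finset.mem_univ i, Nat.mul_pos (hb i) (Nat.pos_of_ne_zero hi)⟩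

theorem exists_wt_min {h : ConvSeries} (b : Fin 4 → ℕ) (hh : h ≠ 0) :
    ∃ n, MvPowerSeries.coeff n h.1 ≠ 0 ∧
      ∀ m, MvPowerSeries.coeff m h.1 ≠ 0 → wt b n ≤ wt b m := by
  have hex : ∃ n, MvPowerSeries.coeff n h.1 ≠ 0 := by
    by_contra! hzero
    exact hh (ConvSeries.ext_coeff hzero)
  obtain ⟨n, hn, hmin⟩ := exists_minimalFor_of_wellFoundedLT _ (wt b) hex
  exact ⟨n, hn, fun m hm => (le_total _ _).elim id (hmin hm)⟩

theorem mul_le_two_mul_sub_wt_of_le_mld [IsDomain (LocalRingX r a (coord 0 ^ 2 + g))]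
    (hr : r ≠ 0) (hf : mu r a (coord 0 ^ 2 + g) = xi r ^ e • (coord 0 ^ 2 + g))
    (hx₀ : ∀ n, MvPowerSeries.coeff n g.1 ≠ 0 → n 0 = 0)
    (hg : ∀ n, MvPowerSeries.coeff n g.1 ≠ 0 → 3 ≤ n.degree) {c₀ : ℝ} (hc₀ : 0 ≤ c₀)
    (hmld : (c₀ : EReal) ≤ mld r a (coord 0 ^ 2 + g)) (hb : ∀ i, 0 < b i)
    (hab : ∀ i, b i ≡ j * a i [MOD r]) (hn : MvPowerSeries.coeff n g.1 ≠ 0)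
    (hmin : ∀ m, MvPowerSeries.coeff m g.1 ≠ 0 → wt b n ≤ wt b m) :
    c₀ * r ≤ (2 * (b 1 + b 2 + b 3) : ℕ) - wt b n := by
  set b' : Fin 4 → ℕ := Function.update (fun i => 2 * b i) 0 (wt b n)
  have hb'_zero : b' 0 = wt b n := Function.update_self _ _ _
  have hb'_ne : ∀ i, i ≠ 0 → b' i = 2 * b i := fun i hi => Function.update_of_ne hi _ _
  have hwt : ∀ m, MvPowerSeries.coeff m g.1 ≠ 0 → wt b' m = 2 * wt b m := fun m hm => by
    rw [← wt_mul_left, wt_congr_of_apply_zero (hx₀ m hm) hb'_ne]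
  have hn0 : n ≠ 0 := by
    rintro rfl
    simpa using hg 0 hn
  have hb'_pos : ∀ i, 0 < b' i :=
    (Function.forall_update_iff _ fun _ x => 0 < x).2 ⟨wt_pos hb hn0, fun i _ => by simp [hb i]⟩
  have hb'_mod : ∀ i, b' i ≡ 2 * j * a i [MOD r] := fun i => by
    rw [mul_assoc]
    rcases eq_or_ne i 0 with rfl | hi
    · exact hb'_zero ▸ (wt_modEq_two_mul_of_semiInvariant hr hf hx₀ hab hn).trans
        ((hab 0).mul_left 2)
    · exact hb'_ne i hi ▸ (hab i).mul_left 2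
  have harc := mul_le_sub_of_le_mld hr hf hx₀ hg hc₀ hmld hb'_pos hb'_mod
    ⟨n, hn, by rw [hwt n hn, hb'_zero]⟩
    fun m hm => by rw [hwt m hm, hb'_zero]; exact Nat.mul_le_mul_left 2 (hmin m hm)
  rwa [hb'_zero, hb'_ne 1 (by decide), hb'_ne 2 (by decide), hb'_ne 3 (by decide), ← mul_add,
    ← mul_add] at harc

/- If the least weight of `g` is not `2 * b 0`, then it differs from `2 * b 0` by at least `r`, and
this gap pays for passing to the doubled weight. -/
theorem mul_le_sum_sub_wt_of_le_mld [IsDomain (LocalRingX r a (coord 0 ^ 2 + g))] (hr : r ≠ 0)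
    (hf : mu r a (coord 0 ^ 2 + g) = xi r ^ e • (coord 0 ^ 2 + g)) (hg₀ : g ≠ 0)
    (hx₀ : ∀ n, MvPowerSeries.coeff n g.1 ≠ 0 → n 0 = 0)
    (hg : ∀ n, MvPowerSeries.coeff n g.1 ≠ 0 → 3 ≤ n.degree) {c₀ : ℝ} (hc₀ : 0 ≤ c₀)
    (hc₁ : c₀ ≤ 1) (hmld : (c₀ : EReal) ≤ mld r a (coord 0 ^ 2 + g)) (hb : ∀ i, 0 < b i)
    (hab : ∀ i, b i ≡ j * a i [MOD r])
    (hmin : ∀ m, MvPowerSeries.coeff m (coord 0 ^ 2 + g).1 ≠ 0 → wt b n ≤ wt b m) :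
    c₀ * r ≤ (∑ i, b i : ℕ) - wt b n := by
  obtain ⟨m, hm, hm_min⟩ := exists_wt_min b hg₀
  have hle_sq : wt b n ≤ 2 * b 0 := by
    rw [mul_comm, ← wt_single]
    exact hmin _ (coeff_single_coord_sq_add hx₀)
  have hle_g : wt b n ≤ wt b m :=
    hmin m (by rwa [coeff_coord_sq_add_of_apply_zero g (hx₀ m hm)])
  rw [Fin.sum_univ_four]
  by_cases heq : wt b m = 2 * b 0
  · have harc := mul_le_sub_of_le_mld hr hf hx₀ hg hc₀ hmld hb hab ⟨m, hm, heq⟩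
      fun l hl => heq ▸ hm_min l hl
    have hle_sq' : (wt b n : ℝ) ≤ 2 * b 0 := mod_cast hle_sq
    push_cast at harc ⊢
    linarith
  have harc := mul_le_two_mul_sub_wt_of_le_mld hr hf hx₀ hg hc₀ hmld hb hab hm hm_min
  have hmod : wt b m ≡ 2 * b 0 [MOD r] := wt_modEq_two_mul_of_semiInvariant hr hf hx₀ hab hm
  have hgap : 2 * wt b n + r ≤ 2 * b 0 + wt b m := by
    rcases lt_or_gt_of_ne heq with hlt | hlt
    · have := hmod.add_le_of_lt hlt
      omega
    · have := hmod.symm.add_le_of_lt hlt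
      omega
  have hgap' : (2 * wt b n + r : ℝ) ≤ 2 * b 0 + wt b m := mod_cast hgap
  have hc₁' : c₀ * r ≤ r := mul_le_of_le_one_left r.cast_nonneg hc₁
  push_cast at harc ⊢
  linarith

end WeightInequality

section MinimalWeight

variable {r e k : ℕ} {a b : Fin 4 → ℕ} {f : ConvSeries} {n : Fin 4 →₀ ℕ}

theorem weight_natCast_div (r : ℕ) (hn : MvPowerSeries.coeff n f.1 ≠ 0)
    (hmin : ∀ m, MvPowerSeries.coeff m f.1 ≠ 0 → wt b n ≤ wt b m) :
    weight (fun i => (b i : ℚ) / r) f = (wt b n : ℝ) / r := by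
  have hwt : ∀ m : Fin 4 →₀ ℕ, ((∑ i, (b i : ℚ) / r * m i : ℚ) : ℝ) = (wt b m : ℝ) / r := by
    intro m
    push_cast [wt]
    rw [Finset.sum_div]
    exact Finset.sum_congr rfl fun i _ => by ring
  refine IsLeast.csInf_eq ⟨⟨n, hn, (hwt n).symm⟩, ?_⟩
  rintro s ⟨m, hm, rfl⟩
  rw [hwt]
  have := hmin m hm
  gcongr

theorem weight_smul {l : ℚ} (hl : 0 ≤ l) (v : Fin 4 → ℚ) (f : ConvSeries) :
    weight (l • v) f = l * weight v f := by
  rw [weight, weight, ← smul_eq_mul, ← Real.sInf_smul_of_nonneg (mod_cast hl)]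
  congr 1
  ext s
  simp only [Set.mem_smul_set, Set.mem_ofPred_eq, Pi.smul_apply, smul_eq_mul, mul_assoc,
    ← Finset.mul_sum, Rat.cast_mul]
  constructor
  · rintro ⟨n, hn, rfl⟩
    exact ⟨_, ⟨n, hn, rfl⟩, rfl⟩
  · rintro ⟨_, ⟨n, hn, rfl⟩, rfl⟩
    exact ⟨n, hn, rfl⟩

theorem exists_nat_of_mem_weightSet (hr : r ≠ 0) {v : Fin 4 → ℚ} (hv : v ∈ weightSet r a) :
    ∃ (j : ℕ) (b : Fin 4 → ℕ), (∀ i, b i ≡ j * a i [MOD r]) ∧ v = fun i => (b i : ℚ) / r := by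
  obtain ⟨hv0, -, j, hj⟩ := hv
  have hr' : (0 : ℚ) < r := by positivity
  choose m hm using hj
  have hrv : ∀ i, (r : ℚ) * v i = (j * a i + r * m i : ℤ) := fun i => by
    rw [hm]
    push_cast
    field_simp
  have hnonneg : ∀ i, (0 : ℤ) ≤ j * a i + r * m i := fun i => by
    exact_mod_cast hrv i ▸ mul_nonneg hr'.le (hv0 i)
  choose b hb using fun i => Int.eq_ofNat_of_zero_le (hnonneg i)
  obtain ⟨k, hk⟩ := Int.eq_ofNat_of_zero_le (Int.emod_nonneg j (Int.natCast_ne_zero.2 hr))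
  refine ⟨k, b, fun i => ?_, funext fun i => ?_⟩
  · rw [← Int.natCast_modEq_iff, ← hb]
    push_cast
    rw [← hk]
    calc j * (a i : ℤ) + r * m i ≡ j * a i [ZMOD r] := Int.add_mul_emod_self_left ..
      _ ≡ j % r * a i [ZMOD r] := (Int.mod_modEq j r).symm.mul_right _
  · rw [eq_div_iff hr'.ne', mul_comm, hrv, hb]
    rfl

theorem le_sum_sub_weight_of_le_mld {g : ConvSeries}
    [IsDomain (LocalRingX r a (coord 0 ^ 2 + g))] (hr : r ≠ 0)
    (hf : mu r a (coord 0 ^ 2 + g) = xi r ^ e • (coord 0 ^ 2 + g)) (hg₀ : g ≠ 0)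
    (hx₀ : ∀ n, MvPowerSeries.coeff n g.1 ≠ 0 → n 0 = 0)
    (hg : ∀ n, MvPowerSeries.coeff n g.1 ≠ 0 → 3 ≤ n.degree) {c₀ : ℝ} (hc₀ : 0 ≤ c₀)
    (hc₁ : c₀ ≤ 1) (hmld : (c₀ : EReal) ≤ mld r a (coord 0 ^ 2 + g)) {β : Fin 4 → ℚ}
    (hβ : β ∈ weightSet r a) (hβ_pos : ∀ i, 0 < β i) :
    c₀ ≤ ((∑ i, β i : ℚ) : ℝ) - weight β (coord 0 ^ 2 + g) := by
  have hr' : (0 : ℝ) < r := by positivity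
  obtain ⟨j, b, hab, rfl⟩ := exists_nat_of_mem_weightSet hr hβ
  have hb : ∀ i, 0 < b i := fun i => Nat.pos_of_ne_zero fun h => by simpa [h] using hβ_pos i
  obtain ⟨n, hn, hmin⟩ := exists_wt_min (h := coord 0 ^ 2 + g) b fun h =>
    coeff_single_coord_sq_add hx₀ (by rw [h]; rfl)
  rw [weight_natCast_div r hn hmin, ← Finset.sum_div]
  push_cast
  rw [← sub_div, le_div_iff₀ hr']
  exact_mod_cast mul_le_sum_sub_wt_of_le_mld hr hf hg₀ hx₀ hg hc₀ hc₁ hmld hb hab hmin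

theorem alpha_mem_weightSet {i : Fin 4} (hi : 0 < alpha r a k i) :
    alpha r a k ∈ weightSet r a :=
  ⟨fun _ => Int.fract_nonneg _, fun h => hi.ne' (congrFun h i), k, fun l =>
    ⟨-⌊(k * a l : ℚ) / r⌋, by rw [alpha, Int.fract]; push_cast; ring⟩⟩

theorem one_le_sum_sub_weight_alpha {ε : ℝ} (hε : -1 / 3 ≤ ε)
    (hbound : ∀ β ∈ weightSet r a, (∀ i, 0 < β i) →
      5 / 6 + ε ≤ ((∑ i, β i : ℚ) : ℝ) - weight β f)
    (hpos : ∀ i, 0 < alpha r a k i) (hΨ : alpha r a k ∉ Psi1 ε r a f ∩ weightSetZero r a) :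
    1 ≤ ((∑ i, alpha r a k i : ℚ) : ℝ) - weight (alpha r a k) f := by
  by_contra! hlt
  have hN := alpha_mem_weightSet (hpos 0)
  have hlt_one : ∀ i, alpha r a k i < 1 := fun i => Int.fract_lt_one _
  by_cases hprim : IsPrimitive r a (alpha r a k)
  · exact hΨ ⟨⟨hprim, hbound _ hN hpos, hlt⟩, hN, fun i => (hlt_one i).le,
      fun h => (h 0).elim (hpos 0).ne' (hlt_one 0).ne⟩
  obtain ⟨l, hl, v, hv, hlv⟩ : ∃ l : ℕ, 2 ≤ l ∧ ∃ v ∈ weightSet r a, alpha r a k = (l : ℚ) • v := by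
    by_contra! h
    exact hprim ⟨hN, h⟩
  have hv_pos : ∀ i, 0 < v i := fun i =>
    pos_of_mul_pos_right (by simpa [hlv] using hpos i) l.cast_nonneg
  have hv_bound := hbound v hv hv_pos
  rw [hlv, weight_smul l.cast_nonneg] at hlt
  simp only [Pi.smul_apply, smul_eq_mul, ← Finset.mul_sum, Rat.cast_mul, Rat.cast_natCast,
    ← mul_sub] at hlt
  have hl' : (2 : ℝ) ≤ l := mod_cast hl
  nlinarith

end MinimalWeight

section Residues

variable {r e k : ℕ} {a b : Fin 4 → ℕ} {f : ConvSeries} {n : Fin 4 →₀ ℕ}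

/-- The integral weight `r α_k`, whose entries are the residues of the `k aᵢ` modulo `r`. -/
def residue (r : ℕ) (a : Fin 4 → ℕ) (k : ℕ) (i : Fin 4) : ℕ := k * a i % r

theorem alpha_eq_residue_div (r : ℕ) (a : Fin 4 → ℕ) (k : ℕ) :
    alpha r a k = fun i => (residue r a k i : ℚ) / r := by
  funext i
  rw [alpha, residue, ← Int.fract_div_natCast_eq_div_natCast_mod, Nat.cast_mul]

theorem residue_modEq (r : ℕ) (a : Fin 4 → ℕ) (k : ℕ) (i : Fin 4) :
    residue r a k i ≡ k * a i [MOD r] :=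
  Nat.mod_modEq _ _

theorem residue_lt (hr : r ≠ 0) (a : Fin 4 → ℕ) (k : ℕ) (i : Fin 4) : residue r a k i < r :=
  Nat.mod_lt _ (Nat.pos_of_ne_zero hr)

theorem residue_pos (htwo : 2 * a 0 ≡ e [MOD r]) (hcop : ∀ i, i ≠ 0 → Nat.Coprime (a i) r)
    (hke : ¬ r ∣ k * e) (i : Fin 4) : 0 < residue r a k i := by
  refine Nat.pos_of_ne_zero fun h => hke ?_
  have hdvd : r ∣ k * a i := Nat.dvd_of_mod_eq_zero h
  rcases eq_or_ne i 0 with rfl | hi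
  · refine ((htwo.mul_left k).dvd_iff dvd_rfl).1 ?_
    rw [mul_left_comm]
    exact hdvd.mul_left 2
  · exact ((hcop i hi).symm.dvd_of_dvd_mul_right hdvd).mul_right e

theorem residue_sub_add_residue {i : Fin 4} (hr : r ≠ 0) (hk : k ≤ r)
    (hpos : 0 < residue r a k i) : residue r a (r - k) i + residue r a k i = r := by
  have hdvd : r ∣ residue r a (r - k) i + residue r a k i := by
    refine (((residue_modEq r a (r - k) i).add (residue_modEq r a k i)).dvd_iff dvd_rfl).2 ?_
    rw [← add_mul, Nat.sub_add_cancel hk]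
    exact dvd_mul_right _ _
  obtain ⟨t, ht⟩ := hdvd
  have hlt := residue_lt hr a k i
  have hlt' := residue_lt hr a (r - k) i
  obtain rfl : t = 1 := by nlinarith
  rw [ht, mul_one]

theorem sum_modEq_add_one (hsum : (∑ i, (a i : ℤ)) - (e : ℤ) ≡ 1 [ZMOD (r : ℤ)]) :
    ∑ i, a i ≡ e + 1 [MOD r] := by
  rw [← Int.natCast_modEq_iff]
  push_cast
  simpa only [add_sub_cancel] using hsum.add_left (e : ℤ)

theorem sum_ne_wt_add (hsum : ∑ i, a i ≡ e + 1 [MOD r]) (hab : ∀ i, b i ≡ k * a i [MOD r])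
    (hn : wt a n ≡ e [MOD r]) (hk : ¬ r ∣ k) : ∑ i, b i ≠ wt b n + r := by
  intro heq
  have hmod : k * e + k ≡ k * e + 0 [MOD r] :=
    calc k * e + k = k * (e + 1) := rfl
      _ ≡ k * ∑ i, a i [MOD r] := hsum.symm.mul_left k
      _ = ∑ i, k * a i := Finset.mul_sum _ _ _
      _ ≡ ∑ i, b i [MOD r] := Nat.ModEq.sum fun i _ => (hab i).symm
      _ = wt b n + r := heq
      _ ≡ k * e + 0 [MOD r] :=
        ((wt_modEq hab n).trans (hn.mul_left k)).add (Nat.modEq_zero_iff_dvd.2 dvd_rfl)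
  exact hk (Nat.modEq_zero_iff_dvd.1 (Nat.ModEq.add_left_cancel' _ hmod))

theorem wt_residue_add_lt_sum (hr : r ≠ 0) (hsum : ∑ i, a i ≡ e + 1 [MOD r])
    (hfe : ∀ n, MvPowerSeries.coeff n f.1 ≠ 0 → wt a n ≡ e [MOD r])
    (hone : 1 ≤ ((∑ i, alpha r a k i : ℚ) : ℝ) - weight (alpha r a k) f) (hk : ¬ r ∣ k)
    (hn : MvPowerSeries.coeff n f.1 ≠ 0)
    (hmin : ∀ m, MvPowerSeries.coeff m f.1 ≠ 0 → wt (residue r a k) n ≤ wt (residue r a k) m) :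
    wt (residue r a k) n + r < ∑ i, residue r a k i := by
  refine lt_of_le_of_ne ?_ (sum_ne_wt_add hsum (residue_modEq r a k) (hfe n hn) hk).symm
  have hr' : (0 : ℝ) < r := by positivity
  rw [alpha_eq_residue_div, weight_natCast_div r hn hmin, ← Finset.sum_div] at hone
  push_cast at hone
  rw [← sub_div, one_le_div hr', le_sub_iff_add_le'] at hone
  exact_mod_cast hone

theorem residue_sum_modEq (hsum : ∑ i, a i ≡ e + 1 [MOD r]) (htwo : 2 * a 0 ≡ e [MOD r])
    (k : ℕ) :
    residue r a k 1 + residue r a k 2 + residue r a k 3 ≡ residue r a k 0 + k [MOD r] := by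
  have ha : a 1 + a 2 + a 3 ≡ a 0 + 1 [MOD r] := Nat.ModEq.add_left_cancel' (a 0) <|
    calc a 0 + (a 1 + a 2 + a 3) = ∑ i, a i := by rw [Fin.sum_univ_four]; ring
      _ ≡ e + 1 [MOD r] := hsum
      _ ≡ 2 * a 0 + 1 [MOD r] := htwo.symm.add_right 1
      _ = a 0 + (a 0 + 1) := by ring
  calc _ ≡ k * a 1 + k * a 2 + k * a 3 [MOD r] :=
        ((residue_modEq r a k 1).add (residue_modEq r a k 2)).add (residue_modEq r a k 3)
    _ = k * (a 1 + a 2 + a 3) := by rw [mul_add, mul_add]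
    _ ≡ k * (a 0 + 1) [MOD r] := ha.mul_left k
    _ = k * a 0 + k := rfl
    _ ≡ residue r a k 0 + k [MOD r] := (residue_modEq r a k 0).symm.add_right k

theorem wt_residue_modEq (htwo : 2 * a 0 ≡ e [MOD r]) (hn : wt a n ≡ e [MOD r]) (k : ℕ) :
    wt (residue r a k) n ≡ 2 * residue r a k 0 [MOD r] :=
  calc wt (residue r a k) n ≡ k * e [MOD r] :=
        (wt_modEq (residue_modEq r a k) n).trans (hn.mul_left k)
    _ ≡ k * (2 * a 0) [MOD r] := htwo.symm.mul_left k
    _ = 2 * (k * a 0) := mul_left_comm _ _ _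
    _ ≡ 2 * residue r a k 0 [MOD r] := (residue_modEq r a k 0).symm.mul_left 2

theorem le_wt_residue_sub_add (hr : r ≠ 0) (htwo : 2 * a 0 ≡ e [MOD r])
    (hn : wt a n ≡ e [MOD r]) (hkr : k ≤ r) (hpos : 0 < residue r a k 0) :
    r ≤ wt (residue r a (r - k)) n + 2 * residue r a k 0 := by
  refine Nat.le_of_dvd (by omega)
    ((((wt_residue_modEq htwo hn (r - k)).add_right _).dvd_iff dvd_rfl).2 ?_)
  rw [← mul_add, residue_sub_add_residue hr hkr hpos]
  exact dvd_mul_left _ _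

/- The inequality `hlt` for `k` bounds the sum of the residues from below, and for `r - k` from
above; together they leave an interval of length less than `r`. -/
theorem residue_sum_eq (hr : r ≠ 0) (hsum : ∑ i, a i ≡ e + 1 [MOD r])
    (htwo : 2 * a 0 ≡ e [MOD r]) (hcop : ∀ i, i ≠ 0 → Nat.Coprime (a i) r)
    (hfe : ∀ n, MvPowerSeries.coeff n f.1 ≠ 0 → wt a n ≡ e [MOD r])
    (hf0 : MvPowerSeries.coeff (Finsupp.single 0 2) f.1 ≠ 0)
    (hlt : ∀ k < r, ¬ r ∣ k * e → ∀ n, MvPowerSeries.coeff n f.1 ≠ 0 →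
      (∀ m, MvPowerSeries.coeff m f.1 ≠ 0 → wt (residue r a k) n ≤ wt (residue r a k) m) →
      wt (residue r a k) n + r < ∑ i, residue r a k i)
    (hkr : k < r) (hke : ¬ r ∣ k * e) (hsmall : 2 * residue r a k 0 < r) :
    residue r a k 1 + residue r a k 2 + residue r a k 3 = residue r a k 0 + r + k := by
  have hf : f ≠ 0 := fun h => hf0 (by rw [h]; rfl)
  have hpos := residue_pos htwo hcop hke
  have hcompl := fun i => residue_sub_add_residue hr hkr.le (hpos i)
  have hke' : ¬ r ∣ (r - k) * e := fun h => hke <| (Nat.dvd_add_right h).1 <| by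
    rw [← add_mul, Nat.sub_add_cancel hkr.le]
    exact dvd_mul_right _ _
  obtain ⟨n, hn, hmin⟩ := exists_wt_min (residue r a k) hf
  obtain ⟨n', hn', hmin'⟩ := exists_wt_min (residue r a (r - k)) hf
  have hwt : wt (residue r a k) n = 2 * residue r a k 0 := by
    have hle := hmin _ hf0
    rw [wt_single, mul_comm] at hle
    exact (wt_residue_modEq htwo (hfe n hn) k).eq_of_lt_of_lt (hle.trans_lt hsmall) hsmall
  have hwt' := le_wt_residue_sub_add hr htwo (hfe n' hn') hkr.le (hpos 0)
  have hk₀ : k ≠ 0 := by rintro rfl; simp at hke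
  have hlower := hlt k hkr hke n hn hmin
  have hupper := hlt (r - k) (Nat.sub_lt (Nat.pos_of_ne_zero hr) (Nat.pos_of_ne_zero hk₀))
    hke' n' hn' hmin'
  rw [Fin.sum_univ_four] at hlower hupper
  have hmod : residue r a k 1 + residue r a k 2 + residue r a k 3 ≡
      residue r a k 0 + r + k [MOD r] := by
    refine (residue_sum_modEq hsum htwo k).trans ?_
    rw [add_right_comm]
    exact Nat.add_modEq_right.symm
  have h0 := hcompl 0
  have h1 := hcompl 1
  have h2 := hcompl 2
  have h3 := hcompl 3
  refine Nat.ModEq.eq_of_abs_lt hmod ?_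
  rw [abs_lt]
  constructor <;> push_cast <;> omega

end Residues

section CDEType

variable {ε : ℝ} {r e : ℕ} {a : Fin 4 → ℕ} {g : ConvSeries}

theorem logDiscrepancies_nonempty {f : ConvSeries} (h : mld r a f ≠ ⊤) :
    (logDiscrepancies r a f).Nonempty := by
  rw [Set.nonempty_iff_ne_empty]
  intro hempty
  exact h (by rw [mld, hempty, Set.image_empty, sInf_empty])

theorem constantCoeff_eq_zero_of_three_le_degree
    (hg : ∀ n, MvPowerSeries.coeff n g.1 ≠ 0 → 3 ≤ n.degree) :
    MvPowerSeries.constantCoeff g.1 = 0 := by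
  by_contra h
  simpa using hg 0 h

theorem wt_residue_add_lt_sum_of_le_mld (hε₀ : -1 / 3 ≤ ε) (hε₁ : ε ≤ 1 / 6) (hr : r ≠ 0)
    (hf : mu r a (coord 0 ^ 2 + g) = xi r ^ e • (coord 0 ^ 2 + g))
    (hx₀ : ∀ n, MvPowerSeries.coeff n g.1 ≠ 0 → n 0 = 0)
    (hg : ∀ n, MvPowerSeries.coeff n g.1 ≠ 0 → 3 ≤ n.degree) (hg₀ : g ≠ 0)
    (hmld : ((5 / 6 + ε : ℝ) : EReal) ≤ mld r a (coord 0 ^ 2 + g))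
    (hne : (logDiscrepancies r a (coord 0 ^ 2 + g)).Nonempty)
    (hsum : ∑ i, a i ≡ e + 1 [MOD r]) (hcop : ∀ i, i ≠ 0 → Nat.Coprime (a i) r)
    (hdvd : ∀ β ∈ Psi1 ε r a (coord 0 ^ 2 + g) ∩ weightSetZero r a, ∀ k : ℕ, 1 ≤ k → k < r →
      β = alpha r a k → r ∣ k * e)
    {k : ℕ} (hkr : k < r) (hke : ¬ r ∣ k * e) {n : Fin 4 →₀ ℕ}
    (hn : MvPowerSeries.coeff n (coord 0 ^ 2 + g).1 ≠ 0)
    (hmin : ∀ m, MvPowerSeries.coeff m (coord 0 ^ 2 + g).1 ≠ 0 →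
      wt (residue r a k) n ≤ wt (residue r a k) m) :
    wt (residue r a k) n + r < ∑ i, residue r a k i := by
  have := isDomain_localRingX hne
  have hk₀ : k ≠ 0 := by rintro rfl; simp at hke
  have hpos : ∀ i, 0 < alpha r a k i := fun i => by
    have := residue_pos (two_mul_modEq_of_semiInvariant hr hf hx₀) hcop hke i
    rw [alpha_eq_residue_div]
    positivity
  have hone : 1 ≤ ((∑ i, alpha r a k i : ℚ) : ℝ) - weight (alpha r a k) (coord 0 ^ 2 + g) :=
    one_le_sum_sub_weight_alpha hε₀
      (fun β hβ => le_sum_sub_weight_of_le_mld hr hf hg₀ hx₀ hg (by linarith) (by linarith)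
        hmld hβ)
      hpos fun hΨ => hke (hdvd _ hΨ k (Nat.one_le_iff_ne_zero.2 hk₀) hkr rfl)
  exact wt_residue_add_lt_sum hr hsum (fun m => wt_modEq_of_semiInvariant hr hf) hone
    (fun h => hke (h.mul_right e)) hn hmin

theorem eq_gcd_of_coord_sq_add (hε₀ : -1 / 3 ≤ ε) (hε₁ : ε ≤ 1 / 6) (hr : r ≠ 0)
    (hf : mu r a (coord 0 ^ 2 + g) = xi r ^ e • (coord 0 ^ 2 + g))
    (hx₀ : ∀ n, MvPowerSeries.coeff n g.1 ≠ 0 → n 0 = 0)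
    (hg : ∀ n, MvPowerSeries.coeff n g.1 ≠ 0 → 3 ≤ n.degree)
    (hiso : HasIsolatedSingularity (coord 0 ^ 2 + g))
    (hfree : ActsFreelyOutsideOrigin r a (coord 0 ^ 2 + g))
    (hmld : ((5 / 6 + ε : ℝ) : EReal) ≤ mld r a (coord 0 ^ 2 + g))
    (hne : (logDiscrepancies r a (coord 0 ^ 2 + g)).Nonempty)
    (hsum : ∑ i, a i ≡ e + 1 [MOD r]) (hfour : 4 ≤ Nat.gcd (a 0) r)
    (hgcd : Nat.gcd (a 0) r = Nat.gcd e r)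
    (hdvd : ∀ β ∈ Psi1 ε r a (coord 0 ^ 2 + g) ∩ weightSetZero r a, ∀ k : ℕ, 1 ≤ k → k < r →
      β = alpha r a k → r ∣ k * e) :
    r = Nat.gcd e r := by
  have hg₀ : g ≠ 0 := by
    rintro rfl
    exact not_hasIsolatedSingularity_coord_sq 0 (by rwa [add_zero] at hiso)
  have htwo : 2 * a 0 ≡ e [MOD r] := two_mul_modEq_of_semiInvariant hr hf hx₀
  have hcop : ∀ i, i ≠ 0 → Nat.Coprime (a i) r := fun i =>
    hfree.coprime_of_gcd_dvd hr hf hx₀ (constantCoeff_eq_zero_of_three_le_degree hg)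
      (hgcd ▸ Nat.gcd_dvd_left _ _)
  exact eq_gcd_of_residues htwo hgcd hfour hcop fun k hkr hke =>
    residue_sum_eq hr hsum htwo hcop (fun n => wt_modEq_of_semiInvariant hr hf)
      (coeff_single_coord_sq_add hx₀)
      (fun l hlr hle n => wt_residue_add_lt_sum_of_le_mld hε₀ hε₁ hr hf hx₀ hg hg₀ hmld hne
        hsum hcop hdvd hlr hle)
      hkr hke

end CDEType

end Hyperquotient

open Hyperquotient in
theorem mainTheorem8_general {ε : ℝ} (hε₀ : -1 / 3 ≤ ε) (hε₁ : ε ≤ 1 / 6) {r e : ℕ}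
    {a : Fin 4 → ℕ} {f : ConvSeries} (hr : r ≠ 0) (hf : mu r a f = xi r ^ e • f)
    (hiso : HasIsolatedSingularity f) (hfree : ActsFreelyOutsideOrigin r a f)
    (hmld : ((5 / 6 + ε : ℝ) : EReal) ≤ mld r a f) (hne : (logDiscrepancies r a f).Nonempty)
    (hsum : (∑ i, (a i : ℤ)) - (e : ℤ) ≡ 1 [ZMOD (r : ℤ)])
    (htype : (∃ g : ConvSeries, f = coord 0 ^ 2 + coord 1 ^ 2 + g ∧
      ∀ n, MvPowerSeries.coeff n g.1 ≠ 0 → n 0 = 0 ∧ n 1 = 0 ∧ 3 ≤ n.degree) ∨ IsCDEType f)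
    (hfour : 4 ≤ Nat.gcd (a 0) r) (hgcd : Nat.gcd (a 0) r = Nat.gcd e r)
    (hdvd : ∀ β ∈ Psi1 ε r a f ∩ weightSetZero r a, ∀ k : ℕ, 1 ≤ k → k < r →
      β = alpha r a k → r ∣ k * e) :
    r = Nat.gcd e r := by
  rcases htype with ⟨g, rfl, hg⟩ | ⟨g, rfl, hg⟩
  · rw [add_assoc] at hf hfree
    have htwo : Nat.gcd (a 0) r ∣ 2 := hfree.dvd_two_of_dvd hr hf (fun n hn => (hg n hn).1)
      (fun n hn => (hg n hn).2.1)
      (constantCoeff_eq_zero_of_three_le_degree fun n hn => (hg n hn).2.2)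
      (Nat.gcd_dvd_right _ _) (Nat.gcd_dvd_left _ _) (hgcd ▸ Nat.gcd_dvd_left _ _)
    exact absurd (hfour.trans (Nat.le_of_dvd two_pos htwo)) (by norm_num)
  · exact eq_gcd_of_coord_sq_add hε₀ hε₁ hr hf (fun n hn => (hg n hn).1)
      (fun n hn => (hg n hn).2) hiso hfree hmld hne (sum_modEq_add_one hsum) hfour hgcd hdvd

theorem mainTheorem8 (ε : ℝ) (hε₀ : 0 < ε) (hε₁ : ε < 1 / 6) (M : ℕ) :
    ∃ Γ : Finset ℕ, ∀ (r : ℕ) (a : Fin 4 → ℕ) (e : ℕ) (f : Hyperquotient.ConvSeries),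
      Hyperquotient.IsHyperquotientSingularity ε r a e f →
      (∑ i, (a i : ℤ)) - (e : ℤ) ≡ 1 [ZMOD (r : ℤ)] →
      (Hyperquotient.IsOddType r a f ∨ Hyperquotient.IsCDEType f) →
      Hyperquotient.SpecialAlternative M ε r a e f →
      r ∈ Γ :=
  ⟨Finset.range (M + 1), fun _ _ _ _ h hsum htype hs => Finset.mem_range_succ_iff.2 <|
    (mainTheorem8_general (by linarith) hε₁.le (Nat.ne_zero_of_lt h.e_lt) h.semiInvariant
      h.isolated h.indexOneCover.1 h.le_mld
      (Hyperquotient.logDiscrepancies_nonempty h.mld_lt.ne_top) hsum (htype.imp_left And.right)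
      (le_trans (by norm_num) hs.seven_le) hs.gcd_eq hs.dvd_mul).trans_le hs.gcd_le⟩
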